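/- Let $K=(0,1)^2$ with edges $\ell_1,\dots,\ell_4$ and outward unit normal $\mathbf n$, let $p\ge 1$ be an integer and $r>0$ a real number. All functions are complex valued. **Spaces.** $H^r(K)$ is the Sobolev(-Slobodetskij) space, $\tilde H^{-1/2}(K)=(H^{1/2}(K))'$ (with $L^2(K)$ as pivot space), and $\tilde{\mathbf H}^{-1/2}(\mathrm{div},K)$ is the space of $\mathbf u\in\tilde H^{-1/2}(K)^2$ with $\mathrm{div}\,\mathbf u\in\tilde H^{-1/2}(K)$. $\mathcal P_{p_1,p_2}(K)$ is the space of polynomials of degree $\le p_1$ in the first and $\le p_2$ in the second variable, $\mathcal P_q(K)=\mathcal P_{q,q}(K)$, $\mathcal P^0_p(K)$ is the subspace of $\mathcal P_p(K)$ of polynomials vanishing on $\partial K$, $\mathcal P^0_p(\ell_i)$ is the space of polynomials of degree $\le p$ on $\ell_i$ vanishing at its end points, $\mathcal P^{RT}_p(K)=\mathcal P_{p,p-1}(K)\times\mathcal P_{p-1,p}(K)$, and $\mathcal P^{RT,0}_p(K)$ is its subspace of fields with vanishing normal trace on $\partial K$. **Inner products.** Let $\Omega=K\times(0,1)$. For $f\in\tilde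 H^{-1/2}(K)$ let $w_f\in H^1(\Omega)$ be the weak solution of $\Delta w_f=0$ in $\Omega$, $\partial w_f/\partial n=f$ on $K\times\{0\}$, $\partial w_f/\partial n=0$ on the four lateral faces, $w_f=0$ on $K\times\{1\}$. Put $\langle f,g\rangle_{-1/2,K}=\int_\Omega\nabla w_f\cdot\overline{\nabla w_g}\,dx$; this is an inner product inducing a norm equivalent to that of $\tilde H^{-1/2}(K)$. Let $\Pi^{-1/2}_{q}:\tilde H^{-1/2}(K)\to\mathcal P_q(K)$ be the orthogonal projection with respect to it. Similarly, for $\psi,\phi\in\tilde H^{1/2}(\ell_i)$ put $\langle\psi,\phi\rangle_{\tilde H^{1/2}(\ell_i)}=\int_K\nabla\Psi\cdot\overline{\nabla\Phi}\,dx$, where $\Psi,\Phi\in H^1(K)$ are the harmonic functions on $K$ whose traces are $\psi$, $\phi$ on $\ell_i$ and $0$ on $\partial K\setminus\ell_i$. **Interpolation operator.** Let $\mathbf u\in \mathbf H^r(K)\cap\tilde{\mathbf H}^{-1/2}(\mathrm{div},K)$. Its normal trace on $\partial K$ is defined by Green's formula $\int_{\partial K}(\mathbf u\cdot\mathbf n)\,\Phi\,d\sigma=\langle\mathrm{div}\,\mathbf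 u,\Phi\rangle+\int_K\mathbf u\cdot\nabla\Phi\,dx$; it extends to a bounded functional on $H^{1/2-s}(\partial K)$ for small $s>0$, so that it can be tested with the indicator functions of the edges. Define $\Pi^{\mathrm{div},-1/2}_p\mathbf u=\mathbf u_1+\mathbf u_2^p+\mathbf u_3^p\in\mathcal P^{RT}_p(K)$ as follows. 1. $\mathbf u_1=\sum_{i=1}^4\big(\int_{\ell_i}\mathbf u\cdot\mathbf n\,d\sigma\big)\boldsymbol\phi_i$, where $\boldsymbol\phi_i\in\mathcal P^{RT}_1(K)$ satisfies $\boldsymbol\phi_i\cdot\mathbf n=1$ on $\ell_i$ and $\boldsymbol\phi_i\cdot\mathbf n=0$ on $\partial K\setminus\ell_i$. 2. Let $\psi$ be the continuous function on $\partial K$ with (counterclockwise) tangential derivative $\partial\psi/\partial\sigma=(\mathbf u-\mathbf u_1)\cdot\mathbf n$ and $\psi=0$ at the vertices. Let $\psi_2^{\ell_i}\in\mathcal P_p^0(\ell_i)$ be the orthogonal projection of $\psi|_{\ell_i}$ with respect to $\langle\cdot,\cdot\rangle_{\tilde H^{1/2}(\ell_i)}$, let $\psi_{2,p}^{\ell_i}\in\mathcal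 P_p(K)$ be any polynomial with $\psi_{2,p}^{\ell_i}=\psi_2^{\ell_i}$ on $\ell_i$ and $\psi_{2,p}^{\ell_i}=0$ on $\partial K\setminus\ell_i$, and put $\mathbf u_2^p=\sum_{i=1}^4\mathbf{curl}\,\psi_{2,p}^{\ell_i}$, where $\mathbf{curl}\,\psi=(\partial_2\psi,-\partial_1\psi)$. 3. $\mathbf u_3^p\in\mathcal P^{RT,0}_p(K)$ is the solution of $$\langle\mathrm{div}(\mathbf u-(\mathbf u_1+\mathbf u_2^p+\mathbf u_3^p)),\mathrm{div}\,\mathbf v\rangle_{-1/2,K}=0\quad\forall\,\mathbf v\in\mathcal P^{RT,0}_p(K),$$ $$\int_K(\mathbf u-(\mathbf u_1+\mathbf u_2^p+\mathbf u_3^p))\cdot\overline{\mathbf{curl}\,\phi}\,dx=0\quad\forall\,\phi\in\mathcal P^0_p(K).$$ **Proposition.** For every $r>0$, every integer $p\ge1$ and every $\mathbf u\in\mathbf H^r(K)\cap\tilde{\mathbf H}^{-1/2}(\mathrm{div},K)$, $$\mathrm{div}\big(\Pi^{\mathrm{div},-1/2}_p\mathbf u\big)=\Pi^{-1/2}_{p-1}(\mathrm{div}\,\mathbf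 u).$$ -/

import Mathlib

open MeasureTheory Filter Topology Set
open scoped ContDiff Distributions ComplexConjugate

noncomputable section

namespace RTInterp

/-! ### Sobolev spaces on the reference square -/

/-- `ℝⁿ` with the Euclidean norm and Lebesgue measure. -/
abbrev E (n : ℕ) : Type := EuclideanSpace ℝ (Fin n)

/-- The open unit box `(0,1)ⁿ`. -/
def box (n : ℕ) : TopologicalSpace.Opens (E n) where
  carrier := {x | ∀ i, x i ∈ Ioo (0 : ℝ) 1}
  is_open' := by
    have h : {x : E n | ∀ i, x i ∈ Ioo (0 : ℝ) 1} = ⋂ i, {x : E n | x i ∈ Ioo (0 : ℝ) 1} := by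
      ext x; simp
    rw [h]
    exact isOpen_iInter_of_finite fun i =>
      isOpen_Ioo.preimage (by fun_prop : Continuous fun x : E n => x i)

/-- The reference square `K = (0,1)²`; the cube `Ω = K × (0,1)` is `box 3`. -/
abbrev K : TopologicalSpace.Opens (E 2) := box 2

/-- Lebesgue measure on the unit box. -/
abbrev boxVol (n : ℕ) : Measure (E n) := volume.restrict (box n : Set (E n))

/-- The `i`-th classical partial derivative. -/
def pd {n : ℕ} (i : Fin n) (f : E n → ℂ) (x : E n) : ℂ :=
  fderiv ℝ f x (EuclideanSpace.single i 1)

/-- The difference quotient `|x - y|^{-(n/2+σ)} (f(x) - f(y))`, whose `L²` norm over the product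
of the box with itself is the Slobodetskij seminorm of order `σ ∈ (0,1)`. -/
def slobodetskij {n : ℕ} (σ : ℝ) (f : E n → ℂ) : E n × E n → ℂ :=
  fun z => (‖z.1 - z.2‖ ^ (-((n : ℝ) / 2 + σ)) : ℝ) • (f z.1 - f z.2)

/-- `g` is the weak partial derivative `∂ᵢ f` in the unit box. -/
def IsWeakPartial {n : ℕ} (i : Fin n) (f g : E n → ℂ) : Prop :=
  ∀ φ : 𝓓(box n, ℂ), ∫ x, f x * pd i φ x ∂(boxVol n) = -∫ x, g x * φ x ∂(boxVol n)

/-- `f ∈ H^{m+σ}` on the unit box, for `0 ≤ σ < 1`: all weak derivatives of order at most `m` are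
square integrable and, if `σ > 0`, those of order `m` have finite Slobodetskij seminorm. -/
def MemSobolevAux {n : ℕ} (σ : ℝ) : ℕ → (E n → ℂ) → Prop
  | 0, f => MemLp f 2 (boxVol n) ∧
      (0 < σ → MemLp (slobodetskij σ f) 2 ((boxVol n).prod (boxVol n)))
  | m + 1, f => MemLp f 2 (boxVol n) ∧
      ∀ i, ∃ g, IsWeakPartial i f g ∧ MemSobolevAux σ m g

/-- `f ∈ H^r` on the unit box, for real `r ≥ 0`. -/
def MemSobolev {n : ℕ} (r : ℝ) (f : E n → ℂ) : Prop :=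
  MemSobolevAux (Int.fract r) ⌊r⌋₊ f

/-- The space `H^{1/2}(K)`. -/
def HHalf : Submodule ℂ (E 2 → ℂ) where
  carrier := {f | MemLp f 2 (boxVol 2) ∧
    MemLp (slobodetskij (1 / 2) f) 2 ((boxVol 2).prod (boxVol 2))}
  zero_mem' := by
    refine ⟨MemLp.zero, ?_⟩
    have : slobodetskij (n := 2) (1 / 2) 0 = 0 := by
      funext z; simp [slobodetskij]
    rw [this]; exact MemLp.zero
  add_mem' := by
    rintro f g ⟨hf, hf'⟩ ⟨hg, hg'⟩
    refine ⟨hf.add hg, ?_⟩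
    have : slobodetskij (n := 2) (1 / 2) (f + g)
        = slobodetskij (1 / 2) f + slobodetskij (1 / 2) g := by
      funext z
      simp only [slobodetskij, Pi.add_apply, ← smul_add]
      congr 1; ring
    rw [this]; exact hf'.add hg'
  smul_mem' := by
    rintro c f ⟨hf, hf'⟩
    refine ⟨hf.const_smul c, ?_⟩
    have : slobodetskij (n := 2) (1 / 2) (c • f) = c • slobodetskij (1 / 2) f := by
      funext z
      simp only [slobodetskij, Pi.smul_apply, smul_eq_mul, Complex.real_smul]
      ring
    rw [this]; exact hf'.const_smul c

/-- The norm of `H^{1/2}(K)`: `(‖f‖²_{L²} + |f|²_{H^{1/2}})^{1/2}`. -/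
def hHalfNorm (f : E 2 → ℂ) : ℝ :=
  Real.sqrt ((eLpNorm f 2 (boxVol 2)).toReal ^ 2 +
    (eLpNorm (slobodetskij (1 / 2) f) 2 ((boxVol 2).prod (boxVol 2))).toReal ^ 2)

/-- `D` belongs to the dual space `H̃^{-1/2}(K) = (H^{1/2}(K))'`. The dual pairing is the bilinear
one, so that an `L²` function `f` acts by `v ↦ ∫_K f v`. -/
def MemHTildeNegHalf (D : Module.Dual ℂ HHalf) : Prop :=
  ∃ C : ℝ, ∀ v : HHalf, ‖D v‖ ≤ C * hHalfNorm v

open Classical in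
/-- The value of a functional on a function, which is `D f` for `f ∈ H^{1/2}(K)`
(and `0` by convention for other functions). -/
def pairing (D : Module.Dual ℂ HHalf) (f : E 2 → ℂ) : ℂ :=
  if h : f ∈ HHalf then D ⟨f, h⟩ else 0

open Classical in
/-- The functional `v ↦ ∫_K f v` given by `f ∈ L²(K)` (and `0` by convention for other `f`). -/
def ofL2 (f : E 2 → ℂ) : Module.Dual ℂ HHalf :=
  if hf : MemLp f 2 (boxVol 2) then
    { toFun := fun v => ∫ x, f x * (v : E 2 → ℂ) x ∂(boxVol 2)
      map_add' := fun v w => by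
        have hv := hf.integrable_mul v.2.1
        have hw := hf.integrable_mul w.2.1
        simp only [Submodule.coe_add, Pi.add_apply, mul_add]
        exact integral_add hv hw
      map_smul' := fun c v => by
        simp only [Submodule.coe_smul, Pi.smul_apply, smul_eq_mul, RingHom.id_apply]
        rw [← integral_const_mul]
        congr 1; funext x; ring }
  else 0

/-- `D` extends the distributional divergence of the vector field `u` on `K`. -/
def IsDistDiv (u : Fin 2 → E 2 → ℂ) (D : Module.Dual ℂ HHalf) : Prop :=
  ∀ φ : 𝓓(K, ℂ), pairing D φ = -∫ x, ∑ j, u j x * pd j φ x ∂(boxVol 2)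

/-- For a field `u ∈ L²(K)² ⊆ H̃^{-1/2}(K)²`, this says that `u ∈ H̃^{-1/2}(div, K)`, that is,
`div u ∈ H̃^{-1/2}(K)`. -/
def MemHTildeDiv (u : Fin 2 → E 2 → ℂ) : Prop :=
  ∃ D, MemHTildeNegHalf D ∧ IsDistDiv u D

open Classical in
/-- `div u` as an element of `H̃^{-1/2}(K)`; it is unique because test functions are dense in
`H^{1/2}(K)`. -/
def divNegHalf (u : Fin 2 → E 2 → ℂ) : Module.Dual ℂ HHalf :=
  if h : MemHTildeDiv u then h.choose else 0

/-! ### The inner product of `H̃^{-1/2}(K)` -/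

/-- Smooth functions on `ℝ³` which vanish on the top face `Γ₆ = K × {1}` of the cube. -/
def IsTopZero (z : E 3 → ℂ) : Prop :=
  ContDiff ℝ ∞ z ∧ ∀ a ∈ Ioo (0 : ℝ) 1, ∀ b ∈ Ioo (0 : ℝ) 1, z !₂[a, b, 1] = 0

/-- `w ∈ H¹(Ω)`, with weak gradient `G`, is the solution of the mixed problem `Δw = 0` in the cube
`Ω = K × (0,1)`, `∂w/∂n = D` on the bottom face `K × {0}`, `∂w/∂n = 0` on the four lateral faces,
`w = 0` on the top face. The first three conjuncts say that `w` lies in the closure in `H¹(Ω)`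
of the smooth functions vanishing on the top face, the last one is the weak form of the problem. -/
def IsMixedSolution (D : Module.Dual ℂ HHalf) (w : E 3 → ℂ) (G : Fin 3 → E 3 → ℂ) : Prop :=
  MemLp w 2 (boxVol 3) ∧ (∀ i, MemLp (G i) 2 (boxVol 3)) ∧
  (∃ z : ℕ → E 3 → ℂ, (∀ k, IsTopZero (z k)) ∧
    Tendsto (fun k => eLpNorm (fun x => z k x - w x) 2 (boxVol 3)) atTop (𝓝 0) ∧
    ∀ i, Tendsto (fun k => eLpNorm (fun x => pd i (z k) x - G i x) 2 (boxVol 3)) atTop (𝓝 0)) ∧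
  ∀ z, IsTopZero z →
    ∫ x, ∑ i, G i x * pd i z x ∂(boxVol 3) = pairing D (fun x => z !₂[x 0, x 1, 0])

open Classical in
/-- The gradient of the solution of the mixed problem with Neumann datum `D`. -/
def mixedGrad (D : Module.Dual ℂ HHalf) : Fin 3 → E 3 → ℂ :=
  if h : ∃ w G, IsMixedSolution D w G then h.choose_spec.choose else 0

/-- The inner product of `H̃^{-1/2}(K)`: the `L²(Ω)` inner product of the gradients of the solutions
of the mixed problems. -/
def negHalfInner (D D' : Module.Dual ℂ HHalf) : ℂ :=
  ∫ x, ∑ i, mixedGrad D i x * conj (mixedGrad D' i x) ∂(boxVol 3)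

/-! ### Polynomial spaces -/

/-- Polynomials in the two coordinates of the square. -/
abbrev Poly : Type := MvPolynomial (Fin 2) ℂ

/-- The polynomial as a function on the plane. -/
def Poly.fn (P : Poly) (x : E 2) : ℂ := MvPolynomial.eval (fun j => (x j : ℂ)) P

/-- `𝒫_{p₁,p₂}(K)`: degree at most `p₁` in the first variable and at most `p₂` in the second. -/
def IsPoly (p₁ p₂ : ℕ) (P : Poly) : Prop := P.degreeOf 0 ≤ p₁ ∧ P.degreeOf 1 ≤ p₂

/-- The counterclockwise arc length parametrisations, over `[0,1]`, of the bottom, right, top and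
left edge of the square. -/
def edge (i : Fin 4) (t : ℝ) : E 2 := ![!₂[t, 0], !₂[1, t], !₂[1 - t, 1], !₂[0, 1 - t]] i

/-- The outward unit normal vectors on the four edges. -/
def normal : Fin 4 → Fin 2 → ℂ := ![![0, -1], ![1, 0], ![0, 1], ![-1, 0]]

/-- `𝒫⁰_p(K)`: polynomials in `𝒫_p(K)` which vanish on the boundary. -/
def IsBubble (p : ℕ) (P : Poly) : Prop :=
  IsPoly p p P ∧ ∀ i, ∀ t ∈ Icc (0 : ℝ) 1, P.fn (edge i t) = 0

/-- The Raviart-Thomas space `𝒫_{p,p-1}(K) × 𝒫_{p-1,p}(K)` of order `p ≥ 1`. -/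
def IsRT (p : ℕ) (V : Fin 2 → Poly) : Prop := IsPoly p (p - 1) (V 0) ∧ IsPoly (p - 1) p (V 1)

/-- Raviart-Thomas fields with vanishing normal trace on the boundary. -/
def IsRTBubble (p : ℕ) (V : Fin 2 → Poly) : Prop :=
  IsRT p V ∧ ∀ i, ∀ t ∈ Icc (0 : ℝ) 1, ∑ j, (V j).fn (edge i t) * normal i j = 0

/-- The divergence of a polynomial vector field. -/
def polyDiv (V : Fin 2 → Poly) : Poly := MvPolynomial.pderiv 0 (V 0) + MvPolynomial.pderiv 1 (V 1)

/-- The vector curl `(∂₂P, -∂₁P)` of a polynomial. -/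
def polyCurl (P : Poly) : Fin 2 → Poly := ![MvPolynomial.pderiv 1 P, -MvPolynomial.pderiv 0 P]

/-- `Q` is the `H̃^{-1/2}(K)`-orthogonal projection of `D` onto `𝒫_q(K)`. -/
def IsNegHalfProj (q : ℕ) (D : Module.Dual ℂ HHalf) (Q : Poly) : Prop :=
  IsPoly q q Q ∧ ∀ V : Poly, IsPoly q q V → negHalfInner (D - ofL2 Q.fn) (ofL2 V.fn) = 0

open Classical in
/-- The `H̃^{-1/2}(K)`-orthogonal projector onto `𝒫_q(K)`. -/
def projNegHalf (q : ℕ) (D : Module.Dual ℂ HHalf) : Poly :=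
  if h : ∃ Q, IsNegHalfProj q D Q then h.choose else 0

/-! ### Normal traces and the lowest order interpolant -/

/-- The normal trace functional `Φ ↦ ∫_{∂K} (u · n) Φ dσ`, defined by Green's formula
`⟨D, Φ⟩ + ∫_K u · ∇Φ`, of a field `u` with divergence `D`. -/
def normalTrace (D : Module.Dual ℂ HHalf) (u : Fin 2 → E 2 → ℂ) (Φ : E 2 → ℂ) : ℂ :=
  pairing D Φ + ∫ x, ∑ j, u j x * pd j Φ x ∂(boxVol 2)

/-- The distances of a point of the square to the four edges. -/
def edgeDist (i : Fin 4) (x : E 2) : ℝ := ![x 1, 1 - x 0, 1 - x 1, x 0] i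

/-- A lift to the square of the indicator function of the edge `ℓᵢ`: the inverse distance weight.
It is smooth in `K`, its boundary values are `1` on `ℓᵢ` and `0` on the other edges, and it belongs
to `H^{1-s}(K)` for all `0 < s < 1` (its gradient is bounded by a multiple of the inverse distance
to the vertices). The four lifts sum to `1`. -/
def edgeLift (i : Fin 4) (x : E 2) : ℂ :=
  (((edgeDist i x)⁻¹ / ∑ j, (edgeDist j x)⁻¹ : ℝ) : ℂ)

/-- The normal flux `∫_{ℓᵢ} u · n dσ`, that is, the normal trace of `u`, a functional in
`H^{-1/2+s}(∂K)` for small `s > 0`, tested with the indicator function of the edge. Its value does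
not depend on which lift of the indicator function to `H^{1-s}(K)` is used in Green's formula. -/
def edgeFlux (u : Fin 2 → E 2 → ℂ) (i : Fin 4) : ℂ :=
  normalTrace (divNegHalf u) u (edgeLift i)

open MvPolynomial in
/-- The basis of the lowest order Raviart-Thomas space: the normal component of the `i`-th field is
`1` on `ℓᵢ` and `0` on the other edges. -/
def rtBasis : Fin 4 → Fin 2 → Poly :=
  ![![0, X 1 - 1], ![X 0, 0], ![0, X 1], ![X 0 - 1, 0]]

/-- The lowest order interpolant `u₁`. -/
def lowest (u : Fin 2 → E 2 → ℂ) : Fin 2 → Poly := ∑ i, edgeFlux u i • rtBasis i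

/-! ### The edge interpolants -/

/-- `ψ`, given on each of the edges in its arc length parameter, is continuous on `∂K`, vanishes at
the vertices, and its tangential derivative is the normal trace on `∂K` of the field `u` with
divergence `D`. -/
def IsBoundaryPotential (D : Module.Dual ℂ HHalf) (u : Fin 2 → E 2 → ℂ) (ψ : Fin 4 → ℝ → ℂ) :
    Prop :=
  (∀ i, ContinuousOn (ψ i) (Icc 0 1) ∧ ψ i 0 = 0 ∧ ψ i 1 = 0) ∧
  ∀ Φ : E 2 → ℂ, ContDiff ℝ ∞ Φ →
    normalTrace D u Φ = -∑ i, ∫ t in (0 : ℝ)..1, ψ i t * deriv (fun s => Φ (edge i s)) t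

open Classical in
/-- The function `ψ` on `∂K` with `∂ψ/∂σ = (u - u₁) · n` and `ψ = 0` at the vertices. -/
def potential (u : Fin 2 → E 2 → ℂ) : Fin 4 → ℝ → ℂ :=
  if h : ∃ ψ, IsBoundaryPotential (divNegHalf u - ofL2 (polyDiv (lowest u)).fn)
      (fun j x => u j x - (lowest u j).fn x) ψ then h.choose else 0

/-- `w ∈ H¹(K)`, with weak gradient `G`, is the harmonic function on `K` whose trace is `f` on the
edge `ℓᵢ` and `0` on the other edges. The trace of `w` is the `L²` limit of the boundary values of
smooth functions which converge to `w` in `H¹(K)`. -/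
def IsHarmonicExt (i : Fin 4) (f : ℝ → ℂ) (w : E 2 → ℂ) (G : Fin 2 → E 2 → ℂ) : Prop :=
  MemLp w 2 (boxVol 2) ∧ (∀ j, MemLp (G j) 2 (boxVol 2)) ∧
  (∃ z : ℕ → E 2 → ℂ, (∀ k, ContDiff ℝ ∞ (z k)) ∧
    Tendsto (fun k => eLpNorm (fun x => z k x - w x) 2 (boxVol 2)) atTop (𝓝 0) ∧
    (∀ j, Tendsto (fun k => eLpNorm (fun x => pd j (z k) x - G j x) 2 (boxVol 2)) atTop (𝓝 0)) ∧
    ∀ l, Tendsto (fun k => eLpNorm (fun t => z k (edge l t) - if l = i then f t else 0) 2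
      (volume.restrict (Ioo (0 : ℝ) 1))) atTop (𝓝 0)) ∧
  ∀ φ : 𝓓(K, ℂ), ∫ x, ∑ j, G j x * pd j φ x ∂(boxVol 2) = 0

open Classical in
/-- The gradient of the harmonic extension to `K` of the extension by zero to `∂K` of a function
on the edge `ℓᵢ`. -/
def harmonicGrad (i : Fin 4) (f : ℝ → ℂ) : Fin 2 → E 2 → ℂ :=
  if h : ∃ w G, IsHarmonicExt i f w G then h.choose_spec.choose else 0

/-- The inner product of `H̃^{1/2}(ℓᵢ)`. -/
def edgeInner (i : Fin 4) (f g : ℝ → ℂ) : ℂ :=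
  ∫ x, ∑ j, harmonicGrad i f j x * conj (harmonicGrad i g j x) ∂(boxVol 2)

/-- `𝒫⁰_p` on an edge: polynomials of degree at most `p` which vanish at the end points. -/
def IsEdgeBubble (p : ℕ) (q : Polynomial ℂ) : Prop :=
  q.natDegree ≤ p ∧ q.eval 0 = 0 ∧ q.eval 1 = 0

/-- `q` is the `H̃^{1/2}(ℓᵢ)`-orthogonal projection of `f` onto `𝒫⁰_p(ℓᵢ)`. -/
def IsEdgeProj (p : ℕ) (i : Fin 4) (f : ℝ → ℂ) (q : Polynomial ℂ) : Prop :=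
  IsEdgeBubble p q ∧ ∀ φ : Polynomial ℂ, IsEdgeBubble p φ →
    edgeInner i (fun t => f t - q.eval (t : ℂ)) (fun t => φ.eval (t : ℂ)) = 0

open Classical in
/-- The polynomial `ψ₂` on the edge `ℓᵢ`. -/
def edgePoly (p : ℕ) (u : Fin 2 → E 2 → ℂ) (i : Fin 4) : Polynomial ℂ :=
  if h : ∃ q, IsEdgeProj p i (potential u i) q then h.choose else 0

/-- `P ∈ 𝒫_p(K)` is a polynomial extension of `q`: it equals `q` on `ℓᵢ` and vanishes on the other
edges. -/
def IsEdgeExtension (p : ℕ) (i : Fin 4) (q : Polynomial ℂ) (P : Poly) : Prop :=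
  IsPoly p p P ∧ ∀ l, ∀ t ∈ Icc (0 : ℝ) 1, P.fn (edge l t) = if l = i then q.eval (t : ℂ) else 0

open Classical in
/-- A polynomial extension to `K` of the polynomial on the edge. -/
def edgeExtension (p : ℕ) (u : Fin 2 → E 2 → ℂ) (i : Fin 4) : Poly :=
  if h : ∃ P, IsEdgeExtension p i (edgePoly p u i) P then h.choose else 0

/-- The edge interpolant `u₂ᵖ`. -/
def edgePart (p : ℕ) (u : Fin 2 → E 2 → ℂ) : Fin 2 → Poly :=
  ∑ i, polyCurl (edgeExtension p u i)

/-! ### The interior interpolant and the interpolation operator -/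

/-- The system of equations for the interior interpolant `u₃ᵖ`. -/
def IsInteriorPart (p : ℕ) (u : Fin 2 → E 2 → ℂ) (U : Fin 2 → Poly) : Prop :=
  IsRTBubble p U ∧
  (∀ V, IsRTBubble p V →
    negHalfInner (divNegHalf u - ofL2 (polyDiv (lowest u + edgePart p u + U)).fn)
      (ofL2 (polyDiv V).fn) = 0) ∧
  ∀ P, IsBubble p P →
    ∫ x, ∑ j, (u j x - ((lowest u + edgePart p u + U) j).fn x) * conj ((polyCurl P j).fn x)
      ∂(boxVol 2) = 0

open Classical in
/-- The interior interpolant `u₃ᵖ`. -/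
def interiorPart (p : ℕ) (u : Fin 2 → E 2 → ℂ) : Fin 2 → Poly :=
  if h : ∃ U, IsInteriorPart p u U then h.choose else 0

/-- The `H̃^{-1/2}(div)`-conforming interpolant `u₁ + u₂ᵖ + u₃ᵖ` of `u`. -/
def interp (p : ℕ) (u : Fin 2 → E 2 → ℂ) : Fin 2 → Poly :=
  lowest u + edgePart p u + interiorPart p u

end RTInterp

end

open MeasureTheory Filter Topology Set
open scoped ContDiff Distributions ComplexConjugate

noncomputable section

namespace RTInterp

/-! The projection of $\mathrm{div}\,u$ is the only $Q\in\mathcal P_{p-1}$ with $\mathrm{div}\,u-Q$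
orthogonal to $\mathcal P_{p-1}$, so it suffices to verify this for the divergence $Q$ of the
interpolant. The space $\mathcal P_{p-1}$ is spanned by $1$ and the divergences of Raviart-Thomas
bubbles (`mem_span_one_sup_map_polyDiv`). Against the latter, orthogonality is the first defining
equation of $u_3$. Against $1$ it is conservation of mass: the mixed problem with datum $1$ has the
solution $1-x_3$, whose bottom trace is $1$, so the inner product of $f$ with $1$ is the plain
pairing $\langle f,1\rangle$ (`inner_gradClass_one`). Curls have no divergence, bubbles have
divergence of mean zero, and each lowest order basis field has divergence $1$; hence $\langle
Q,1\rangle$ is the sum of the four edge fluxes. So is $\langle\mathrm{div}\,u,1\rangle$, because the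
four edge lifts sum to $1$ (`sum_edgeFlux`).

The length comes from justifying these steps. Objects picked by choice must be shown to exist
wherever their value matters. For the mixed problem this is Riesz representation
(`exists_riesz_range`), based on a Poincaré inequality and on the trace estimate from $H^1(\Omega)$
to $H^{1/2}(K)$ for smooth functions (`exists_hHalfNorm_bottom_le`). For $u_3$ two successive
orthogonal projections suffice (`exists_isInteriorPart`); uniqueness of $u_3$ plays no role. Nothing
about the edge potentials or their extensions is needed, since every curl is divergence free.

Adding the fluxes requires each edge lift to lie in $H^{1/2}(K)$ (`edgeLift_mem_HHalf`) and each
product of a component of $u$ with a derivative of a lift to be integrable. These derivatives grow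
like the inverse $1/w$ of a weight comparable to the distance to the vertices. A Hardy type argument
shows $f/w\in L^1$ for $f\in H^\sigma(K)$ with any $0<\sigma<1$
(`lintegral_mul_inv_vertexWeight_lt_top`). Orders $r\ge1$ are reduced to $\sigma=1/2$ by the
embedding $H^1(K)\subset H^{1/2}(K)$ (`memLp_slobodetskij_half`). -/

/-- Lebesgue measure on the unit interval. -/
abbrev unitVol : Measure ℝ := volume.restrict (Ioo (0 : ℝ) 1)

/-! ### Product coordinates on the square and the cube -/

lemma measurePreserving_plane :
    MeasurePreserving (fun p : ℝ × ℝ => (!₂[p.1, p.2] : E 2)) volume volume := by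
  have h := (PiLp.volume_preserving_toLp (Fin 2)).comp (volume_preserving_finTwoArrow ℝ).symm
  exact h

lemma measurableEmbedding_plane :
    MeasurableEmbedding (fun p : ℝ × ℝ => (!₂[p.1, p.2] : E 2)) := by
  have h := (MeasurableEquiv.toLp 2 (Fin 2 → ℝ)).measurableEmbedding.comp
    (MeasurableEquiv.finTwoArrow (α := ℝ)).symm.measurableEmbedding
  exact h

lemma mem_K {x : E 2} : x ∈ (K : Set (E 2)) ↔ x 0 ∈ Ioo (0 : ℝ) 1 ∧ x 1 ∈ Ioo (0 : ℝ) 1 := by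
  change (∀ i, x i ∈ Ioo (0 : ℝ) 1) ↔ _
  simp [Fin.forall_fin_two]

lemma measurePreserving_box2 :
    MeasurePreserving (fun p : ℝ × ℝ => (!₂[p.1, p.2] : E 2)) (unitVol.prod unitVol) (boxVol 2) := by
  have h := measurePreserving_plane.restrict_preimage_emb measurableEmbedding_plane
    (box 2 : Set (E 2))
  have hs : (fun p : ℝ × ℝ => (!₂[p.1, p.2] : E 2)) ⁻¹' (box 2 : Set (E 2))
      = Ioo (0 : ℝ) 1 ×ˢ Ioo (0 : ℝ) 1 := by
    ext p
    change !₂[p.1, p.2] ∈ (K : Set (E 2)) ↔ _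
    rw [mem_K]
    simp
  rw [hs, Measure.volume_eq_prod, ← Measure.prod_restrict] at h
  exact h

/-- The point of space above the point `x` of the plane, at height `t`. -/
def lift3 (p : E 2 × ℝ) : E 3 := !₂[p.1 0, p.1 1, p.2]

lemma mem_box3 {x : E 3} : x ∈ (box 3 : Set (E 3)) ↔
    x 0 ∈ Ioo (0 : ℝ) 1 ∧ x 1 ∈ Ioo (0 : ℝ) 1 ∧ x 2 ∈ Ioo (0 : ℝ) 1 := by
  change (∀ i, x i ∈ Ioo (0 : ℝ) 1) ↔ _
  simp [Fin.forall_fin_succ]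

lemma measurePreserving_lift3_aux :
    MeasurePreserving lift3 volume volume ∧ MeasurableEmbedding lift3 := by
  have h1 := (volume_preserving_piFinSuccAbove (fun _ : Fin 3 => ℝ) (Fin.last 2)).symm
  have h2 : MeasurePreserving (Prod.swap : (Fin 2 → ℝ) × ℝ → ℝ × (Fin 2 → ℝ)) volume volume :=
    Measure.measurePreserving_swap
  have h3 : MeasurePreserving (Prod.map (WithLp.ofLp : E 2 → _) (id : ℝ → ℝ)) volume volume :=
    (PiLp.volume_preserving_ofLp (Fin 2)).prod (MeasurePreserving.id _)
  have h4 := (PiLp.volume_preserving_toLp (Fin 3)).comp (h1.comp (h2.comp h3))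
  have h5 : MeasurableEmbedding (Prod.map (WithLp.ofLp : E 2 → _) (id : ℝ → ℝ)) :=
    ((MeasurableEquiv.toLp 2 (Fin 2 → ℝ)).symm.prodCongr (MeasurableEquiv.refl ℝ)).measurableEmbedding
  have h6 := (MeasurableEquiv.toLp 2 (Fin 3 → ℝ)).measurableEmbedding.comp
    ((MeasurableEquiv.piFinSuccAbove (fun _ : Fin 3 => ℝ) (Fin.last 2)).symm.measurableEmbedding.comp
      ((MeasurableEquiv.prodComm (α := Fin 2 → ℝ) (β := ℝ)).measurableEmbedding.comp h5))
  have key : ∀ x : E 2 × ℝ, lift3 x = WithLp.toLp 2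
      ((MeasurableEquiv.piFinSuccAbove (fun _ : Fin 3 => ℝ) (Fin.last 2)).symm
        (x.2, WithLp.ofLp x.1)) := by
    intro x
    ext i
    fin_cases i <;> simp [lift3, MeasurableEquiv.piFinSuccAbove, Fin.insertNthEquiv] <;> rfl
  constructor
  · rw [funext key]; exact h4
  · rw [funext key]; exact h6

lemma measurableEmbedding_lift3 : MeasurableEmbedding lift3 := measurePreserving_lift3_aux.2

lemma measurePreserving_box3 :
    MeasurePreserving lift3 ((boxVol 2).prod unitVol) (boxVol 3) := by
  have h := measurePreserving_lift3_aux.1.restrict_preimage_emb measurableEmbedding_lift3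
    (box 3 : Set (E 3))
  have hs : lift3 ⁻¹' (box 3 : Set (E 3)) = (K : Set (E 2)) ×ˢ Ioo (0 : ℝ) 1 := by
    ext p
    change lift3 p ∈ (box 3 : Set (E 3)) ↔ (p.1 ∈ (K : Set (E 2)) ∧ p.2 ∈ Ioo (0 : ℝ) 1)
    rw [mem_K, mem_box3]
    simp [lift3, and_assoc]
  rw [hs, Measure.volume_eq_prod, ← Measure.prod_restrict] at h
  exact h

lemma lintegral_box2 (F : E 2 → ENNReal) :
    ∫⁻ x, F x ∂(boxVol 2) = ∫⁻ p, F !₂[p.1, p.2] ∂(unitVol.prod unitVol) :=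
  (measurePreserving_box2.lintegral_comp_emb measurableEmbedding_plane F).symm

lemma lintegral_box3 (F : E 3 → ENNReal) :
    ∫⁻ x, F x ∂(boxVol 3) = ∫⁻ p, F (lift3 p) ∂((boxVol 2).prod unitVol) :=
  (measurePreserving_box3.lintegral_comp_emb measurableEmbedding_lift3 F).symm

lemma integral_box2 (F : E 2 → ℂ) :
    ∫ x, F x ∂(boxVol 2) = ∫ p, F !₂[p.1, p.2] ∂(unitVol.prod unitVol) :=
  (measurePreserving_box2.integral_comp measurableEmbedding_plane F).symm

lemma box_subset_closedBall (n : ℕ) : (box n : Set (E n)) ⊆ Metric.closedBall 0 (Real.sqrt n) := by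
  intro x hx
  have hx' : ∀ i, x i ∈ Ioo (0 : ℝ) 1 := hx
  rw [mem_closedBall_zero_iff, EuclideanSpace.norm_eq]
  apply Real.sqrt_le_sqrt
  calc ∑ i, ‖x i‖ ^ 2 ≤ ∑ _i : Fin n, (1 : ℝ) := by
        refine Finset.sum_le_sum fun i _ => ?_
        have := hx' i
        rw [Real.norm_eq_abs, sq_abs]
        nlinarith [this.1, this.2]
    _ = n := by simp

instance isFiniteMeasure_boxVol (n : ℕ) : IsFiniteMeasure (boxVol n) := by
  refine ⟨?_⟩
  rw [Measure.restrict_apply_univ]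
  exact (measure_mono (box_subset_closedBall n)).trans_lt measure_closedBall_lt_top

lemma ae_boxVol_mem (n : ℕ) : ∀ᵐ x ∂(boxVol n), x ∈ (box n : Set (E n)) :=
  ae_restrict_mem (box n).isOpen.measurableSet

lemma memLp_boxVol_of_continuous {n : ℕ} {f : E n → ℂ} (hf : Continuous f) (p : ENNReal) :
    MemLp f p (boxVol n) := by
  obtain ⟨C, hC⟩ := (isCompact_closedBall (0 : E n) (Real.sqrt n)).exists_bound_of_continuousOn
    hf.continuousOn
  refine MemLp.of_bound hf.aestronglyMeasurable C ?_
  filter_upwards [ae_boxVol_mem n] with x hx using hC x (box_subset_closedBall n hx)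

lemma ae_boxVol_of_continuous {n : ℕ} {f : E n → ℂ} (hf : Continuous f)
    (h : f =ᵐ[boxVol n] 0) : ∀ x ∈ (box n : Set (E n)), f x = 0 := by
  intro x hx
  exact Measure.eqOn_open_of_ae_eq h (box n).isOpen hf.continuousOn continuousOn_const hx

/-! ### Polynomials as functions -/

lemma hasFDerivAt_coord {n : ℕ} (j : Fin n) (x : E n) :
    HasFDerivAt (fun x : E n => (x j : ℂ))
      (Complex.ofRealCLM.comp (EuclideanSpace.proj j : E n →L[ℝ] ℝ)) x :=
  (Complex.ofRealCLM.comp (EuclideanSpace.proj j : E n →L[ℝ] ℝ)).hasFDerivAt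

lemma Poly.contDiff_fn (P : Poly) : ContDiff ℝ ∞ (Poly.fn P) := by
  induction P using MvPolynomial.induction_on with
  | C a => 
    have : Poly.fn (MvPolynomial.C a) = fun _ => a := by funext x; simp [Poly.fn]
    rw [this]; exact contDiff_const
  | add P Q hP hQ =>
    have : Poly.fn (P + Q) = fun x => (Poly.fn P) x + (Poly.fn Q) x := by funext x; simp [Poly.fn]
    rw [this]; exact hP.add hQ
  | mul_X P i hP =>
    have : Poly.fn (P * MvPolynomial.X i) = fun x => (Poly.fn P) x * (x i : ℂ) := by
      funext x; simp [Poly.fn]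
    rw [this]
    exact hP.mul (Complex.ofRealCLM.comp (EuclideanSpace.proj i : E 2 →L[ℝ] ℝ)).contDiff

lemma Poly.continuous_fn (P : Poly) : Continuous (Poly.fn P) := P.contDiff_fn.continuous

lemma Poly.differentiable_fn (P : Poly) : Differentiable ℝ (Poly.fn P) :=
  P.contDiff_fn.differentiable (by simp)

lemma Poly.fderiv_fn_apply (P : Poly) (x v : E 2) :
    fderiv ℝ (Poly.fn P) x v = ∑ j, Poly.fn (MvPolynomial.pderiv j P) x * (v j : ℂ) := by
  induction P using MvPolynomial.induction_on with
  | C a => 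
    have : Poly.fn (MvPolynomial.C a) = fun _ => a := by funext x; simp [Poly.fn]
    rw [this]; simp [Poly.fn]
  | add P Q hP hQ =>
    have : Poly.fn (P + Q) = (Poly.fn P) + (Poly.fn Q) := by funext x; simp [Poly.fn]
    rw [this, fderiv_add (Poly.differentiable_fn P x) (Poly.differentiable_fn Q x)]
    simp only [_root_.add_apply, hP, hQ, ← Finset.sum_add_distrib]
    simp [Poly.fn, add_mul]
  | mul_X P i hP =>
    have : Poly.fn (P * MvPolynomial.X i) = Poly.fn P * fun x => (x i : ℂ) := by
      funext x; simp [Poly.fn]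
    rw [this, ((Poly.differentiable_fn P x).hasFDerivAt.mul (hasFDerivAt_coord i x)).fderiv]
    simp only [_root_.add_apply, _root_.smul_apply, hP]
    fin_cases i <;> simp [Poly.fn, MvPolynomial.pderiv_X, Pi.single_apply, Fin.sum_univ_two] <;> ring

lemma Poly.eq_zero_of_fn (P : Poly) (h : ∀ x ∈ (K : Set (E 2)), P.fn x = 0) : P = 0 := by
  refine MvPolynomial.funext_set (fun _ : Fin 2 => (fun t : ℝ => (t : ℂ)) '' Ioo (0 : ℝ) 1)
    (fun i => ?_) ?_
  · exact (Ioo_infinite (by norm_num)).image Complex.ofReal_injective.injOn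
  · intro x hx
    have hx' : ∀ i, ∃ t ∈ Ioo (0 : ℝ) 1, (t : ℂ) = x i := fun i => hx i (mem_univ i)
    choose t ht hxt using hx'
    have := h (WithLp.toLp 2 t) ht
    simp only [Poly.fn] at this
    rw [map_zero, ← this]
    congr 1
    simp only [hxt]

lemma Poly.eq_zero_of_ae (P : Poly) (h : P.fn =ᵐ[boxVol 2] 0) : P = 0 :=
  P.eq_zero_of_fn (ae_boxVol_of_continuous P.continuous_fn h)

lemma Poly.fn_add (P Q : Poly) : Poly.fn (P + Q) = P.fn + Q.fn := by
  funext x; simp [Poly.fn]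

lemma Poly.fn_smul (c : ℂ) (P : Poly) : Poly.fn (c • P) = c • P.fn := by
  funext x; simp [Poly.fn]

lemma Poly.memLp_fn (P : Poly) (p : ENNReal) : MemLp P.fn p (boxVol 2) :=
  memLp_boxVol_of_continuous P.continuous_fn p

/-! ### Elementary integrals -/

lemma memLp_two_iff {α : Type*} [MeasurableSpace α] {μ : Measure α} {F : Type*}
    [NormedAddCommGroup F] {f : α → F} :
    MemLp f 2 μ ↔ AEStronglyMeasurable f μ ∧ ∫⁻ x, ‖f x‖ₑ ^ 2 ∂μ < ⊤ := by
  unfold MemLp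
  rw [eLpNorm_lt_top_iff_lintegral_rpow_enorm_lt_top (by norm_num) (by norm_num)]
  simp

lemma eLpNorm_two_sq {α : Type*} [MeasurableSpace α] {μ : Measure α} {F : Type*}
    [NormedAddCommGroup F] (f : α → F) :
    eLpNorm f 2 μ ^ 2 = ∫⁻ x, ‖f x‖ₑ ^ 2 ∂μ := by
  have := eLpNorm_nnreal_pow_eq_lintegral (f := f) (μ := μ) (p := 2) (by norm_num)
  simpa using this

lemma lintegral_rpow_neg_lt_top {q : ℝ} (hq : q < 1) :
    ∫⁻ t, ENNReal.ofReal (t ^ (-q)) ∂unitVol < ⊤ := by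
  have h : IntervalIntegrable (fun t : ℝ => t ^ (-q)) volume 0 1 :=
    intervalIntegral.intervalIntegrable_rpow' (by linarith)
  rw [intervalIntegrable_iff_integrableOn_Ioo_of_le zero_le_one] at h
  exact h.lintegral_lt_top

lemma lintegral_one_sub_rpow_neg_lt_top {q : ℝ} (hq : q < 1) :
    ∫⁻ t, ENNReal.ofReal ((1 - t) ^ (-q)) ∂unitVol < ⊤ := by
  have h : IntervalIntegrable (fun t : ℝ => t ^ (-q)) volume 0 1 :=
    intervalIntegral.intervalIntegrable_rpow' (by linarith)
  have h2 := (h.comp_sub_left 1).symm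
  simp only [sub_zero, sub_self] at h2
  rw [intervalIntegrable_iff_integrableOn_Ioo_of_le zero_le_one] at h2
  exact h2.lintegral_lt_top

/-- Over a common denominator the claim is $1\le t^q+(1-t)^q$. This follows from $t\le t^q$ and
$1-t\le(1-t)^q$, valid for $q\le1$ on the unit interval. It separates the singularities at the two
end points. -/
lemma mul_one_sub_rpow_neg_le {q t : ℝ} (hq : q < 1) (ht : t ∈ Ioo (0 : ℝ) 1) :
    (t * (1 - t)) ^ (-q) ≤ t ^ (-q) + (1 - t) ^ (-q) := by
  have h1 : 0 < t := ht.1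
  have h2 : 0 < 1 - t := by linarith [ht.2]
  rw [Real.rpow_neg (by positivity), Real.rpow_neg h1.le, Real.rpow_neg h2.le,
    Real.mul_rpow h1.le h2.le]
  have h3 : 0 < t ^ q := by positivity
  have h4 : 0 < (1 - t) ^ q := by positivity
  have h5 : 1 ≤ t ^ q + (1 - t) ^ q := by
    have e1 : t ≤ t ^ q := by
      simpa using Real.rpow_le_rpow_of_exponent_ge h1 ht.2.le hq.le
    have e2 : 1 - t ≤ (1 - t) ^ q := by
      simpa using Real.rpow_le_rpow_of_exponent_ge h2 (by linarith) hq.le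
    linarith
  rw [← sub_nonneg]
  have : (t ^ q)⁻¹ + ((1 - t) ^ q)⁻¹ - (t ^ q * (1 - t) ^ q)⁻¹
      = (t ^ q + (1 - t) ^ q - 1) * (t ^ q * (1 - t) ^ q)⁻¹ := by
    field_simp; ring
  rw [this]
  exact mul_nonneg (by linarith) (by positivity)

lemma lintegral_mul_one_sub_rpow_neg_lt_top {q : ℝ} (hq : q < 1) :
    ∫⁻ t, ENNReal.ofReal ((t * (1 - t)) ^ (-q)) ∂unitVol < ⊤ := by
  calc ∫⁻ t, ENNReal.ofReal ((t * (1 - t)) ^ (-q)) ∂unitVol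
      ≤ ∫⁻ t, (ENNReal.ofReal (t ^ (-q)) + ENNReal.ofReal ((1 - t) ^ (-q))) ∂unitVol := by
        refine lintegral_mono_ae ?_
        filter_upwards [ae_restrict_mem measurableSet_Ioo] with t ht
        exact (ENNReal.ofReal_le_ofReal (mul_one_sub_rpow_neg_le hq ht)).trans
          ENNReal.ofReal_add_le
    _ < ⊤ := by
        rw [lintegral_add_left (by fun_prop)]
        exact ENNReal.add_lt_top.2
          ⟨lintegral_rpow_neg_lt_top hq, lintegral_one_sub_rpow_neg_lt_top hq⟩

/-! ### The weight at the vertices -/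

/-- A weight equivalent to the distance to the vertices of the square. -/
def vertexWeight (x : E 2) : ℝ := x 0 * (1 - x 0) + x 1 * (1 - x 1)

lemma measurable_vertexWeight : Measurable vertexWeight := by
  unfold vertexWeight; fun_prop

lemma vertexWeight_pos {x : E 2} (hx : x ∈ (K : Set (E 2))) : 0 < vertexWeight x := by
  obtain ⟨⟨h1, h2⟩, h3, h4⟩ := mem_K.1 hx
  have := mul_pos h1 (sub_pos.2 h2)
  have := mul_pos h3 (sub_pos.2 h4)
  unfold vertexWeight; linarith

lemma vertexWeight_le_one (x : E 2) : vertexWeight x ≤ 1 := by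
  unfold vertexWeight
  nlinarith [sq_nonneg (x 0 - 1 / 2), sq_nonneg (x 1 - 1 / 2)]

/-- Split the exponent into $q\theta$ and $q(1-\theta)$, and keep a different summand of the weight
in each factor; negative powers are decreasing. With $\theta=1/2$ this reduces integrability of
$w^{-q}$ for $q<2$ to one variable and the exponent $q/2<1$. -/
lemma vertexWeight_rpow_neg_le {q θ : ℝ} (hq : 0 ≤ q) (hθ : 0 ≤ θ) (hθ1 : θ ≤ 1) {x : E 2}
    (hx : x ∈ (K : Set (E 2))) :
    vertexWeight x ^ (-q) ≤
      (x 0 * (1 - x 0)) ^ (-(q * θ)) * (x 1 * (1 - x 1)) ^ (-(q * (1 - θ))) := by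
  obtain ⟨⟨h1, h2⟩, h3, h4⟩ := mem_K.1 hx
  have ha := mul_pos h1 (sub_pos.2 h2)
  have hb := mul_pos h3 (sub_pos.2 h4)
  have e : vertexWeight x ^ (-q) = vertexWeight x ^ (-(q * θ)) * vertexWeight x ^ (-(q * (1 - θ))) := by
    rw [← Real.rpow_add (vertexWeight_pos hx)]; congr 1; ring
  rw [e]
  refine mul_le_mul ?_ ?_ (Real.rpow_nonneg (vertexWeight_pos hx).le _) (Real.rpow_nonneg ha.le _)
  · refine Real.rpow_le_rpow_of_nonpos ha ?_ (by nlinarith)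
    unfold vertexWeight; linarith
  · refine Real.rpow_le_rpow_of_nonpos hb ?_ (by nlinarith)
    unfold vertexWeight; linarith

lemma lintegral_vertexWeight_rpow_neg_lt_top {q : ℝ} (hq0 : 0 ≤ q) (hq : q < 2) :
    ∫⁻ x, ENNReal.ofReal (vertexWeight x ^ (-q)) ∂(boxVol 2) < ⊤ := by
  set g : ℝ → ENNReal := fun t => ENNReal.ofReal ((t * (1 - t)) ^ (-(q / 2))) with hg
  have hgm : Measurable g := by fun_prop
  calc ∫⁻ x, ENNReal.ofReal (vertexWeight x ^ (-q)) ∂(boxVol 2)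
      ≤ ∫⁻ x, g (x 0) * g (x 1) ∂(boxVol 2) := by
        refine lintegral_mono_ae ?_
        filter_upwards [ae_boxVol_mem 2] with x hx
        obtain ⟨⟨h1, h2⟩, h3, h4⟩ := mem_K.1 hx
        have ha := mul_pos h1 (sub_pos.2 h2)
        rw [hg, ← ENNReal.ofReal_mul (Real.rpow_nonneg ha.le _)]
        apply ENNReal.ofReal_le_ofReal
        have := vertexWeight_rpow_neg_le hq0 (θ := 1 / 2) (by norm_num) (by norm_num) hx
        convert this using 3 <;> ring
    _ = (∫⁻ t, g t ∂unitVol) * ∫⁻ t, g t ∂unitVol := by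
        rw [lintegral_box2]
        simp only [Matrix.cons_val_zero, Matrix.cons_val_one]
        exact lintegral_prod_mul hgm.aemeasurable hgm.aemeasurable
    _ < ⊤ := by
        have := lintegral_mul_one_sub_rpow_neg_lt_top (q := q / 2) (by linarith)
        exact ENNReal.mul_lt_top this this

/-! ### Polar coordinates -/

/-- The factor $1/\|\xi\|$ cancels the Jacobian of polar coordinates. All singular double integrals
below are brought to this form. -/
lemma lintegral_polar {Ψ : ℝ → ENNReal} (hΨ : Measurable Ψ) :
    ∫⁻ ξ : E 2, ENNReal.ofReal (‖ξ‖⁻¹) * Ψ ‖ξ‖ =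
      ENNReal.ofReal (2 * Real.pi) * ∫⁻ ρ in Ioi (0 : ℝ), Ψ ρ := by
  rw [← measurePreserving_plane.lintegral_comp_emb measurableEmbedding_plane,
    ← lintegral_comp_polarCoord_symm]
  have hn : ∀ p ∈ polarCoord.target, ‖(!₂[(polarCoord.symm p).1, (polarCoord.symm p).2] : E 2)‖
      = p.1 := by
    intro p hp
    have hp1 : 0 < p.1 := hp.1
    rw [EuclideanSpace.norm_eq]
    simp only [polarCoord_symm_apply, Fin.sum_univ_two, Matrix.cons_val_zero, Matrix.cons_val_one,
      Real.norm_eq_abs, sq_abs]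
    rw [show (p.1 * Real.cos p.2) ^ 2 + (p.1 * Real.sin p.2) ^ 2 = p.1 ^ 2 by
      nlinarith [Real.sin_sq_add_cos_sq p.2]]
    exact Real.sqrt_sq hp1.le
  have hm : MeasurableSet polarCoord.target := polarCoord.open_target.measurableSet
  calc _ = ∫⁻ p in polarCoord.target, Ψ p.1 := by
        refine setLIntegral_congr_fun hm fun p hp => ?_
        have hp1 : 0 < p.1 := hp.1
        simp only [hn p hp]
        rw [smul_eq_mul, ← mul_assoc, ← ENNReal.ofReal_mul hp1.le, mul_inv_cancel₀ hp1.ne']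
        simp
    _ = _ := by
        rw [polarCoord_target, Measure.volume_eq_prod, ← Measure.prod_restrict,
          lintegral_prod _ (by fun_prop)]
        simp only [lintegral_const, Measure.restrict_apply MeasurableSet.univ, univ_inter,
          Real.volume_Ioo]
        rw [lintegral_mul_const _ hΨ, mul_comm]
        congr 2; ring

/-- Since $\|x-y\|^{-3/2}=\|x-y\|^{-1}\|x-y\|^{-1/2}$, extending to the plane with a cutoff at
radius $4$ and translating by $y$ gives a radial integral that no longer depends on $y$. -/
lemma lintegral_norm_sub_rpow_neg_le (y : E 2) (hy : y ∈ (K : Set (E 2))) :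
    ∫⁻ x, ENNReal.ofReal (‖x - y‖ ^ (-(3 / 2) : ℝ)) ∂(boxVol 2) ≤
      ENNReal.ofReal (2 * Real.pi) *
        ∫⁻ ρ in Ioi (0 : ℝ), (Iio (4 : ℝ)).indicator (fun ρ => ENNReal.ofReal (ρ ^ (-(1 / 2) : ℝ))) ρ := by
  rw [← lintegral_polar (by fun_prop (disch := measurability))]
  have h2 : ∀ x ∈ (K : Set (E 2)), ‖x‖ < 2 := fun x hx => by
    have := mem_closedBall_zero_iff.1 (box_subset_closedBall 2 hx)
    have h3 : Real.sqrt ((2 : ℕ) : ℝ) < 2 := by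
      rw [Real.sqrt_lt' (by norm_num)]; norm_num
    linarith
  calc ∫⁻ x, ENNReal.ofReal (‖x - y‖ ^ (-(3 / 2) : ℝ)) ∂(boxVol 2)
      ≤ ∫⁻ x in (K : Set (E 2)), ENNReal.ofReal (‖x - y‖⁻¹) * (Iio (4 : ℝ)).indicator
          (fun ρ => ENNReal.ofReal (ρ ^ (-(1 / 2) : ℝ))) ‖x - y‖ := by
        refine setLIntegral_mono' K.isOpen.measurableSet fun x hx => ?_
        have hlt : ‖x - y‖ < 4 := (norm_sub_le _ _).trans_lt (by linarith [h2 x hx, h2 y hy])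
        rw [indicator_of_mem (show ‖x - y‖ ∈ Iio (4 : ℝ) from hlt),
          ← ENNReal.ofReal_mul (by positivity)]
        apply ENNReal.ofReal_le_ofReal
        rcases (norm_nonneg (x - y)).eq_or_lt with h0 | h0
        · rw [← h0, Real.zero_rpow (by norm_num)]; simp
        · rw [← Real.rpow_neg_one, ← Real.rpow_add h0]; norm_num
    _ ≤ ∫⁻ x, ENNReal.ofReal (‖x - y‖⁻¹) * (Iio (4 : ℝ)).indicator
          (fun ρ => ENNReal.ofReal (ρ ^ (-(1 / 2) : ℝ))) ‖x - y‖ := setLIntegral_le_lintegral _ _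
    _ = _ := lintegral_sub_right_eq_self (fun ξ : E 2 => ENNReal.ofReal (‖ξ‖⁻¹) *
          (Iio (4 : ℝ)).indicator (fun ρ => ENNReal.ofReal (ρ ^ (-(1 / 2) : ℝ))) ‖ξ‖) y

lemma exists_lintegral_norm_sub_le :
    ∃ C : ENNReal, C < ⊤ ∧ ∀ y ∈ (K : Set (E 2)),
      ∫⁻ x, ENNReal.ofReal (‖x - y‖ ^ (-(3 / 2) : ℝ)) ∂(boxVol 2) ≤ C := by
  refine ⟨_, ?_, lintegral_norm_sub_rpow_neg_le⟩
  refine ENNReal.mul_lt_top ENNReal.ofReal_lt_top ?_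
  rw [lintegral_indicator measurableSet_Iio, Measure.restrict_restrict measurableSet_Iio]
  have h : IntervalIntegrable (fun t : ℝ => t ^ (-(1 / 2) : ℝ)) volume 0 4 :=
    intervalIntegral.intervalIntegrable_rpow' (by norm_num)
  rw [intervalIntegrable_iff_integrableOn_Ioo_of_le (by norm_num)] at h
  have e : Iio (4 : ℝ) ∩ Ioi 0 = Ioo 0 4 := by ext; simp [and_comm]
  rw [e]
  exact h.lintegral_lt_top

/-! ### The lifts of the indicator functions of the edges -/

lemma mul_one_sub_lipschitz {s t : ℝ} (hs : s ∈ Ioo (0 : ℝ) 1) (ht : t ∈ Ioo (0 : ℝ) 1) :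
    |s * (1 - s) - t * (1 - t)| ≤ |s - t| := by
  rw [show s * (1 - s) - t * (1 - t) = (s - t) * (1 - s - t) by ring, abs_mul]
  refine mul_le_of_le_one_right (abs_nonneg _) (abs_le.2 ⟨?_, ?_⟩) <;> linarith [hs.1, hs.2, ht.1, ht.2]

/-- The real inverse distance weights of the edges, with the denominators cleared. -/
def edgeWeight (i : Fin 4) (x : E 2) : ℝ :=
  ![1 - x 1, x 0, x 1, 1 - x 0] i *
    (![x 0 * (1 - x 0), x 1 * (1 - x 1), x 0 * (1 - x 0), x 1 * (1 - x 1)] i / vertexWeight x)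

/-- For opposite edges $1/t+1/(1-t)=1/(t(1-t))$, so after clearing denominators only `vertexWeight`
remains below: the lift is singular at the vertices alone. -/
lemma edgeLift_eq (i : Fin 4) {x : E 2} (hx : x ∈ (K : Set (E 2))) :
    edgeLift i x = (edgeWeight i x : ℂ) := by
  obtain ⟨⟨h1, h2⟩, h3, h4⟩ := mem_K.1 hx
  have h2' := sub_pos.2 h2
  have h4' := sub_pos.2 h4
  have hw := vertexWeight_pos hx
  have hs : ∑ j, (edgeDist j x)⁻¹ =
      vertexWeight x / (x 0 * (1 - x 0) * (x 1 * (1 - x 1))) := by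
    simp only [edgeDist, Fin.sum_univ_four, vertexWeight, Matrix.cons_val]
    field_simp
    ring
  unfold edgeLift
  rw [hs]
  congr 1
  fin_cases i <;> simp [edgeDist, edgeWeight] <;> field_simp

lemma abs_mul_sub_mul_le {c c' φ φ' A B : ℝ} (hc : |c| ≤ 1) (hφ : |φ'| ≤ 1) (h1 : |c - c'| ≤ A)
    (h2 : |φ - φ'| ≤ B) : |c * φ - c' * φ'| ≤ A + B := by
  rw [show c * φ - c' * φ' = (c - c') * φ' + c * (φ - φ') by ring]
  refine (abs_add_le _ _).trans ?_
  rw [abs_mul, abs_mul]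
  have := mul_le_mul h1 hφ (abs_nonneg _) ((abs_nonneg _).trans h1)
  have := mul_le_mul hc h2 (abs_nonneg _) zero_le_one
  linarith

/-- The difference is rewritten with the single denominator $a'+b'$ and with coefficients $a/(a+b)$,
$b/(a+b)$ in $[0,1]$. The bound therefore degenerates at only one of the two points, which later
allows integration in the other variable first. -/
lemma abs_div_add_sub_le {a b a' b' : ℝ} (ha : 0 < a) (hb : 0 < b) (ha' : 0 < a') (hb' : 0 < b') :
    |a / (a + b) - a' / (a' + b')| ≤ (|a - a'| + |b - b'|) / (a' + b') := by
  have e : a / (a + b) - a' / (a' + b') =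
      (a / (a + b) * (b' - b) + b / (a + b) * (a - a')) / (a' + b') := by
    field_simp; ring
  rw [e, abs_div, abs_of_pos (add_pos ha' hb')]
  refine div_le_div_of_nonneg_right ?_ (by positivity)
  refine (abs_add_le _ _).trans ?_
  rw [abs_mul, abs_mul, abs_of_pos (by positivity : 0 < a / (a + b)),
    abs_of_pos (by positivity : 0 < b / (a + b)), abs_sub_comm b' b]
  have h1 : a / (a + b) ≤ 1 := (div_le_one (by positivity)).2 (by linarith)
  have h2 : b / (a + b) ≤ 1 := (div_le_one (by positivity)).2 (by linarith)
  nlinarith [abs_nonneg (a - a'), abs_nonneg (b - b')]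

lemma abs_coord_sub_le {n : ℕ} (x y : E n) (i : Fin n) : |x i - y i| ≤ ‖x - y‖ := by
  have := PiLp.norm_apply_le (x - y) i
  simpa using this

lemma abs_edgeWeight_sub_le (i : Fin 4) {x y : E 2} (hx : x ∈ (K : Set (E 2)))
    (hy : y ∈ (K : Set (E 2))) :
    |edgeWeight i x - edgeWeight i y| ≤ 3 * (‖x - y‖ / vertexWeight y) := by
  obtain ⟨hx0, hx1⟩ := mem_K.1 hx
  obtain ⟨hy0, hy1⟩ := mem_K.1 hy
  have hx0' := mul_pos hx0.1 (sub_pos.2 hx0.2)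
  have hx1' := mul_pos hx1.1 (sub_pos.2 hx1.2)
  have hy0' := mul_pos hy0.1 (sub_pos.2 hy0.2)
  have hy1' := mul_pos hy1.1 (sub_pos.2 hy1.2)
  have hw := vertexWeight_pos hy
  have h0 := abs_coord_sub_le x y 0
  have h1 := abs_coord_sub_le x y 1
  -- As the weight is at most $1$, the Lipschitz bound of the linear factor is absorbed. It
  -- contributes $1$ to the final constant $3$; the two coordinates in the quotient contribute $2$.
  have hA : ‖x - y‖ ≤ ‖x - y‖ / vertexWeight y :=
    le_div_self (norm_nonneg _) hw (vertexWeight_le_one y)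
  have hq : ∀ a b a' b' : ℝ, 0 < a → 0 < b → 0 < a' → 0 < b' → a' + b' = vertexWeight y →
      |a - a'| ≤ ‖x - y‖ → |b - b'| ≤ ‖x - y‖ →
      |a / (a + b) - a' / (a' + b')| ≤ 2 * (‖x - y‖ / vertexWeight y) := by
    intro a b a' b' ha hb ha' hb' hs hd hd'
    refine (abs_div_add_sub_le ha hb ha' hb').trans ?_
    rw [hs, ← mul_div_assoc]
    exact div_le_div_of_nonneg_right (by linarith) hw.le
  have hφ : ∀ a' b' : ℝ, 0 < a' → 0 < b' → |a' / (a' + b')| ≤ 1 := by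
    intro a' b' ha' hb'
    rw [abs_of_pos (by positivity), div_le_one (by positivity)]
    linarith
  have d0 := (mul_one_sub_lipschitz hx0 hy0).trans h0
  have d1 := (mul_one_sub_lipschitz hx1 hy1).trans h1
  have p0 := hq _ _ _ _ hx0' hx1' hy0' hy1' rfl d0 d1
  have p1 := hq _ _ _ _ hx1' hx0' hy1' hy0' (add_comm _ _) d1 d0
  have q0 := hφ _ _ hy0' hy1'
  have q1 := hφ _ _ hy1' hy0'
  have e0 : |x 0| ≤ 1 := abs_le.2 ⟨by linarith [hx0.1], hx0.2.le⟩
  have e1 : |x 1| ≤ 1 := abs_le.2 ⟨by linarith [hx1.1], hx1.2.le⟩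
  have e2 : |1 - x 0| ≤ 1 := abs_le.2 ⟨by linarith [hx0.2], by linarith [hx0.1]⟩
  have e3 : |1 - x 1| ≤ 1 := abs_le.2 ⟨by linarith [hx1.2], by linarith [hx1.1]⟩
  have f2 : |(1 - x 0) - (1 - y 0)| ≤ ‖x - y‖ := by
    rw [show (1 - x 0) - (1 - y 0) = -(x 0 - y 0) by ring, abs_neg]; exact h0
  have f3 : |(1 - x 1) - (1 - y 1)| ≤ ‖x - y‖ := by
    rw [show (1 - x 1) - (1 - y 1) = -(x 1 - y 1) by ring, abs_neg]; exact h1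
  have c : x 1 * (1 - x 1) + x 0 * (1 - x 0) = vertexWeight x := add_comm _ _
  have c' : y 1 * (1 - y 1) + y 0 * (1 - y 0) = vertexWeight y := add_comm _ _
  rw [c, c'] at p1
  rw [c'] at q1
  rw [show 3 * (‖x - y‖ / vertexWeight y)
    = ‖x - y‖ / vertexWeight y + 2 * (‖x - y‖ / vertexWeight y) by ring]
  fin_cases i
  · exact abs_mul_sub_mul_le e3 q0 (f3.trans hA) p0
  · exact abs_mul_sub_mul_le e0 q1 (h0.trans hA) p1
  · exact abs_mul_sub_mul_le e1 q0 (h1.trans hA) p0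
  · exact abs_mul_sub_mul_le e2 q1 (f2.trans hA) p1

lemma edgeWeight_mem_Icc (i : Fin 4) {x : E 2} (hx : x ∈ (K : Set (E 2))) :
    edgeWeight i x ∈ Icc (0 : ℝ) 1 := by
  obtain ⟨⟨h1, h2⟩, h3, h4⟩ := mem_K.1 hx
  have h2' := sub_pos.2 h2
  have h4' := sub_pos.2 h4
  have ha := mul_pos h1 h2'
  have hb := mul_pos h3 h4'
  have key : ∀ c a : ℝ, 0 ≤ c → c ≤ 1 → 0 ≤ a → a ≤ vertexWeight x →
      c * (a / vertexWeight x) ∈ Icc (0 : ℝ) 1 := by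
    intro c a hc hc1 ha0 ha1
    have hq0 : 0 ≤ a / vertexWeight x := div_nonneg ha0 (vertexWeight_pos hx).le
    have hq1 : a / vertexWeight x ≤ 1 := (div_le_one (vertexWeight_pos hx)).2 ha1
    exact ⟨mul_nonneg hc hq0, mul_le_one₀ hc1 hq0 hq1⟩
  have w0 : x 0 * (1 - x 0) ≤ vertexWeight x := by unfold vertexWeight; linarith
  have w1 : x 1 * (1 - x 1) ≤ vertexWeight x := by unfold vertexWeight; linarith
  fin_cases i
  · exact key (1 - x 1) _ h4'.le (by linarith) ha.le w0
  · exact key _ _ h1.le h2.le hb.le w1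
  · exact key _ _ h3.le h4.le ha.le w0
  · exact key (1 - x 0) _ h2'.le (by linarith) hb.le w1

lemma measurable_edgeLift (i : Fin 4) : Measurable (edgeLift i) := by
  have hd : ∀ j, Measurable (edgeDist j) := by
    intro j; unfold edgeDist; fin_cases j <;> simp <;> fun_prop
  unfold edgeLift
  have : Measurable fun x => ∑ j, (edgeDist j x)⁻¹ :=
    Finset.measurable_sum _ fun j _ => (hd j).inv
  exact Complex.measurable_ofReal.comp ((hd i).inv.div this)

lemma norm_edgeLift_sub_le (i : Fin 4) {x y : E 2} (hx : x ∈ (K : Set (E 2)))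
    (hy : y ∈ (K : Set (E 2))) :
    ‖edgeLift i x - edgeLift i y‖ ≤ 3 / vertexWeight y * ‖x - y‖ := by
  rw [edgeLift_eq i hx, edgeLift_eq i hy, ← Complex.ofReal_sub, Complex.norm_real,
    Real.norm_eq_abs]
  refine (abs_edgeWeight_sub_le i hx hy).trans (le_of_eq ?_)
  ring

lemma norm_edgeLift_sub_le_one (i : Fin 4) {x y : E 2} (hx : x ∈ (K : Set (E 2)))
    (hy : y ∈ (K : Set (E 2))) :
    ‖edgeLift i x - edgeLift i y‖ ≤ 1 := by
  rw [edgeLift_eq i hx, edgeLift_eq i hy, ← Complex.ofReal_sub, Complex.norm_real,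
    Real.norm_eq_abs]
  have h1 := edgeWeight_mem_Icc i hx
  have h2 := edgeWeight_mem_Icc i hy
  exact abs_le.2 ⟨by linarith [h1.1, h2.2], by linarith [h1.2, h2.1]⟩

/-- The difference estimate has a constant depending on the base point only, so it bounds the
derivative there without any differentiation of the quotient. -/
lemma norm_fderiv_edgeLift_le (i : Fin 4) {x : E 2} (hx : x ∈ (K : Set (E 2))) :
    ‖fderiv ℝ (edgeLift i) x‖ ≤ 3 / vertexWeight x := by
  refine norm_fderiv_le_of_lip' ℝ (div_nonneg (by norm_num) (vertexWeight_pos hx).le) ?_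
  filter_upwards [K.isOpen.mem_nhds hx] with y hy using norm_edgeLift_sub_le i hy hx

lemma norm_pd_edgeLift_le (i : Fin 4) (j : Fin 2) {x : E 2} (hx : x ∈ (K : Set (E 2))) :
    ‖pd j (edgeLift i) x‖ ≤ 3 / vertexWeight x := by
  refine ((fderiv ℝ (edgeLift i) x).le_opNorm _).trans ?_
  simpa using norm_fderiv_edgeLift_le i hx

lemma sum_edgeLift {x : E 2} (hx : x ∈ (K : Set (E 2))) : ∑ i, edgeLift i x = 1 := by
  have hw := vertexWeight_pos hx
  simp only [edgeLift_eq _ hx]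
  rw [← Complex.ofReal_sum, ← Complex.ofReal_one]
  congr 1
  simp only [edgeWeight, Fin.sum_univ_four, Matrix.cons_val]
  field_simp
  unfold vertexWeight
  ring

lemma differentiableAt_edgeLift (i : Fin 4) {x : E 2} (hx : x ∈ (K : Set (E 2))) :
    DifferentiableAt ℝ (edgeLift i) x := by
  have h : DifferentiableAt ℝ (edgeWeight i) x := by
    have hw : vertexWeight x ≠ 0 := (vertexWeight_pos hx).ne'
    unfold edgeWeight
    unfold vertexWeight at hw ⊢
    fin_cases i <;> simp <;> fun_prop (disch := assumption)
  have h2 : DifferentiableAt ℝ (fun y => (edgeWeight i y : ℂ)) x :=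
    Complex.ofRealCLM.differentiableAt.comp x h
  refine h2.congr_of_eventuallyEq ?_
  filter_upwards [K.isOpen.mem_nhds hx] with y hy using edgeLift_eq i hy

lemma sum_pd_edgeLift (j : Fin 2) {x : E 2} (hx : x ∈ (K : Set (E 2))) :
    ∑ i, pd j (edgeLift i) x = 0 := by
  have h1 : HasFDerivAt (fun y => ∑ i, edgeLift i y) (∑ i, fderiv ℝ (edgeLift i) x) x :=
    HasFDerivAt.fun_sum fun i _ => (differentiableAt_edgeLift i hx).hasFDerivAt
  have h2 : HasFDerivAt (fun y => ∑ i, edgeLift i y) (0 : E 2 →L[ℝ] ℂ) x := by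
    refine (hasFDerivAt_const (1 : ℂ) x).congr_of_eventuallyEq ?_
    filter_upwards [K.isOpen.mem_nhds hx] with y hy using sum_edgeLift hy
  have h3 := h1.unique h2
  have := congrArg (fun L : E 2 →L[ℝ] ℂ => L (EuclideanSpace.single j 1)) h3
  simpa [pd, _root_.sum_apply] using this

lemma memLp_edgeLift (i : Fin 4) : MemLp (edgeLift i) 2 (boxVol 2) := by
  refine MemLp.of_bound (measurable_edgeLift i).aestronglyMeasurable 1 ?_
  filter_upwards [ae_boxVol_mem 2] with x hx
  rw [edgeLift_eq i hx, Complex.norm_real, Real.norm_eq_abs, abs_of_nonneg (edgeWeight_mem_Icc i hx).1]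
  exact (edgeWeight_mem_Icc i hx).2

lemma measurable_slobodetskij {n : ℕ} (σ : ℝ) {f : E n → ℂ} (hf : Measurable f) :
    Measurable (slobodetskij σ f) := by
  unfold slobodetskij; fun_prop

lemma norm_slobodetskij {n : ℕ} (σ : ℝ) (f : E n → ℂ) (z : E n × E n) :
    ‖slobodetskij σ f z‖ = ‖z.1 - z.2‖ ^ (-((n : ℝ) / 2 + σ)) * ‖f z.1 - f z.2‖ := by
  rw [slobodetskij, norm_smul, Real.norm_of_nonneg (by positivity)]

/-- Interpolate between $d\le1$ and $d\le3\rho/w(y)$: $d^2\le d^{3/2}\le(3\rho/w(y))^{3/2}$. An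
exponent $a$ here leaves $\rho^{a-3}w^{-a}$, and both powers are integrable in the plane when
$1<a<2$; the choice $a=3/2$ is the middle. -/
lemma norm_slobodetskij_edgeLift_sq_le (i : Fin 4) {x y : E 2} (hx : x ∈ (K : Set (E 2)))
    (hy : y ∈ (K : Set (E 2))) :
    ‖slobodetskij (1 / 2) (edgeLift i) (x, y)‖ ^ 2 ≤
      (3 ^ (3 / 2 : ℝ) * vertexWeight y ^ (-(3 / 2) : ℝ)) * ‖x - y‖ ^ (-(3 / 2) : ℝ) := by
  rw [norm_slobodetskij, mul_pow]
  simp only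
  set d := ‖edgeLift i x - edgeLift i y‖
  set ρ := ‖x - y‖ with hρ
  have hw := vertexWeight_pos hy
  have hd1 : d ≤ 1 := norm_edgeLift_sub_le_one i hx hy
  have hd0 : 0 ≤ d := norm_nonneg _
  have hd : d ≤ 3 / vertexWeight y * ρ := norm_edgeLift_sub_le i hx hy
  -- On the diagonal the kernel is a nonzero power of $0$, which is $0$ by convention, so the left
  -- side vanishes.
  rcases (norm_nonneg (x - y)).eq_or_lt with h0 | h0
  · rw [← hρ] at h0
    rw [← h0, Real.zero_rpow (by norm_num)]
    have : 0 ≤ (0 : ℝ) ^ (-(3 / 2) : ℝ) := by positivity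
    simp only [ne_eq, OfNat.ofNat_ne_zero, not_false_eq_true, zero_pow, zero_mul]
    positivity
  · have e1 : d ^ 2 ≤ (3 / vertexWeight y * ρ) ^ (3 / 2 : ℝ) := by
      calc d ^ 2 = d ^ (2 : ℝ) := (Real.rpow_natCast d 2).symm
        _ ≤ d ^ (3 / 2 : ℝ) := by
          rcases hd0.eq_or_lt with h | h
          · rw [← h, Real.zero_rpow (by norm_num), Real.zero_rpow (by norm_num)]
          · exact Real.rpow_le_rpow_of_exponent_ge h hd1 (by norm_num)
        _ ≤ _ := Real.rpow_le_rpow hd0 hd (by norm_num)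
    have e2 : (ρ ^ (-(((2 : ℕ) : ℝ) / 2 + 1 / 2))) ^ 2 = ρ ^ (-3 : ℝ) := by
      rw [← Real.rpow_natCast, ← Real.rpow_mul (norm_nonneg _)]; norm_num [hρ]
    rw [e2]
    calc ρ ^ (-3 : ℝ) * d ^ 2 ≤ ρ ^ (-3 : ℝ) * (3 / vertexWeight y * ρ) ^ (3 / 2 : ℝ) := by gcongr
      _ = _ := by
        rw [Real.mul_rpow (by positivity) h0.le, Real.div_rpow (by norm_num) hw.le,
          Real.rpow_neg hw.le, show (-(3 / 2) : ℝ) = -3 + 3 / 2 by norm_num, Real.rpow_add h0]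
        ring

lemma edgeLift_mem_HHalf (i : Fin 4) : edgeLift i ∈ HHalf := by
  refine ⟨memLp_edgeLift i, memLp_two_iff.2
    ⟨(measurable_slobodetskij _ (measurable_edgeLift i)).aestronglyMeasurable, ?_⟩⟩
  obtain ⟨C, hC, hCle⟩ := exists_lintegral_norm_sub_le
  have hm := measurable_slobodetskij (1 / 2) (measurable_edgeLift i)
  rw [lintegral_prod_symm _ (by fun_prop)]
  have hfin := lintegral_vertexWeight_rpow_neg_lt_top (q := 3 / 2) (by norm_num) (by norm_num)
  have hmw := measurable_vertexWeight
  calc ∫⁻ y, ∫⁻ x, ‖slobodetskij (1 / 2) (edgeLift i) (x, y)‖ₑ ^ 2 ∂(boxVol 2) ∂(boxVol 2)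
      ≤ ∫⁻ y, ENNReal.ofReal (3 ^ (3 / 2 : ℝ)) *
          ENNReal.ofReal (vertexWeight y ^ (-(3 / 2) : ℝ)) * C ∂(boxVol 2) := by
        refine lintegral_mono_ae ?_
        filter_upwards [ae_boxVol_mem 2] with y hy
        refine le_trans (lintegral_mono_ae (g := fun x => ENNReal.ofReal (3 ^ (3 / 2 : ℝ)) *
          ENNReal.ofReal (vertexWeight y ^ (-(3 / 2) : ℝ)) *
            ENNReal.ofReal (‖x - y‖ ^ (-(3 / 2) : ℝ))) ?_) ?_
        · filter_upwards [ae_boxVol_mem 2] with x hx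
          rw [← ofReal_norm, ← ENNReal.ofReal_pow (norm_nonneg _),
            ← ENNReal.ofReal_mul (by positivity),
            ← ENNReal.ofReal_mul (mul_nonneg (by positivity)
              (Real.rpow_nonneg (vertexWeight_pos hy).le _))]
          exact ENNReal.ofReal_le_ofReal (norm_slobodetskij_edgeLift_sq_le i hx hy)
        · rw [lintegral_const_mul _ (by fun_prop)]
          gcongr
          exact hCle y hy
    _ < ⊤ := by
        rw [lintegral_mul_const _ (by fun_prop), lintegral_const_mul _ (by fun_prop)]
        exact ENNReal.mul_lt_top (ENNReal.mul_lt_top ENNReal.ofReal_lt_top hfin) hC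

/-! ### Fractional Sobolev functions are integrable against the inverse vertex weight -/

instance isProbabilityMeasure_unitVol : IsProbabilityMeasure unitVol := ⟨by simp⟩

instance isProbabilityMeasure_boxVol_two : IsProbabilityMeasure (boxVol 2) := by
  refine ⟨?_⟩
  have := measurePreserving_box2.measure_preimage (s := univ) nullMeasurableSet_univ
  rw [preimage_univ, measure_univ] at this
  exact this.symm

lemma lintegral_mul_sq_le {α : Type*} [MeasurableSpace α] {μ : Measure α} {f g : α → ENNReal}
    (hf : AEMeasurable f μ) (hg : AEMeasurable g μ) :
    (∫⁻ x, f x * g x ∂μ) ^ 2 ≤ (∫⁻ x, f x ^ 2 ∂μ) * ∫⁻ x, g x ^ 2 ∂μ := by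
  have h := ENNReal.lintegral_mul_le_Lp_mul_Lq μ Real.HolderConjugate.two_two hf hg
  have h2 := pow_le_pow_left₀ (zero_le) h 2
  rw [mul_pow] at h2
  have e : ∀ a : ENNReal, (a ^ (1 / 2 : ℝ)) ^ 2 = a := fun a => by
    rw [← ENNReal.rpow_natCast, ← ENNReal.rpow_mul]; norm_num
  rw [e, e] at h2
  simpa using h2

lemma lintegral_sq_le {α : Type*} [MeasurableSpace α] {μ : Measure α} [IsProbabilityMeasure μ]
    {f : α → ENNReal} (hf : AEMeasurable f μ) :
    (∫⁻ x, f x ∂μ) ^ 2 ≤ ∫⁻ x, f x ^ 2 ∂μ := by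
  simpa using lintegral_mul_sq_le hf (aemeasurable_const (b := (1 : ENNReal)))

lemma convex_K : Convex ℝ (K : Set (E 2)) := by
  intro a ha b hb s r hs hr hsr
  rw [mem_K] at *
  have hcv := convex_Ioo (𝕜 := ℝ) (0 : ℝ) 1
  exact ⟨hcv ha.1 hb.1 hs hr hsr, hcv ha.2 hb.2 hs hr hsr⟩

/-- The contraction of the square towards the point `x` with ratio `t`. -/
lemma lintegral_contraction_le {x : E 2} (hx : x ∈ (K : Set (E 2))) {t : ℝ} (ht : 0 < t)
    (ht1 : t ≤ 1) {H : E 2 → ENNReal} (hH : Measurable H) :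
    ∫⁻ k, H ((1 - t) • x + t • k) ∂(boxVol 2) ≤
      ENNReal.ofReal ((t ^ 2)⁻¹) * ∫⁻ y, H y ∂(boxVol 2) := by
  set H' := (K : Set (E 2)).indicator H with hH'
  have hK : MeasurableSet (K : Set (E 2)) := K.isOpen.measurableSet
  have hm : Measurable H' := hH.indicator hK
  have hc := convex_K
  calc ∫⁻ k, H ((1 - t) • x + t • k) ∂(boxVol 2)
      = ∫⁻ k in (K : Set (E 2)), H' ((1 - t) • x + t • k) := by
        refine setLIntegral_congr_fun hK fun k hk => ?_
        rw [hH', indicator_of_mem (hc hx hk (by linarith) ht.le (by ring))]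
    _ ≤ ∫⁻ k, H' ((1 - t) • x + t • k) := setLIntegral_le_lintegral _ _
    _ = ∫⁻ k, H' ((1 - t) • x + k) ∂(Measure.map (fun k : E 2 => t • k) volume) := by
        rw [lintegral_map (by fun_prop) (by fun_prop)]
    _ = ENNReal.ofReal ((t ^ 2)⁻¹) * ∫⁻ k, H' ((1 - t) • x + k) := by
        rw [Measure.map_addHaar_smul _ ht.ne', lintegral_smul_measure, smul_eq_mul]
        congr 2
        rw [finrank_euclideanSpace_fin, abs_of_pos (by positivity)]
    _ = ENNReal.ofReal ((t ^ 2)⁻¹) * ∫⁻ y, H y ∂(boxVol 2) := by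
        rw [lintegral_add_left_eq_self (fun k => H' k), hH', lintegral_indicator hK]

lemma norm_sub_lt_two {x y : E 2} (hx : x ∈ (K : Set (E 2))) (hy : y ∈ (K : Set (E 2))) :
    ‖x - y‖ < 2 := by
  rw [EuclideanSpace.norm_eq, Real.sqrt_lt' (by norm_num)]
  obtain ⟨h1, h2⟩ := mem_K.1 hx
  obtain ⟨h3, h4⟩ := mem_K.1 hy
  simp only [Fin.sum_univ_two, PiLp.sub_apply, Real.norm_eq_abs, sq_abs]
  nlinarith [h1.1, h1.2, h2.1, h2.2, h3.1, h3.2, h4.1, h4.2, abs_le.1 (le_refl |x 0 - y 0|)]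

/-- Hardy type estimate: $f(x)$ is compared with $f(y)$, where $y$ lies at distance $\rho\le2\sqrt
w$ from $x$. Write $|f(x)-f(y)|=S\rho^{1+\sigma}$ with the Slobodetskij quotient $S$. Young's
inequality bounds $S\rho^{1+\sigma}/w$ by $wS^2+w^{-3}\rho^{2(1+\sigma)}$, and $\rho^2\le4w$ turns
the last term into $16\,w^{-(2-\sigma)}$, integrable because $\sigma>0$. The term $|f(y)|/w$ is
treated in the same way. -/
lemma norm_mul_inv_vertexWeight_le {σ : ℝ} (hσ : 0 < σ) (hσ1 : σ < 1) (f : E 2 → ℂ) {x k : E 2}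
    (hx : x ∈ (K : Set (E 2))) (hk : k ∈ (K : Set (E 2))) {y : E 2}
    (hy : y = (1 - √(vertexWeight x)) • x + √(vertexWeight x) • k) :
    ‖f x‖ * (vertexWeight x)⁻¹ ≤
      vertexWeight x * ‖slobodetskij σ f (x, y)‖ ^ 2 + 16 * vertexWeight x ^ (-(2 - σ)) +
      (vertexWeight x ^ (-(1 / 2) : ℝ) * ‖f y‖ ^ 2 + vertexWeight x ^ (-(3 / 2) : ℝ)) := by
  set w := vertexWeight x with hw'
  have hw : 0 < w := vertexWeight_pos hx
  set t := √w with ht'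
  have ht : 0 < t := Real.sqrt_pos.2 hw
  have htw : t ^ 2 = w := Real.sq_sqrt hw.le
  have hxy : x - y = t • (x - k) := by
    rw [hy, sub_smul, smul_sub, one_smul]; abel
  set ρ := ‖x - y‖ with hρ
  have hρt : ρ ≤ 2 * t := by
    rw [hρ, hxy, norm_smul, Real.norm_of_nonneg ht.le]
    nlinarith [norm_sub_lt_two hx hk]
  set S := ‖slobodetskij σ f (x, y)‖ with hS
  have hF : ‖f x - f y‖ * w⁻¹ ≤ w * S ^ 2 + 16 * w ^ (-(2 - σ)) := by
    rcases (norm_nonneg (x - y)).eq_or_lt with h0 | h0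
    · have : x = y := sub_eq_zero.1 (norm_eq_zero.1 h0.symm)
      rw [this]; simp only [sub_self, norm_zero, zero_mul]; positivity
    · rw [← hρ] at h0
      have e1 : ‖f x - f y‖ = S * ρ ^ (1 + σ) := by
        rw [hS, norm_slobodetskij]
        simp only
        rw [← hρ, mul_assoc, mul_comm (‖f x - f y‖), ← mul_assoc, ← Real.rpow_add h0]
        norm_num
      have e2 : (ρ ^ (1 + σ)) ^ 2 ≤ 16 * w ^ (1 + σ) := by
        have a1 : ρ ^ 2 ≤ 4 * w := by rw [← htw]; nlinarith
        calc (ρ ^ (1 + σ)) ^ 2 = (ρ ^ 2) ^ (1 + σ) := by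
              rw [← Real.rpow_natCast, ← Real.rpow_natCast, ← Real.rpow_mul h0.le,
                ← Real.rpow_mul h0.le, mul_comm]
          _ ≤ (4 * w) ^ (1 + σ) := Real.rpow_le_rpow (by positivity) a1 (by linarith)
          _ = 4 ^ (1 + σ) * w ^ (1 + σ) := Real.mul_rpow (by norm_num) hw.le
          _ ≤ 4 ^ (2 : ℝ) * w ^ (1 + σ) := by
              gcongr
              · norm_num
              · linarith
          _ = _ := by norm_num
      have e3 : w ^ (-(2 - σ)) = w⁻¹ * (w⁻¹) ^ 2 * w ^ (1 + σ) := by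
        rw [← Real.rpow_neg_one, ← Real.rpow_natCast, ← Real.rpow_mul hw.le,
          ← Real.rpow_add hw, ← Real.rpow_add hw]
        congr 1; push_cast; ring
      rw [e1, e3]
      set R := ρ ^ (1 + σ)
      have e4 : S * R * w⁻¹ ≤ w * S ^ 2 + w⁻¹ * (w⁻¹) ^ 2 * R ^ 2 := by
        have : w * S ^ 2 + w⁻¹ * (w⁻¹) ^ 2 * R ^ 2 - S * R * w⁻¹ =
            w * ((S - w⁻¹ ^ 2 * R / 2) ^ 2 + 3 / 4 * (w⁻¹ ^ 2 * R) ^ 2) := by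
          field_simp; ring
        have h' : 0 ≤ w * ((S - w⁻¹ ^ 2 * R / 2) ^ 2 + 3 / 4 * (w⁻¹ ^ 2 * R) ^ 2) := by positivity
        linarith
      refine e4.trans ?_
      have := mul_le_mul_of_nonneg_left e2 (by positivity : 0 ≤ w⁻¹ * (w⁻¹) ^ 2)
      linarith
  have hG : ‖f y‖ * w⁻¹ ≤ w ^ (-(1 / 2) : ℝ) * ‖f y‖ ^ 2 + w ^ (-(3 / 2) : ℝ) := by
    have e1 : w ^ (-(1 / 2) : ℝ) = t⁻¹ := by
      rw [Real.rpow_neg hw.le, ← Real.sqrt_eq_rpow]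
    have e2 : w ^ (-(3 / 2) : ℝ) = t⁻¹ * w⁻¹ := by
      rw [← e1, ← Real.rpow_neg_one w, ← Real.rpow_add hw]; norm_num
    rw [e1, e2, ← htw]
    have : t⁻¹ * ‖f y‖ ^ 2 + t⁻¹ * (t ^ 2)⁻¹ - ‖f y‖ * (t ^ 2)⁻¹ =
        t⁻¹ * ((‖f y‖ - t⁻¹ / 2) ^ 2 + 3 / 4 * t⁻¹ ^ 2) := by
      field_simp; ring
    have h' : 0 ≤ t⁻¹ * ((‖f y‖ - t⁻¹ / 2) ^ 2 + 3 / 4 * t⁻¹ ^ 2) := by positivity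
    linarith
  have hfx : ‖f x‖ ≤ ‖f x - f y‖ + ‖f y‖ := by
    simpa using norm_add_le (f x - f y) (f y)
  have := mul_le_mul_of_nonneg_right hfx (inv_nonneg.2 hw.le)
  linarith

/-- Average the pointwise estimate over $k\in K$. The contraction of ratio $\sqrt w$ has inverse
Jacobian $1/w$. This exactly cancels the factor $w$ of $S^2$, leaving the Slobodetskij seminorm, and
turns $w^{-1/2}|f(y)|^2$ into $w^{-3/2}\|f\|^2$, still integrable. The ratio $\sqrt w$ is chosen for
this balance. -/
lemma lintegral_mul_inv_vertexWeight_lt_top_of_measurable {σ : ℝ} (hσ : 0 < σ) (hσ1 : σ < 1)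
    {f : E 2 → ℂ} (hfm : Measurable f) (hf : MemLp f 2 (boxVol 2))
    (hf' : MemLp (slobodetskij σ f) 2 ((boxVol 2).prod (boxVol 2))) :
    ∫⁻ x, ENNReal.ofReal (‖f x‖ * (vertexWeight x)⁻¹) ∂(boxVol 2) < ⊤ := by
  have hm := measurable_slobodetskij σ hfm
  have hmw := measurable_vertexWeight
  have h1 := (memLp_two_iff.1 hf).2
  have h2 := (memLp_two_iff.1 hf').2
  rw [lintegral_prod _ (by fun_prop)] at h2
  have key : ∀ x ∈ (K : Set (E 2)), ENNReal.ofReal (‖f x‖ * (vertexWeight x)⁻¹) ≤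
      (∫⁻ y, ‖slobodetskij σ f (x, y)‖ₑ ^ 2 ∂(boxVol 2)) +
      16 * ENNReal.ofReal (vertexWeight x ^ (-(2 - σ))) +
      ENNReal.ofReal (vertexWeight x ^ (-(3 / 2) : ℝ)) *
        (∫⁻ y, ‖f y‖ₑ ^ 2 ∂(boxVol 2)) +
      ENNReal.ofReal (vertexWeight x ^ (-(3 / 2) : ℝ)) := by
    intro x hx
    have hw : 0 < vertexWeight x := vertexWeight_pos hx
    have ht : 0 < √(vertexWeight x) := Real.sqrt_pos.2 hw
    have ht1 : √(vertexWeight x) ≤ 1 := Real.sqrt_le_one.2 (vertexWeight_le_one x)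
    have htw : √(vertexWeight x) ^ 2 = vertexWeight x := Real.sq_sqrt hw.le
    have c1 := lintegral_contraction_le hx ht ht1
      (H := fun y => ‖slobodetskij σ f (x, y)‖ₑ ^ 2) (by fun_prop)
    have c2 := lintegral_contraction_le hx ht ht1 (H := fun y => ‖f y‖ₑ ^ 2) (by fun_prop)
    rw [htw] at c1 c2
    calc ENNReal.ofReal (‖f x‖ * (vertexWeight x)⁻¹)
        = ∫⁻ _k, ENNReal.ofReal (‖f x‖ * (vertexWeight x)⁻¹) ∂(boxVol 2) := by
          rw [lintegral_const, measure_univ, mul_one]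
      _ ≤ ∫⁻ k, (ENNReal.ofReal (vertexWeight x) * ‖slobodetskij σ f
              (x, (1 - √(vertexWeight x)) • x + √(vertexWeight x) • k)‖ₑ ^ 2 +
            16 * ENNReal.ofReal (vertexWeight x ^ (-(2 - σ))) +
            ENNReal.ofReal (vertexWeight x ^ (-(1 / 2) : ℝ)) *
              ‖f ((1 - √(vertexWeight x)) • x + √(vertexWeight x) • k)‖ₑ ^ 2 +
            ENNReal.ofReal (vertexWeight x ^ (-(3 / 2) : ℝ))) ∂(boxVol 2) := by
          refine lintegral_mono_ae ?_
          filter_upwards [ae_boxVol_mem 2] with k hk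
          have h := norm_mul_inv_vertexWeight_le hσ hσ1 f hx hk rfl
          refine (ENNReal.ofReal_le_ofReal h).trans (le_of_eq ?_)
          rw [ENNReal.ofReal_add (by positivity) (by positivity),
            ENNReal.ofReal_add (by positivity) (by positivity),
            ENNReal.ofReal_add (by positivity) (by positivity),
            ENNReal.ofReal_mul hw.le, ENNReal.ofReal_mul (by norm_num),
            ENNReal.ofReal_mul (by positivity), ENNReal.ofReal_pow (norm_nonneg _),
            ENNReal.ofReal_pow (norm_nonneg _), ofReal_norm, ofReal_norm, ← add_assoc]
          norm_num
      _ ≤ _ := by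
          rw [lintegral_add_right _ (by fun_prop), lintegral_add_right _ (by fun_prop),
            lintegral_add_right _ (by fun_prop), lintegral_const, lintegral_const, measure_univ,
            mul_one, mul_one, lintegral_const_mul _ (by fun_prop),
            lintegral_const_mul _ (by fun_prop)]
          refine add_le_add (add_le_add (add_le_add ?_ le_rfl) ?_) le_rfl
          · refine (mul_le_mul_right c1 _).trans (le_of_eq ?_)
            rw [← mul_assoc, ← ENNReal.ofReal_mul hw.le, mul_inv_cancel₀ hw.ne']
            simp
          · refine (mul_le_mul_right c2 _).trans (le_of_eq ?_)
            rw [← mul_assoc, ← ENNReal.ofReal_mul (by positivity), ← Real.rpow_neg_one,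
              ← Real.rpow_add hw]
            norm_num
  have hw1 := lintegral_vertexWeight_rpow_neg_lt_top (q := 3 / 2) (by norm_num) (by norm_num)
  have hw2 := lintegral_vertexWeight_rpow_neg_lt_top (q := 2 - σ) (by linarith) (by linarith)
  refine (setLIntegral_mono' K.isOpen.measurableSet key).trans_lt ?_
  rw [lintegral_add_right _ (by fun_prop), lintegral_add_right _ (by fun_prop),
    lintegral_add_right _ (by fun_prop), lintegral_const_mul _ (by fun_prop),
    lintegral_mul_const _ (by fun_prop)]
  refine ENNReal.add_lt_top.2 ⟨ENNReal.add_lt_top.2 ⟨ENNReal.add_lt_top.2 ⟨h2, ?_⟩, ?_⟩, hw1⟩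
  · exact ENNReal.mul_lt_top (by norm_num) hw2
  · exact ENNReal.mul_lt_top hw1 h1

lemma slobodetskij_congr_ae {n : ℕ} (σ : ℝ) {f g : E n → ℂ} (h : f =ᵐ[boxVol n] g) :
    slobodetskij σ f =ᵐ[(boxVol n).prod (boxVol n)] slobodetskij σ g := by
  have h1 := Measure.quasiMeasurePreserving_fst (μ := boxVol n) (ν := boxVol n) |>.ae_eq_comp h
  have h2 := Measure.quasiMeasurePreserving_snd (μ := boxVol n) (ν := boxVol n) |>.ae_eq_comp h
  filter_upwards [h1, h2] with z hz1 hz2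
  simp only [Function.comp_apply] at hz1 hz2
  rw [slobodetskij, slobodetskij, hz1, hz2]

lemma lintegral_mul_inv_vertexWeight_lt_top {σ : ℝ} (hσ : 0 < σ) (hσ1 : σ < 1)
    {f : E 2 → ℂ} (hf : MemLp f 2 (boxVol 2))
    (hf' : MemLp (slobodetskij σ f) 2 ((boxVol 2).prod (boxVol 2))) :
    ∫⁻ x, ENNReal.ofReal (‖f x‖ * (vertexWeight x)⁻¹) ∂(boxVol 2) < ⊤ := by
  obtain ⟨g, hgm, hg⟩ := hf.1
  have := lintegral_mul_inv_vertexWeight_lt_top_of_measurable hσ hσ1 hgm.measurable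
    (hf.ae_eq hg) (hf'.ae_eq (slobodetskij_congr_ae σ hg))
  refine lt_of_eq_of_lt (lintegral_congr_ae ?_) this
  filter_upwards [hg] with x hx
  rw [hx]

/-! ### Weakly differentiable functions have half a fractional derivative -/

/-- The average of a function over the translates of a segment. -/
def smear (θ : E 2 → ℂ) (h : E 2) (x : E 2) : ℂ := ∫ s, θ (x - s • h) ∂unitVol

open scoped Convolution in
-- The smeared function is the convolution of $\theta$ with the image of Lebesgue measure on the
-- segment from $0$ to $h$, so it inherits the smoothness of $\theta$.
lemma contDiff_smear {θ : E 2 → ℂ} (hθ : ContDiff ℝ ∞ θ) (hc : HasCompactSupport θ) (h : E 2) :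
    ContDiff ℝ ∞ (smear θ h) := by
  have hm : Measurable fun s : ℝ => s • h := by fun_prop
  have := hc.contDiff_convolution_right (ContinuousLinearMap.lsmul ℝ ℝ) (n := ⊤)
    (μ := Measure.map (fun s : ℝ => s • h) unitVol) (f := fun _ => (1 : ℝ))
    (by
      have : IsFiniteMeasure (Measure.map (fun s : ℝ => s • h) unitVol) :=
        Measure.isFiniteMeasure_map _ _
      exact (integrable_const (1 : ℝ)).locallyIntegrable) hθ
  convert this using 1
  funext x
  rw [convolution_def, integral_map hm.aemeasurable
    (Continuous.aestronglyMeasurable (by have := hθ.continuous; fun_prop))]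
  simp [smear]

lemma support_smear_subset {θ : E 2 → ℂ} (h : E 2) :
    Function.support (smear θ h) ⊆
      (fun p : E 2 × ℝ => p.1 + p.2 • h) '' (tsupport θ ×ˢ Icc (0 : ℝ) 1) := by
  intro x hx
  by_contra hn
  apply hx
  unfold smear
  rw [← integral_zero ℝ ℂ (μ := unitVol)]
  refine setIntegral_congr_fun measurableSet_Ioo fun s hs => ?_
  by_contra h0
  exact hn ⟨(x - s • h, s), ⟨subset_tsupport _ h0, hs.1.le, hs.2.le⟩, by simp⟩

lemma isCompact_smear_aux {θ : E 2 → ℂ} (hc : HasCompactSupport θ) (h : E 2) :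
    IsCompact ((fun p : E 2 × ℝ => p.1 + p.2 • h) '' (tsupport θ ×ˢ Icc (0 : ℝ) 1)) :=
  (hc.isCompact.prod isCompact_Icc).image (by fun_prop)

/-- Smearing spreads the support along segments from $x$ to $x+h$, which stay in $K$ by convexity
once both ends do. -/
lemma tsupport_smear_subset {θ : E 2 → ℂ} (hc : HasCompactSupport θ) {h : E 2}
    (hK : ∀ x ∈ tsupport θ, x ∈ (K : Set (E 2)) ∧ x + h ∈ (K : Set (E 2))) :
    tsupport (smear θ h) ⊆ K := by
  refine (closure_minimal (support_smear_subset h) (isCompact_smear_aux hc h).isClosed).trans ?_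
  rintro _ ⟨⟨x, s⟩, ⟨hx, hs⟩, rfl⟩
  obtain ⟨h1, h2⟩ := hK x hx
  have := convex_K h1 h2 (sub_nonneg.2 hs.2) hs.1 (sub_add_cancel _ _)
  have e : (1 - s) • x + s • (x + h) = x + s • h := by
    rw [smul_add, ← add_assoc, ← add_smul]; simp
  rwa [e] at this

/-- The smeared test function as a test function. -/
def smearTest {θ : E 2 → ℂ} (hθ : ContDiff ℝ ∞ θ) (hc : HasCompactSupport θ) {h : E 2}
    (hK : ∀ x ∈ tsupport θ, x ∈ (K : Set (E 2)) ∧ x + h ∈ (K : Set (E 2))) : 𝓓(K, ℂ) where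
  toFun := smear θ h
  contDiff' := contDiff_smear hθ hc h
  hasCompactSupport' := HasCompactSupport.of_support_subset_isCompact (isCompact_smear_aux hc h)
    (support_smear_subset h)
  tsupport_subset' := tsupport_smear_subset hc hK

/-- Along the direction $h$ the smear is a moving average, so its derivative is the difference of
the end values. A finite difference of $\theta$ is thereby an exact derivative of a test function.
-/
lemma fderiv_smear_apply {θ : E 2 → ℂ} (hθ : ContDiff ℝ ∞ θ) (hc : HasCompactSupport θ) (h : E 2)
    (x : E 2) : fderiv ℝ (smear θ h) x h = θ x - θ (x - h) := by
  have hd : DifferentiableAt ℝ (smear θ h) x :=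
    (contDiff_smear hθ hc h).differentiable (by simp) x
  have hl : HasDerivAt (fun τ : ℝ => x + τ • h) h 0 := by
    simpa using ((hasDerivAt_id (0 : ℝ)).smul_const h).const_add x
  have h1 : HasDerivAt (fun τ : ℝ => smear θ h (x + τ • h)) (fderiv ℝ (smear θ h) x h) 0 := by
    have := (by simpa using hd.hasFDerivAt :
      HasFDerivAt (smear θ h) (fderiv ℝ (smear θ h) x) (x + (0 : ℝ) • h))
    exact this.comp_hasDerivAt (0 : ℝ) hl
  have hcont : Continuous fun v : ℝ => θ (x + v • h) := by have := hθ.continuous; fun_prop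
  have e : (fun τ : ℝ => smear θ h (x + τ • h)) =
      fun τ => (∫ v in (0 : ℝ)..τ, θ (x + v • h)) - ∫ v in (0 : ℝ)..(τ - 1), θ (x + v • h) := by
    funext τ
    rw [intervalIntegral.integral_interval_sub_left (hcont.intervalIntegrable _ _)
      (hcont.intervalIntegrable _ _)]
    have := intervalIntegral.integral_comp_sub_left (fun v : ℝ => θ (x + v • h)) τ (a := 0) (b := 1)
    rw [sub_zero] at this
    rw [← this, intervalIntegral.integral_of_le zero_le_one, integral_Ioc_eq_integral_Ioo]
    unfold smear
    refine integral_congr_ae (Eventually.of_forall fun s => congrArg θ ?_)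
    rw [sub_smul]; abel
  have h2 : HasDerivAt (fun τ : ℝ => smear θ h (x + τ • h)) (θ x - θ (x - h)) 0 := by
    rw [e]
    have a1 := intervalIntegral.integral_hasDerivAt_right (hcont.intervalIntegrable 0 0)
      hcont.aestronglyMeasurable.stronglyMeasurableAtFilter hcont.continuousAt
    have a2 : HasDerivAt (fun u => ∫ v in (0 : ℝ)..u, θ (x + v • h)) (θ (x + ((0 : ℝ) - 1) • h))
        ((0 : ℝ) - 1) :=
      intervalIntegral.integral_hasDerivAt_right (hcont.intervalIntegrable 0 _)
        hcont.aestronglyMeasurable.stronglyMeasurableAtFilter hcont.continuousAt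
    have a3 := a1.sub (a2.comp_sub_const (0 : ℝ) 1)
    have e5 : θ x - θ (x - h) = θ (x + (0 : ℝ) • h) - θ (x + ((0 : ℝ) - 1) • h) := by
      simp [sub_eq_add_neg]
    rw [e5]
    exact a3
  exact h1.unique h2

lemma fderiv_apply_eq_sum {n : ℕ} (f : E n → ℂ) (x h : E n) :
    fderiv ℝ f x h = ∑ i, (h i : ℂ) * pd i f x := by
  have e : h = ∑ i, h i • EuclideanSpace.single i (1 : ℝ) := by
    ext j; simp [Pi.single_apply]
  conv_lhs => rw [e, map_sum]
  simp only [map_smul, Complex.real_smul, pd]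

lemma integrable_shear {G : E 2 → ℂ} (hG : Integrable G) (h : E 2) :
    Integrable (fun p : E 2 × ℝ => G (p.1 + p.2 • h)) (volume.prod unitVol) := by
  have hmp : MeasurePreserving (fun p : ℝ × E 2 => (p.1, p.2 + p.1 • h))
      (unitVol.prod volume) (unitVol.prod volume) := by
    refine MeasurePreserving.skew_product (g := fun (s : ℝ) (x : E 2) => x + s • h)
      (MeasurePreserving.id unitVol) (by fun_prop) (Eventually.of_forall fun s => ?_)
    exact (measurePreserving_add_right volume (s • h)).map_eq
  have h1 : Integrable (fun p : ℝ × E 2 => G p.2) (unitVol.prod volume) := hG.comp_snd unitVol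
  have h2 := hmp.integrable_comp_of_integrable h1
  exact h2.swap

/-- Fundamental theorem of calculus for weak derivatives, by duality instead of mollification.
Against a test function $\theta$ the shift difference of $f$ becomes $-f$ paired with
$\theta-\theta(\cdot-h)$, the directional derivative of the smear of $\theta$. The weak derivative
moves it onto $g$, and Fubini moves the averaging from $\theta$ to $g$. -/
lemma weakPartial_shift {f : E 2 → ℂ} {g : Fin 2 → E 2 → ℂ} (hf : Integrable f (boxVol 2))
    (hg : ∀ i, Integrable (g i) (boxVol 2)) (hw : ∀ i, IsWeakPartial i f (g i)) (h : E 2) :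
    ∀ᵐ x, x ∈ (K : Set (E 2)) ∩ (fun x => x + h) ⁻¹' K →
      f (x + h) - f x =
        ∫ s, (K : Set (E 2)).indicator (fun y => ∑ i, (h i : ℂ) * g i y) (x + s • h) ∂unitVol := by
  have hKm : MeasurableSet (K : Set (E 2)) := K.isOpen.measurableSet
  set F := (K : Set (E 2)).indicator f with hF
  set G := (K : Set (E 2)).indicator (fun y => ∑ i, (h i : ℂ) * g i y) with hG
  have hFi : Integrable F := (integrable_indicator_iff hKm).2 hf
  have hGi : Integrable G := (integrable_indicator_iff hKm).2
    (integrable_finsetSum _ fun i _ => (hg i).const_mul _)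
  have hFh : Integrable (fun x => F (x + h)) := hFi.comp_add_right h
  have hsh := integrable_shear hGi h
  have hI : Integrable (fun x => ∫ s, G (x + s • h) ∂unitVol) := hsh.integral_prod_left
  set U := (K : Set (E 2)) ∩ (fun x => x + h) ⁻¹' K with hU
  have hUo : IsOpen U := K.isOpen.inter (K.isOpen.preimage (by fun_prop))
  -- The test functions are supported where both $x$ and $x+h$ lie in $K$, which is what makes their
  -- smears admissible. Extension by zero allows all integrals to be taken over the plane, where
  -- translations are free.
  have key := hUo.ae_eq_zero_of_integral_contDiff_smul_eq_zero (μ := volume)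
    (f := fun x => F (x + h) - F x - ∫ s, G (x + s • h) ∂unitVol)
    (((hFh.sub hFi).sub hI).locallyIntegrable.locallyIntegrableOn U) (by
    intro η hη hηc hηU
    set θ : E 2 → ℂ := fun x => (η x : ℂ) with hθdef
    have hθ : ContDiff ℝ ∞ θ := Complex.ofRealCLM.contDiff.comp hη
    have hts : tsupport θ ⊆ tsupport η := by
      refine closure_mono fun x hx => ?_
      simpa [hθdef] using hx
    have hθc : HasCompactSupport θ := hηc.comp_left (g := fun r : ℝ => (r : ℂ)) (by simp)
    have hθK : ∀ x ∈ tsupport θ, x ∈ (K : Set (E 2)) ∧ x + h ∈ (K : Set (E 2)) :=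
      fun x hx => hηU (hts hx)
    have hcont := hθ.continuous
    obtain ⟨C, hC⟩ := hcont.bounded_above_of_compact_support hθc
    have hbd : ∀ {G' : E 2 → ℂ}, Integrable G' → Integrable (fun x => G' x * θ x) := fun hG' =>
      hG'.mul_bdd hcont.aestronglyMeasurable (Eventually.of_forall hC)
    have hbd' : ∀ {G' : E 2 → ℂ}, Integrable G' → Integrable (fun x => G' x * θ (x - h)) :=
      fun hG' => hG'.mul_bdd (by fun_prop) (Eventually.of_forall fun x => hC (x - h))
    set φ := smearTest hθ hθc hθK with hφ
    have hφc : Continuous φ := φ.continuous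
    have hφd : ∀ x, ∑ i, (h i : ℂ) * pd i φ x = θ x - θ (x - h) := fun x => by
      rw [← fderiv_apply_eq_sum]
      exact fderiv_smear_apply hθ hθc h x
    obtain ⟨C', hC'⟩ := hφc.bounded_above_of_compact_support φ.hasCompactSupport
    have hpdc : ∀ i, ∃ C, ∀ x, ‖pd i φ x‖ ≤ C := fun i => by
      have hcd : Continuous (fderiv ℝ φ) := φ.contDiff.continuous_fderiv (by simp)
      obtain ⟨C, hC⟩ := hcd.bounded_above_of_compact_support (φ.hasCompactSupport.fderiv ℝ)
      refine ⟨C, fun x => ((fderiv ℝ φ x).le_opNorm _).trans ?_⟩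
      simpa using hC x
    have hpdm : ∀ i, Continuous (pd i φ) := fun i => by
      have hcd : Continuous (fderiv ℝ φ) := φ.contDiff.continuous_fderiv (by simp)
      unfold pd; fun_prop
    have w1 : ∫ x, F x * (θ x - θ (x - h)) = -∫ x, G x * φ x := by
      have a1 : ∫ x, F x * (θ x - θ (x - h)) =
          ∑ i, (h i : ℂ) * ∫ x, f x * pd i φ x ∂(boxVol 2) := by
        calc ∫ x, F x * (θ x - θ (x - h))
            = ∫ x, (K : Set (E 2)).indicator (fun x => f x * (θ x - θ (x - h))) x := by
              congr 1; funext x; rw [hF, indicator_mul_left]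
          _ = ∫ x, ∑ i, (h i : ℂ) * (f x * pd i φ x) ∂(boxVol 2) := by
              rw [integral_indicator hKm]
              congr 1; funext x
              rw [← hφd, Finset.mul_sum]
              exact Finset.sum_congr rfl fun i _ => by ring
          _ = _ := by
              rw [integral_finsetSum]
              · simp only [integral_const_mul]
              · intro i _
                obtain ⟨C, hC⟩ := hpdc i
                exact (hf.mul_bdd (hpdm i).aestronglyMeasurable
                  (Eventually.of_forall hC)).const_mul _
      have a2 : ∫ x, G x * φ x = ∑ i, (h i : ℂ) * ∫ x, g i x * φ x ∂(boxVol 2) := by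
        calc ∫ x, G x * φ x
            = ∫ x, (K : Set (E 2)).indicator (fun x => (∑ i, (h i : ℂ) * g i x) * φ x) x := by
              congr 1; funext x; rw [hG, indicator_mul_left]
          _ = ∫ x, ∑ i, (h i : ℂ) * (g i x * φ x) ∂(boxVol 2) := by
              rw [integral_indicator hKm]
              congr 1; funext x
              rw [Finset.sum_mul]
              exact Finset.sum_congr rfl fun i _ => by ring
          _ = _ := by
              rw [integral_finsetSum]
              · simp only [integral_const_mul]
              · intro i _
                exact ((hg i).mul_bdd hφc.aestronglyMeasurable
                  (Eventually.of_forall hC')).const_mul _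
      rw [a1, a2, ← Finset.sum_neg_distrib]
      refine Finset.sum_congr rfl fun i _ => ?_
      rw [hw i φ, mul_neg]
    have w2 : ∫ x, F x * (θ x - θ (x - h)) = ∫ x, (F x - F (x + h)) * θ x := by
      simp only [mul_sub, sub_mul]
      rw [integral_sub (hbd hFi) (hbd' hFi), integral_sub (hbd hFi) (hbd hFh)]
      congr 1
      rw [← integral_add_right_eq_self _ h]
      simp
    have w3 : ∫ x, G x * φ x = ∫ x, (∫ s, G (x + s • h) ∂unitVol) * θ x := by
      have i1 : Integrable (fun p : E 2 × ℝ => G (p.1 + p.2 • h) * θ p.1)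
          (volume.prod unitVol) :=
        hsh.mul_bdd (by fun_prop) (Eventually.of_forall fun p => hC p.1)
      have i2 : Integrable (fun p : E 2 × ℝ => G p.1 * θ (p.1 - p.2 • h))
          (volume.prod unitVol) :=
        (hGi.comp_fst unitVol).mul_bdd (by fun_prop) (Eventually.of_forall fun p => hC _)
      calc ∫ x, G x * φ x = ∫ x, ∫ s, G x * θ (x - s • h) ∂unitVol := by
            congr 1; funext x; rw [integral_const_mul]; rfl
        _ = ∫ s, (∫ x, G x * θ (x - s • h)) ∂unitVol := integral_integral_swap i2
        _ = ∫ s, (∫ x, G (x + s • h) * θ x) ∂unitVol := by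
            congr 1; funext s
            rw [← integral_add_right_eq_self _ (s • h)]
            simp
        _ = ∫ x, ∫ s, G (x + s • h) * θ x ∂unitVol := (integral_integral_swap i1).symm
        _ = _ := by
            congr 1; funext x; rw [integral_mul_const]
    have w4 : ∫ x, η x • (F (x + h) - F x - ∫ s, G (x + s • h) ∂unitVol) =
        -(∫ x, (F x - F (x + h)) * θ x) - ∫ x, (∫ s, G (x + s • h) ∂unitVol) * θ x := by
      have hn : Integrable (fun x => -((F x - F (x + h)) * θ x)) := (hbd (hFi.sub hFh)).neg
      rw [← integral_neg, ← integral_sub hn (hbd hI)]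
      congr 1; funext x
      simp only [hθdef, Complex.real_smul]
      ring
    rw [w4, ← w3, ← w2, w1]
    ring)
  filter_upwards [key] with x hx hxU
  have h3 := hx hxU
  rw [hF, indicator_of_mem hxU.1, indicator_of_mem (show x + h ∈ (K : Set (E 2)) from hxU.2)] at h3
  exact sub_eq_zero.1 h3

lemma isWeakPartial_congr {n : ℕ} {i : Fin n} {f f' g : E n → ℂ} (h : f =ᵐ[boxVol n] f')
    (hw : IsWeakPartial i f g) : IsWeakPartial i f' g := by
  intro φ
  rw [← hw φ]
  refine integral_congr_ae ?_
  filter_upwards [h] with x hx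
  rw [hx]

/-- Cauchy-Schwarz in $s$ and translation invariance in $x$ remove the segment average. The factor
$2$ comes from bounding each $|h_i|$ by $\|h\|$. -/
lemma lintegral_shift_sub_sq_le {f : E 2 → ℂ} {g : Fin 2 → E 2 → ℂ} (hf : Integrable f (boxVol 2))
    (hg : ∀ i, MemLp (g i) 2 (boxVol 2)) (hw : ∀ i, IsWeakPartial i f (g i)) (h : E 2) :
    ∫⁻ x in (K : Set (E 2)) ∩ (fun x => x + h) ⁻¹' K, ‖f (x + h) - f x‖ₑ ^ 2 ≤
      ENNReal.ofReal (2 * ‖h‖ ^ 2) * ∑ i, ∫⁻ x, ‖g i x‖ₑ ^ 2 ∂(boxVol 2) := by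
  have hKm : MeasurableSet (K : Set (E 2)) := K.isOpen.measurableSet
  have hgi : ∀ i, Integrable (g i) (boxVol 2) := fun i => (hg i).integrable (by norm_num)
  set G := (K : Set (E 2)).indicator (fun y => ∑ i, (h i : ℂ) * g i y) with hG
  have hGi : Integrable G := (integrable_indicator_iff hKm).2
    (integrable_finsetSum _ fun i _ => (hgi i).const_mul _)
  have hsh := integrable_shear hGi h
  have hUm : MeasurableSet ((K : Set (E 2)) ∩ (fun x => x + h) ⁻¹' K) :=
    hKm.inter (hKm.preimage (by fun_prop))
  have hae := hsh.aestronglyMeasurable.enorm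
  calc ∫⁻ x in (K : Set (E 2)) ∩ (fun x => x + h) ⁻¹' K, ‖f (x + h) - f x‖ₑ ^ 2
      = ∫⁻ x in (K : Set (E 2)) ∩ (fun x => x + h) ⁻¹' K, ‖∫ s, G (x + s • h) ∂unitVol‖ₑ ^ 2 := by
        refine setLIntegral_congr_fun_ae hUm ?_
        filter_upwards [weakPartial_shift hf hgi hw h] with x hx hxU
        rw [hx hxU]
    _ ≤ ∫⁻ x, ‖∫ s, G (x + s • h) ∂unitVol‖ₑ ^ 2 := setLIntegral_le_lintegral _ _
    _ ≤ ∫⁻ x, (∫⁻ s, ‖G (x + s • h)‖ₑ ^ 2 ∂unitVol) := by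
        refine lintegral_mono_ae ?_
        filter_upwards [hsh.prod_right_ae] with x hx
        refine le_trans ?_ (lintegral_sq_le hx.aestronglyMeasurable.enorm)
        gcongr
        exact enorm_integral_le_lintegral_enorm _
    _ = ∫⁻ s, (∫⁻ x, ‖G (x + s • h)‖ₑ ^ 2) ∂unitVol := lintegral_lintegral_swap (hae.pow_const 2)
    _ = ∫⁻ x, ‖G x‖ₑ ^ 2 := by
        have : ∀ s : ℝ, ∫⁻ x, ‖G (x + s • h)‖ₑ ^ 2 = ∫⁻ x, ‖G x‖ₑ ^ 2 := fun s =>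
          lintegral_add_right_eq_self (fun x => ‖G x‖ₑ ^ 2) (s • h)
        simp only [this, lintegral_const, measure_univ, mul_one]
    _ = ∫⁻ x, ‖∑ i, (h i : ℂ) * g i x‖ₑ ^ 2 ∂(boxVol 2) := by
        rw [← lintegral_indicator hKm]
        congr 1; funext x
        by_cases hx : x ∈ (K : Set (E 2))
        · rw [hG, indicator_of_mem hx, indicator_of_mem hx]
        · rw [hG, indicator_of_notMem hx, indicator_of_notMem hx]; simp
    _ ≤ ∫⁻ x, ENNReal.ofReal (2 * ‖h‖ ^ 2) * ∑ i, ‖g i x‖ₑ ^ 2 ∂(boxVol 2) := by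
        refine lintegral_mono fun x => ?_
        have hh : ∀ i, ‖(h i : ℂ)‖ ≤ ‖h‖ := fun i => by
          simpa using PiLp.norm_apply_le h i
        have h1 : ‖∑ i, (h i : ℂ) * g i x‖ ^ 2 ≤ (2 * ‖h‖ ^ 2) * ∑ i, ‖g i x‖ ^ 2 := by
          have h2 : ‖∑ i, (h i : ℂ) * g i x‖ ≤ ‖h‖ * ‖g 0 x‖ + ‖h‖ * ‖g 1 x‖ := by
            rw [Fin.sum_univ_two]
            refine (norm_add_le _ _).trans ?_
            rw [norm_mul, norm_mul]
            gcongr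
            · exact hh 0
            · exact hh 1
          rw [Fin.sum_univ_two] at h2 ⊢
          rw [Fin.sum_univ_two]
          calc _ ≤ (‖h‖ * ‖g 0 x‖ + ‖h‖ * ‖g 1 x‖) ^ 2 := pow_le_pow_left₀ (norm_nonneg _) h2 2
            _ ≤ 2 * ‖h‖ ^ 2 * (‖g 0 x‖ ^ 2 + ‖g 1 x‖ ^ 2) := by
              have := mul_nonneg (sq_nonneg ‖h‖) (sq_nonneg (‖g 0 x‖ - ‖g 1 x‖))
              nlinarith
        have := ENNReal.ofReal_le_ofReal h1
        rw [ENNReal.ofReal_mul (by positivity), ENNReal.ofReal_pow (norm_nonneg _),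
          ENNReal.ofReal_sum_of_nonneg (fun _ _ => by positivity), ofReal_norm] at this
        simpa only [ENNReal.ofReal_pow (norm_nonneg _), ofReal_norm] using this
    _ = _ := by
        rw [lintegral_const_mul' _ _ ENNReal.ofReal_ne_top, lintegral_finsetSum' _ fun i _ =>
          (hg i).1.enorm.pow_const 2]

/-- With $y=x+h$ the kernel $\|h\|^{-3}$ meets a shift difference of size $\|h\|^2$. What remains is
$\|h\|^{-1}$ on the bounded range $\|h\|<2$, which is integrable in the plane. -/
lemma memLp_slobodetskij_half_of_measurable {f : E 2 → ℂ} {g : Fin 2 → E 2 → ℂ}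
    (hfm : Measurable f) (hf : Integrable f (boxVol 2))
    (hg : ∀ i, MemLp (g i) 2 (boxVol 2)) (hw : ∀ i, IsWeakPartial i f (g i)) :
    MemLp (slobodetskij (1 / 2) f) 2 ((boxVol 2).prod (boxVol 2)) := by
  have hm := measurable_slobodetskij (1 / 2) hfm
  have hKm : MeasurableSet (K : Set (E 2)) := K.isOpen.measurableSet
  refine memLp_two_iff.2 ⟨hm.aestronglyMeasurable, ?_⟩
  rw [lintegral_prod _ (by fun_prop)]
  set A := ∑ i, ∫⁻ x, ‖g i x‖ₑ ^ 2 ∂(boxVol 2) with hA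
  have hAt : A < ⊤ := ENNReal.sum_lt_top.2 fun i _ => (memLp_two_iff.1 (hg i)).2
  set H : E 2 → E 2 → ENNReal := fun x h => ((K : Set (E 2)) ∩ (fun x => x + h) ⁻¹' K).indicator
    (fun x => ENNReal.ofReal (‖h‖ ^ (-3 : ℝ)) * ‖f (x + h) - f x‖ₑ ^ 2) x with hH
  have hHm : Measurable (Function.uncurry H) := by
    have : Function.uncurry H = ({p : E 2 × E 2 | p.1 ∈ (K : Set (E 2))} ∩
        {p | p.1 + p.2 ∈ (K : Set (E 2))}).indicator
        (fun p => ENNReal.ofReal (‖p.2‖ ^ (-3 : ℝ)) * ‖f (p.1 + p.2) - f p.1‖ₑ ^ 2) := by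
      funext p; rfl
    rw [this]
    refine Measurable.indicator (by fun_prop) ?_
    exact (hKm.preimage measurable_fst).inter
      (hKm.preimage (measurable_fst.add measurable_snd))
  have hUm : ∀ h, MeasurableSet ((K : Set (E 2)) ∩ (fun x => x + h) ⁻¹' K) := fun h =>
    hKm.inter (hKm.preimage (by fun_prop))
  calc ∫⁻ x, ∫⁻ y, ‖slobodetskij (1 / 2) f (x, y)‖ₑ ^ 2 ∂(boxVol 2) ∂(boxVol 2)
      ≤ ∫⁻ x, ∫⁻ h, H x h := by
        rw [← lintegral_indicator hKm]
        refine lintegral_mono fun x => ?_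
        by_cases hx : x ∈ (K : Set (E 2))
        swap
        · rw [indicator_of_notMem hx]; exact zero_le
        rw [indicator_of_mem hx, ← lintegral_indicator hKm,
          ← lintegral_add_left_eq_self _ x]
        refine lintegral_mono fun h => ?_
        by_cases hy : x + h ∈ (K : Set (E 2))
        swap
        · rw [indicator_of_notMem hy]; exact zero_le
        rw [indicator_of_mem hy, hH]
        simp only
        rw [indicator_of_mem (show x ∈ (K : Set (E 2)) ∩ (fun x => x + h) ⁻¹' K from ⟨hx, hy⟩),
          ← ofReal_norm, norm_slobodetskij, ← ofReal_norm,
          ← ENNReal.ofReal_pow (by positivity), ← ENNReal.ofReal_pow (by positivity),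
          ← ENNReal.ofReal_mul (by positivity)]
        apply ENNReal.ofReal_le_ofReal
        simp only [sub_add_cancel_left, norm_neg, mul_pow]
        rw [← Real.rpow_natCast (‖h‖ ^ _), ← Real.rpow_mul (norm_nonneg _), norm_sub_rev (f x)]
        norm_num
    _ = ∫⁻ h, ∫⁻ x, H x h := lintegral_lintegral_swap hHm.aemeasurable
    _ ≤ ∫⁻ h : E 2, ENNReal.ofReal (‖h‖⁻¹) * (Iio (2 : ℝ)).indicator (fun _ => 2 * A) ‖h‖ := by
        refine lintegral_mono fun h => ?_
        by_cases hh : ‖h‖ ∈ Iio (2 : ℝ)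
        swap
        · rw [indicator_of_notMem hh, mul_zero]
          refine le_of_eq (lintegral_eq_zero_of_ae_eq_zero (Eventually.of_forall fun x => ?_))
          refine indicator_of_notMem (fun hx => hh ?_) _
          have := norm_sub_lt_two (show x + h ∈ (K : Set (E 2)) from hx.2) hx.1
          simpa using this
        rw [indicator_of_mem hh, hH]
        simp only
        rw [lintegral_indicator (hUm h), lintegral_const_mul _ (by fun_prop)]
        refine (mul_le_mul_right (lintegral_shift_sub_sq_le hf hg hw h) _).trans ?_
        rw [← mul_assoc, ← mul_assoc, ← ENNReal.ofReal_mul (by positivity)]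
        refine mul_le_mul_left ?_ A
        have e2 : ENNReal.ofReal ‖h‖⁻¹ * 2 = ENNReal.ofReal (‖h‖⁻¹ * 2) := by
          rw [ENNReal.ofReal_mul (by positivity)]; norm_num
        rw [e2]
        apply ENNReal.ofReal_le_ofReal
        rcases (norm_nonneg h).eq_or_lt with h0 | h0
        · simp [norm_eq_zero.1 h0.symm]
        · apply le_of_eq
          rw [Real.rpow_neg h0.le]
          norm_cast
          field_simp
    _ < ⊤ := by
        rw [lintegral_polar (Ψ := (Iio (2 : ℝ)).indicator (fun _ => 2 * A))
          (measurable_const.indicator measurableSet_Iio), lintegral_indicator measurableSet_Iio,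
          Measure.restrict_restrict measurableSet_Iio, lintegral_const]
        have e : Iio (2 : ℝ) ∩ Ioi 0 = Ioo 0 2 := by ext; simp [and_comm]
        rw [e, Measure.restrict_apply_univ, Real.volume_Ioo]
        exact ENNReal.mul_lt_top ENNReal.ofReal_lt_top (ENNReal.mul_lt_top
          (ENNReal.mul_lt_top (by norm_num) hAt) ENNReal.ofReal_lt_top)

lemma memLp_slobodetskij_half {f : E 2 → ℂ} {g : Fin 2 → E 2 → ℂ} (hf : MemLp f 2 (boxVol 2))
    (hg : ∀ i, MemLp (g i) 2 (boxVol 2)) (hw : ∀ i, IsWeakPartial i f (g i)) :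
    MemLp (slobodetskij (1 / 2) f) 2 ((boxVol 2).prod (boxVol 2)) := by
  obtain ⟨f', hfm, hff⟩ := hf.1
  have h1 : Integrable f' (boxVol 2) := (hf.ae_eq hff).integrable (by norm_num)
  exact (memLp_slobodetskij_half_of_measurable hfm.measurable h1 hg
    fun i => isWeakPartial_congr hff (hw i)).ae_eq (slobodetskij_congr_ae _ hff.symm)

/-! ### Integrability against the gradients of the edge lifts -/

lemma MemSobolevAux.memLp {n m : ℕ} {σ : ℝ} {f : E n → ℂ} (h : MemSobolevAux σ m f) :
    MemLp f 2 (boxVol n) := by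
  cases m <;> exact h.1

lemma MemSobolev.memLp {n : ℕ} {r : ℝ} {f : E n → ℂ} (h : MemSobolev r f) : MemLp f 2 (boxVol n) :=
  MemSobolevAux.memLp h

/-- For $r<1$ the Slobodetskij seminorm is part of the definition. For $r\ge1$ only the square
integrable first derivatives are kept, and they provide the order $\sigma=1/2$. -/
lemma MemSobolev.lintegral_lt_top {r : ℝ} (hr : 0 < r) {f : E 2 → ℂ} (h : MemSobolev r f) :
    ∫⁻ x, ENNReal.ofReal (‖f x‖ * (vertexWeight x)⁻¹) ∂(boxVol 2) < ⊤ := by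
  unfold MemSobolev at h
  rcases hm : ⌊r⌋₊ with _ | m
  · rw [hm] at h
    have hr1 : r < 1 := Nat.floor_eq_zero.1 hm
    have hfr : Int.fract r = r := Int.fract_eq_self.2 ⟨hr.le, hr1⟩
    rw [hfr] at h
    exact lintegral_mul_inv_vertexWeight_lt_top hr hr1 h.1 (h.2 hr)
  · rw [hm] at h
    choose g hg hg' using h.2
    exact lintegral_mul_inv_vertexWeight_lt_top (σ := 1 / 2) (by norm_num) (by norm_num) h.1
      (memLp_slobodetskij_half h.1 (fun i => (hg' i).memLp) hg)

/-- This makes the integral in `edgeFlux` a genuine one rather than the default value, so that the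
four fluxes can be added under the integral sign. -/
lemma MemSobolev.integrable_mul_pd_edgeLift {r : ℝ} (hr : 0 < r) {f : E 2 → ℂ}
    (h : MemSobolev r f) (i : Fin 4) (j : Fin 2) :
    Integrable (fun x => f x * pd j (edgeLift i) x) (boxVol 2) := by
  have hm : Measurable (pd j (edgeLift i)) := by
    unfold pd; exact measurable_fderiv_apply_const ℝ _ _
  refine ⟨h.memLp.1.mul hm.aestronglyMeasurable, ?_⟩
  refine lt_of_le_of_lt (setLIntegral_mono' K.isOpen.measurableSet
    (g := fun x => 3 * ENNReal.ofReal (‖f x‖ * (vertexWeight x)⁻¹)) fun x hx => ?_) ?_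
  · rw [← ofReal_norm, norm_mul, ← ENNReal.ofReal_ofNat 3, ← ENNReal.ofReal_mul (by norm_num)]
    apply ENNReal.ofReal_le_ofReal
    have := mul_le_mul_of_nonneg_left (norm_pd_edgeLift_le i j hx) (norm_nonneg (f x))
    refine this.trans (le_of_eq ?_)
    rw [div_eq_mul_inv]; ring
  · rw [lintegral_const_mul' _ _ (by norm_num)]
    exact ENNReal.mul_lt_top (by norm_num) (h.lintegral_lt_top hr)

/-! ### The total flux -/

lemma pairing_of_mem (D : Module.Dual ℂ HHalf) {f : E 2 → ℂ} (hf : f ∈ HHalf) :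
    pairing D f = D ⟨f, hf⟩ := dif_pos hf

lemma one_mem_HHalf : (fun _ => 1 : E 2 → ℂ) ∈ HHalf := by
  refine ⟨memLp_const 1, ?_⟩
  have : slobodetskij (n := 2) (1 / 2) (fun _ => 1) = 0 := by
    funext z; simp [slobodetskij]
  rw [this]; exact MemLp.zero

lemma hHalfNorm_eq_zero_of_ae {f : E 2 → ℂ} (h : f =ᵐ[boxVol 2] 0) : hHalfNorm f = 0 := by
  have h1 : eLpNorm f 2 (boxVol 2) = 0 := by rw [eLpNorm_congr_ae h]; simp
  have h2 : eLpNorm (slobodetskij (1 / 2) f) 2 ((boxVol 2).prod (boxVol 2)) = 0 := by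
    rw [eLpNorm_congr_ae (slobodetskij_congr_ae _ h)]
    have : slobodetskij (n := 2) (1 / 2) 0 = 0 := by funext z; simp [slobodetskij]
    rw [this]; simp
  rw [hHalfNorm, h1, h2]; simp

/-- Elements of `HHalf` are functions, not classes, and a bounded functional cannot see null sets.
This matters because the edge lifts are only known to sum to $1$ inside $K$. -/
lemma MemHTildeNegHalf.congr_ae {D : Module.Dual ℂ HHalf} (hD : MemHTildeNegHalf D) {v w : HHalf}
    (h : (v : E 2 → ℂ) =ᵐ[boxVol 2] w) : D v = D w := by
  obtain ⟨C, hC⟩ := hD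
  have h1 := hC (v - w)
  have h2 : ((v - w : HHalf) : E 2 → ℂ) =ᵐ[boxVol 2] 0 := by
    filter_upwards [h] with x hx
    simp [hx]
  rw [hHalfNorm_eq_zero_of_ae h2, mul_zero, map_sub] at h1
  exact sub_eq_zero.1 (norm_le_zero_iff.1 h1)

/-- The lifts form a partition of unity on $K$: their gradients cancel in the volume terms of
Green's formula, and the pairings add up to the pairing with $1$. -/
lemma sum_edgeFlux {r : ℝ} (hr : 0 < r) {u : Fin 2 → E 2 → ℂ} (hu : ∀ j, MemSobolev r (u j))
    (hD : MemHTildeNegHalf (divNegHalf u)) :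
    ∑ i, edgeFlux u i = pairing (divNegHalf u) (fun _ => 1) := by
  have h1 : ∑ i, ∫ x, ∑ j, u j x * pd j (edgeLift i) x ∂(boxVol 2) = 0 := by
    rw [← integral_finsetSum]
    · refine integral_eq_zero_of_ae ?_
      filter_upwards [ae_boxVol_mem 2] with x hx
      rw [Finset.sum_comm]
      simp only [← Finset.mul_sum, sum_pd_edgeLift _ hx, mul_zero, Finset.sum_const_zero]
      rfl
    · intro i _
      exact integrable_finsetSum _ fun j _ => (hu j).integrable_mul_pd_edgeLift hr i j
  have h2 : ∑ i, pairing (divNegHalf u) (edgeLift i) = pairing (divNegHalf u) (fun _ => 1) := by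
    simp only [pairing_of_mem _ (edgeLift_mem_HHalf _), pairing_of_mem _ one_mem_HHalf]
    rw [← map_sum]
    refine hD.congr_ae ?_
    filter_upwards [ae_boxVol_mem 2] with x hx
    rw [← sum_edgeLift hx]
    simp
  simp only [edgeFlux, normalTrace, Finset.sum_add_distrib]
  rw [h1, h2, add_zero]

lemma memHTildeNegHalf_divNegHalf {u : Fin 2 → E 2 → ℂ} (h : MemHTildeDiv u) :
    MemHTildeNegHalf (divNegHalf u) := by
  rw [divNegHalf, dif_pos h]
  exact h.choose_spec.1

/-! ### The trace theorem on the bottom face of the cube -/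

/-- The squared length of the gradient. -/
def gradSq (z : E 3 → ℂ) (p : E 3) : ENNReal := ∑ i, ‖pd i z p‖ₑ ^ 2

lemma continuous_pd {n : ℕ} {z : E n → ℂ} (hz : ContDiff ℝ ∞ z) (i : Fin n) :
    Continuous (pd i z) := by
  have : Continuous (fderiv ℝ z) := hz.continuous_fderiv (by simp)
  unfold pd; fun_prop

lemma measurable_gradSq {z : E 3 → ℂ} (hz : ContDiff ℝ ∞ z) : Measurable (gradSq z) := by
  have := fun i => (continuous_pd hz i).measurable
  unfold gradSq
  exact Finset.measurable_sum _ fun i _ => (this i).enorm.pow_const 2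

lemma measurable_lift3 : Measurable lift3 := measurableEmbedding_lift3.measurable

lemma continuous_lift3 : Continuous lift3 := by
  unfold lift3
  refine (PiLp.continuous_toLp 2 _).comp (continuous_pi fun i => ?_)
  fin_cases i <;> simp <;> fun_prop

lemma lift3_add_smul (x v : E 2) (t b s : ℝ) :
    lift3 (x + s • v, t + s * b) = lift3 (x, t) + s • lift3 (v, b) := by
  ext i; fin_cases i <;> simp [lift3]

lemma norm_lift3_sq (x : E 2) (t : ℝ) : ‖lift3 (x, t)‖ ^ 2 = ‖x‖ ^ 2 + t ^ 2 := by
  simp [EuclideanSpace.norm_sq_eq, lift3, Fin.sum_univ_succ, add_assoc]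

lemma enorm_fderiv_apply_sq_le (z : E 3 → ℂ) (p v : E 3) :
    ‖fderiv ℝ z p v‖ₑ ^ 2 ≤ ENNReal.ofReal (‖v‖ ^ 2) * gradSq z p := by
  have h : ‖fderiv ℝ z p v‖ ^ 2 ≤ ‖v‖ ^ 2 * ∑ i, ‖pd i z p‖ ^ 2 := by
    rw [fderiv_apply_eq_sum, EuclideanSpace.norm_sq_eq]
    calc ‖∑ i, (v i : ℂ) * pd i z p‖ ^ 2 ≤ (∑ i, ‖v i‖ * ‖pd i z p‖) ^ 2 := by
          gcongr
          refine (norm_sum_le _ _).trans (le_of_eq ?_)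
          refine Finset.sum_congr rfl fun i _ => ?_
          rw [norm_mul, Complex.norm_real]
      _ ≤ _ := Finset.sum_mul_sq_le_sq_mul_sq _ _ _
  have := ENNReal.ofReal_le_ofReal h
  rw [ENNReal.ofReal_mul (by positivity), ENNReal.ofReal_pow (norm_nonneg _),
    ENNReal.ofReal_sum_of_nonneg (fun _ _ => by positivity), ofReal_norm] at this
  simpa only [gradSq, ENNReal.ofReal_pow (norm_nonneg (pd _ _ _)), ofReal_norm] using this

lemma enorm_sub_le_lintegral_segment {z : E 3 → ℂ} (hz : ContDiff ℝ ∞ z) (p v : E 3) :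
    ‖z (p + v) - z p‖ₑ ≤ ∫⁻ s, ‖fderiv ℝ z (p + s • v) v‖ₑ ∂unitVol := by
  have hd : ∀ s : ℝ, HasDerivAt (fun s : ℝ => z (p + s • v)) (fderiv ℝ z (p + s • v) v) s := by
    intro s
    have hl : HasDerivAt (fun τ : ℝ => p + τ • v) v s := by
      simpa using ((hasDerivAt_id s).smul_const v).const_add p
    exact (hz.differentiable (by simp) _).hasFDerivAt.comp_hasDerivAt s hl
  have hc : Continuous fun s : ℝ => fderiv ℝ z (p + s • v) v := by
    have : Continuous (fderiv ℝ z) := hz.continuous_fderiv (by simp)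
    fun_prop
  have := intervalIntegral.integral_eq_sub_of_hasDerivAt (fun s _ => hd s)
    (hc.intervalIntegrable 0 1)
  rw [one_smul, zero_smul, add_zero, intervalIntegral.integral_of_le zero_le_one,
    integral_Ioc_eq_integral_Ioo] at this
  rw [← this]
  exact enorm_integral_le_lintegral_enorm _

lemma enorm_add_sq_le (a b : ℂ) : ‖a + b‖ₑ ^ 2 ≤ 2 * ‖a‖ₑ ^ 2 + 2 * ‖b‖ₑ ^ 2 := by
  have h : ‖a + b‖ ^ 2 ≤ 2 * ‖a‖ ^ 2 + 2 * ‖b‖ ^ 2 := by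
    have := pow_le_pow_left₀ (norm_nonneg _) (norm_add_le a b) 2
    nlinarith [sq_nonneg (‖a‖ - ‖b‖)]
  have := ENNReal.ofReal_le_ofReal h
  rw [ENNReal.ofReal_add (by positivity) (by positivity), ENNReal.ofReal_mul (by norm_num),
    ENNReal.ofReal_mul (by norm_num)] at this
  simpa only [ENNReal.ofReal_pow (norm_nonneg _), ofReal_norm, ENNReal.ofReal_ofNat] using this

/-- The weighted integral used for the trace estimate. -/
def sqrtInt : ENNReal := ∫⁻ s, ENNReal.ofReal (s ^ (-(1 / 2) : ℝ)) ∂unitVol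

lemma sqrtInt_lt_top : sqrtInt < ⊤ := lintegral_rpow_neg_lt_top (by norm_num)

/-- The energy of `z` along the segment from the bottom face below `x` to the point halfway towards
`y`, raised by half of their distance. -/
def segmentEnergy (z : E 3 → ℂ) (x y : E 2) : ENNReal :=
  ∫⁻ s, ENNReal.ofReal (s ^ (1 / 2 : ℝ)) *
    gradSq z (lift3 (x + (s / 2) • (y - x), s / 2 * ‖y - x‖)) ∂unitVol

/-- The bottom points below $x$ and $y$ are both joined to the point above their midpoint at height
$\|y-x\|/2$. Cauchy-Schwarz is applied with the weights $s^{-1/4}s^{1/4}$: integrating the energy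
over all pairs costs $1/s$ at parameter $s$, and the gained $s^{1/2}$ leaves the integrable
$s^{-1/2}$. -/
lemma enorm_sub_mid_sq_le {z : E 3 → ℂ} (hz : ContDiff ℝ ∞ z) (x y : E 2) :
    ‖z (lift3 (x + (1 / 2 : ℝ) • (y - x), 1 / 2 * ‖y - x‖)) - z (lift3 (x, 0))‖ₑ ^ 2 ≤
      ENNReal.ofReal (‖y - x‖ ^ 2) * (sqrtInt * segmentEnergy z x y) := by
  set v := lift3 ((1 / 2 : ℝ) • (y - x), 1 / 2 * ‖y - x‖) with hv
  have hvn : ‖v‖ ^ 2 ≤ ‖y - x‖ ^ 2 := by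
    rw [hv, norm_lift3_sq, norm_smul]
    norm_num
    nlinarith [sq_nonneg ‖y - x‖]
  have hpath : ∀ s : ℝ, lift3 (x, 0) + s • v = lift3 (x + (s / 2) • (y - x), s / 2 * ‖y - x‖) := by
    intro s
    rw [hv, ← lift3_add_smul, smul_smul, show s * (1 / 2 : ℝ) = s / 2 by ring,
      show 0 + s * (1 / 2 * ‖y - x‖) = s / 2 * ‖y - x‖ by ring]
  have h1 : lift3 (x + (1 / 2 : ℝ) • (y - x), 1 / 2 * ‖y - x‖) = lift3 (x, 0) + v := by
    have := hpath 1; rw [one_smul] at this; exact this.symm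
  have hc : Measurable fun s : ℝ => ‖fderiv ℝ z (lift3 (x, 0) + s • v) v‖ₑ := by
    have : Continuous (fderiv ℝ z) := hz.continuous_fderiv (by simp)
    have h : Continuous fun s : ℝ => fderiv ℝ z (lift3 (x, 0) + s • v) v := by fun_prop
    exact h.measurable.enorm
  have hw : ∀ s ∈ Ioo (0 : ℝ) 1, ENNReal.ofReal (s ^ (-(1 / 4) : ℝ)) *
      ENNReal.ofReal (s ^ (1 / 4 : ℝ)) = 1 := by
    intro s hs
    rw [← ENNReal.ofReal_mul (Real.rpow_nonneg hs.1.le _), ← Real.rpow_add hs.1]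
    norm_num
  have hsq : ∀ s ∈ Ioo (0 : ℝ) 1, ∀ a b : ℝ, a * 2 = b →
      ENNReal.ofReal (s ^ a) ^ 2 = ENNReal.ofReal (s ^ b) := by
    intro s hs a b hab
    rw [← ENNReal.ofReal_pow (Real.rpow_nonneg hs.1.le _), ← Real.rpow_natCast, ← Real.rpow_mul hs.1.le]
    push_cast; rw [hab]
  rw [h1]
  calc ‖z (lift3 (x, 0) + v) - z (lift3 (x, 0))‖ₑ ^ 2
      ≤ (∫⁻ s, ENNReal.ofReal (s ^ (-(1 / 4) : ℝ)) * (ENNReal.ofReal (s ^ (1 / 4 : ℝ)) *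
          ‖fderiv ℝ z (lift3 (x, 0) + s • v) v‖ₑ) ∂unitVol) ^ 2 := by
        gcongr
        refine (enorm_sub_le_lintegral_segment hz _ _).trans (le_of_eq ?_)
        refine setLIntegral_congr_fun measurableSet_Ioo fun s hs => ?_
        rw [← mul_assoc, hw s hs, one_mul]
    _ ≤ (∫⁻ s, ENNReal.ofReal (s ^ (-(1 / 4) : ℝ)) ^ 2 ∂unitVol) *
          ∫⁻ s, (ENNReal.ofReal (s ^ (1 / 4 : ℝ)) *
          ‖fderiv ℝ z (lift3 (x, 0) + s • v) v‖ₑ) ^ 2 ∂unitVol :=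
        lintegral_mul_sq_le (by fun_prop) (by fun_prop)
    _ ≤ sqrtInt * ∫⁻ s, ENNReal.ofReal (‖y - x‖ ^ 2) * (ENNReal.ofReal (s ^ (1 / 2 : ℝ)) *
          gradSq z (lift3 (x + (s / 2) • (y - x), s / 2 * ‖y - x‖))) ∂unitVol := by
        refine mul_le_mul' (le_of_eq ?_) ?_
        · refine setLIntegral_congr_fun measurableSet_Ioo fun s hs => ?_
          exact hsq s hs _ _ (by norm_num)
        · refine setLIntegral_mono' measurableSet_Ioo fun s hs => ?_
          rw [mul_pow, hsq s hs _ (1 / 2) (by norm_num), ← hpath]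
          rw [← mul_assoc, mul_comm (ENNReal.ofReal (‖y - x‖ ^ 2)), mul_assoc]
          gcongr
          refine (enorm_fderiv_apply_sq_le z _ v).trans ?_
          gcongr
    _ = _ := by
        rw [lintegral_const_mul' _ _ ENNReal.ofReal_ne_top]
        unfold segmentEnergy
        ring

lemma measurable_segmentEnergy_integrand {z : E 3 → ℂ} (hz : ContDiff ℝ ∞ z) :
    Measurable fun q : (E 2 × E 2) × ℝ => ENNReal.ofReal (q.2 ^ (1 / 2 : ℝ)) *
      gradSq z (lift3 (q.1.1 + (q.2 / 2) • (q.1.2 - q.1.1), q.2 / 2 * ‖q.1.2 - q.1.1‖)) := by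
  have h1 := measurable_gradSq hz
  have h2 := measurable_lift3
  refine Measurable.mul (by fun_prop) (h1.comp (h2.comp ?_))
  fun_prop

lemma measurable_segmentEnergy {z : E 3 → ℂ} (hz : ContDiff ℝ ∞ z) :
    Measurable fun q : E 2 × E 2 => segmentEnergy z q.1 q.2 :=
  (measurable_segmentEnergy_integrand hz).lintegral_prod_right'

/-- In terms of $\xi=y-x$, translation invariance in $x$ leaves the energy of the horizontal slice
at height $s\|\xi\|/2$. Polar coordinates absorb $1/\|\xi\|$ and give $2\pi$; rescaling the radius
to the height gives $2/s$. -/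
lemma lintegral_segment_le {z : E 3 → ℂ} (hz : ContDiff ℝ ∞ z) {s : ℝ} (hs : s ∈ Ioo (0 : ℝ) 1) :
    ∫⁻ x, ∫⁻ y, ENNReal.ofReal (‖y - x‖⁻¹) *
      gradSq z (lift3 (x + (s / 2) • (y - x), s / 2 * ‖y - x‖)) ∂(boxVol 2) ∂(boxVol 2) ≤
    ENNReal.ofReal (4 * Real.pi) * ENNReal.ofReal s⁻¹ * ∫⁻ p, gradSq z p ∂(boxVol 3) := by
  have hKm : MeasurableSet (K : Set (E 2)) := K.isOpen.measurableSet
  have hgm := measurable_gradSq hz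
  set S : Set (E 2 × ℝ) := (K : Set (E 2)) ×ˢ Ioo (0 : ℝ) 1 with hS
  have hSm : MeasurableSet S := hKm.prod measurableSet_Ioo
  set N : E 2 × ℝ → ENNReal := S.indicator fun q => gradSq z (lift3 q) with hN
  have hNm : Measurable N := (hgm.comp measurable_lift3).indicator hSm
  have hNv : ∀ t : ℝ, ∀ v : E 2, ∫⁻ x, N (x + v, t) = ∫⁻ x, N (x, t) := fun t v =>
    lintegral_add_right_eq_self (fun x => N (x, t)) v
  set Φ : ℝ → ENNReal := fun t => ∫⁻ x, N (x, t) with hΦ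
  have hΦm : Measurable Φ := hNm.lintegral_prod_left'
  calc _ ≤ ∫⁻ x, ∫⁻ ξ : E 2, ENNReal.ofReal (‖ξ‖⁻¹) * N (x + (s / 2) • ξ, s / 2 * ‖ξ‖) := by
        rw [← lintegral_indicator hKm]
        refine lintegral_mono fun x => ?_
        by_cases hx : x ∈ (K : Set (E 2))
        swap
        · rw [indicator_of_notMem hx]; exact zero_le
        rw [indicator_of_mem hx, ← lintegral_indicator hKm, ← lintegral_add_right_eq_self _ x]
        refine lintegral_mono fun ξ => ?_
        by_cases hy : ξ + x ∈ (K : Set (E 2))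
        swap
        · rw [indicator_of_notMem hy]; exact zero_le
        rw [indicator_of_mem hy, add_sub_cancel_right]
        -- For $\xi=0$ the height is $0$, outside the open cube, but the inverse of $0$ is $0$ by
        -- convention and the term vanishes.
        rcases (norm_nonneg ξ).eq_or_lt with h0 | h0
        · rw [← h0]; simp
        have hm : (x + (s / 2) • ξ, s / 2 * ‖ξ‖) ∈ S := by
          constructor
          · have := convex_K hx hy (a := 1 - s / 2) (b := s / 2) (by linarith [hs.2])
              (by linarith [hs.1]) (by ring)
            have e : (1 - s / 2) • x + (s / 2) • (ξ + x) = x + (s / 2) • ξ := by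
              rw [smul_add, sub_smul, one_smul]; abel
            rwa [e] at this
          · have h2 : ‖ξ‖ < 2 := by simpa using norm_sub_lt_two hy hx
            exact ⟨mul_pos (by linarith [hs.1]) h0, by nlinarith [hs.1, hs.2]⟩
        rw [hN, indicator_of_mem hm]
    _ = ∫⁻ ξ : E 2, ∫⁻ x, ENNReal.ofReal (‖ξ‖⁻¹) * N (x + (s / 2) • ξ, s / 2 * ‖ξ‖) := by
        refine lintegral_lintegral_swap (Measurable.aemeasurable ?_)
        unfold Function.uncurry
        refine Measurable.mul (by fun_prop) (hNm.comp (by fun_prop))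
    _ = ∫⁻ ξ : E 2, ENNReal.ofReal (‖ξ‖⁻¹) * Φ (s / 2 * ‖ξ‖) := by
        congr 1; funext ξ
        rw [lintegral_const_mul' _ _ ENNReal.ofReal_ne_top, hNv]
    _ = ENNReal.ofReal (2 * Real.pi) * ∫⁻ ρ in Ioi (0 : ℝ), Φ (s / 2 * ρ) :=
        lintegral_polar (Ψ := fun ρ => Φ (s / 2 * ρ)) (by fun_prop)
    _ ≤ ENNReal.ofReal (2 * Real.pi) * ∫⁻ ρ, Φ (s / 2 * ρ) := by
        exact mul_le_mul_right (setLIntegral_le_lintegral _ _) _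
    _ = ENNReal.ofReal (2 * Real.pi) * (ENNReal.ofReal (2 * s⁻¹) * ∫⁻ t, Φ t) := by
        have hs2 : s / 2 ≠ 0 := by linarith [hs.1]
        rw [← lintegral_map (f := Φ) hΦm (by fun_prop : Measurable fun ρ : ℝ => s / 2 * ρ),
          Real.map_volume_mul_left hs2, lintegral_smul_measure, smul_eq_mul]
        congr 3
        rw [abs_of_pos (by have := hs.1; positivity)]
        field_simp
    _ = _ := by
        have e : ∫⁻ t, Φ t = ∫⁻ p, gradSq z p ∂(boxVol 3) := by
          rw [lintegral_box3, Measure.prod_restrict, ← lintegral_indicator hSm,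
            lintegral_prod_symm _ hNm.aemeasurable]
        rw [e, ← mul_assoc, ← ENNReal.ofReal_mul (by positivity),
          ← ENNReal.ofReal_mul (by positivity)]
        congr 2; ring

/-- The integrand of `segmentEnergy` at the parameter `s`, divided by the distance of the points. -/
def segmentDensity (z : E 3 → ℂ) (s : ℝ) (x y : E 2) : ENNReal :=
  ENNReal.ofReal (‖y - x‖⁻¹) * gradSq z (lift3 (x + (s / 2) • (y - x), s / 2 * ‖y - x‖))

lemma measurable_segmentDensity {z : E 3 → ℂ} (hz : ContDiff ℝ ∞ z) :
    Measurable fun q : (E 2 × E 2) × ℝ => segmentDensity z q.2 q.1.1 q.1.2 := by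
  have h1 := measurable_gradSq hz
  have h2 := measurable_lift3
  refine Measurable.mul (by fun_prop) (h1.comp (h2.comp ?_))
  fun_prop

lemma mul_segmentEnergy_eq (z : E 3 → ℂ) (x y : E 2) :
    ENNReal.ofReal (‖y - x‖⁻¹) * segmentEnergy z x y =
      ∫⁻ s, ENNReal.ofReal (s ^ (1 / 2 : ℝ)) * segmentDensity z s x y ∂unitVol := by
  rw [segmentEnergy, ← lintegral_const_mul' _ _ ENNReal.ofReal_ne_top]
  refine lintegral_congr fun s => ?_
  rw [segmentDensity, ← mul_assoc, ← mul_assoc, mul_comm (ENNReal.ofReal ‖y - x‖⁻¹)]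

lemma lintegral_segmentDensity_le {z : E 3 → ℂ} (hz : ContDiff ℝ ∞ z) {s : ℝ}
    (hs : s ∈ Ioo (0 : ℝ) 1) :
    ∫⁻ q : E 2 × E 2, ENNReal.ofReal (s ^ (1 / 2 : ℝ)) * segmentDensity z s q.1 q.2
        ∂((boxVol 2).prod (boxVol 2)) ≤
      ENNReal.ofReal (s ^ (-(1 / 2) : ℝ)) * (ENNReal.ofReal (4 * Real.pi) *
        ∫⁻ p, gradSq z p ∂(boxVol 3)) := by
  have hms : Measurable fun q : E 2 × E 2 => segmentDensity z s q.1 q.2 := by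
    have h1 := measurable_gradSq hz
    have h2 := measurable_lift3
    refine Measurable.mul (by fun_prop) (h1.comp (h2.comp ?_))
    fun_prop
  rw [lintegral_const_mul' _ _ ENNReal.ofReal_ne_top, lintegral_prod _ hms.aemeasurable]
  refine (mul_le_mul_right (lintegral_segment_le hz hs) _).trans (le_of_eq ?_)
  have e : s ^ (-(1 / 2) : ℝ) = s ^ (1 / 2 : ℝ) * s⁻¹ := by
    rw [← Real.rpow_neg_one, ← Real.rpow_add hs.1]; norm_num
  rw [e, ENNReal.ofReal_mul (Real.rpow_nonneg hs.1.le _)]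
  generalize ∫⁻ p, gradSq z p ∂(boxVol 3) = N
  ring

lemma lintegral_segmentEnergy_le {z : E 3 → ℂ} (hz : ContDiff ℝ ∞ z) :
    ∫⁻ x, ∫⁻ y, ENNReal.ofReal (‖y - x‖⁻¹) * segmentEnergy z x y ∂(boxVol 2) ∂(boxVol 2) ≤
      ENNReal.ofReal (4 * Real.pi) * sqrtInt * ∫⁻ p, gradSq z p ∂(boxVol 3) := by
  have hm2 : Measurable fun q : (E 2 × E 2) × ℝ => ENNReal.ofReal (q.2 ^ (1 / 2 : ℝ)) *
      segmentDensity z q.2 q.1.1 q.1.2 :=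
    Measurable.mul (by fun_prop) (measurable_segmentDensity hz)
  simp only [mul_segmentEnergy_eq]
  rw [← lintegral_prod (fun q : E 2 × E 2 => ∫⁻ s, ENNReal.ofReal (s ^ (1 / 2 : ℝ)) *
    segmentDensity z s q.1 q.2 ∂unitVol) hm2.lintegral_prod_right'.aemeasurable]
  rw [lintegral_lintegral_swap (f := fun (q : E 2 × E 2) s => ENNReal.ofReal (s ^ (1 / 2 : ℝ)) *
    segmentDensity z s q.1 q.2) hm2.aemeasurable]
  refine (setLIntegral_mono' measurableSet_Ioo
    fun s hs => lintegral_segmentDensity_le hz hs).trans (le_of_eq ?_)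
  rw [lintegral_mul_const _ (by fun_prop)]
  unfold sqrtInt
  ring

/-- The trace on the bottom face. -/
def bottom (z : E 3 → ℂ) (x : E 2) : ℂ := z !₂[x 0, x 1, 0]

lemma continuous_bottom {z : E 3 → ℂ} (hz : ContDiff ℝ ∞ z) : Continuous (bottom z) := by
  have : bottom z = fun x => z (lift3 (x, 0)) := rfl
  rw [this]
  exact hz.continuous.comp (continuous_lift3.comp (by fun_prop))

/-- The two segments through the common midpoint contribute symmetrically. The kernel $\|y-x\|^{-3}$
and the squared path length leave the factor $\|y-x\|^{-1}$ of `lintegral_segmentEnergy_le`. -/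
lemma lintegral_slobodetskij_bottom_le {z : E 3 → ℂ} (hz : ContDiff ℝ ∞ z) :
    ∫⁻ q, ‖slobodetskij (1 / 2) (bottom z) q‖ₑ ^ 2 ∂((boxVol 2).prod (boxVol 2)) ≤
      4 * sqrtInt * (ENNReal.ofReal (4 * Real.pi) * sqrtInt * ∫⁻ p, gradSq z p ∂(boxVol 3)) := by
  have hme := measurable_segmentEnergy hz
  set B : E 2 × E 2 → ENNReal := fun q =>
    ENNReal.ofReal (‖q.2 - q.1‖⁻¹) * segmentEnergy z q.1 q.2 with hB
  have hBm : Measurable B := Measurable.mul (by fun_prop) hme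
  have key : ∀ q : E 2 × E 2, ‖slobodetskij (1 / 2) (bottom z) q‖ₑ ^ 2 ≤
      2 * sqrtInt * (B q + B q.swap) := by
    rintro ⟨x, y⟩
    have h1 := enorm_sub_mid_sq_le hz x y
    have h2 := enorm_sub_mid_sq_le hz y x
    have hmid : y + (1 / 2 : ℝ) • (x - y) = x + (1 / 2 : ℝ) • (y - x) := by
      ext i; simp; ring
    rw [hmid, norm_sub_rev x y] at h2
    set a := z (lift3 (x + (1 / 2 : ℝ) • (y - x), 1 / 2 * ‖y - x‖)) with ha
    have h3 : ‖bottom z x - bottom z y‖ₑ ^ 2 ≤ ENNReal.ofReal (‖y - x‖ ^ 2) *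
        (2 * sqrtInt * (segmentEnergy z x y + segmentEnergy z y x)) := by
      have e : bottom z x - bottom z y = -(a - z (lift3 (x, 0))) + (a - z (lift3 (y, 0))) := by
        simp only [bottom, lift3]; ring
      rw [e]
      refine (enorm_add_sq_le _ _).trans ?_
      rw [enorm_neg]
      refine (add_le_add (mul_le_mul_right h1 2) (mul_le_mul_right h2 2)).trans (le_of_eq ?_)
      ring
    have h4 : ‖slobodetskij (1 / 2) (bottom z) (x, y)‖ₑ ^ 2 =
        ENNReal.ofReal (‖y - x‖ ^ (-3 : ℝ)) * ‖bottom z x - bottom z y‖ₑ ^ 2 := by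
      rw [← ofReal_norm, norm_slobodetskij, ← ofReal_norm, ← ENNReal.ofReal_pow (by positivity),
        ← ENNReal.ofReal_pow (by positivity), ← ENNReal.ofReal_mul (by positivity)]
      congr 1
      simp only [mul_pow]
      rw [← Real.rpow_natCast (‖x - y‖ ^ _), ← Real.rpow_mul (norm_nonneg _), norm_sub_rev x y]
      norm_num
    rw [h4]
    refine (mul_le_mul_right h3 _).trans (le_of_eq ?_)
    rw [hB]
    simp only [Prod.swap_prod_mk]
    rw [norm_sub_rev x y, ← mul_assoc, ← ENNReal.ofReal_mul (by positivity)]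
    have e : ‖y - x‖ ^ (-3 : ℝ) * ‖y - x‖ ^ 2 = ‖y - x‖⁻¹ := by
      rcases (norm_nonneg (y - x)).eq_or_lt with h0 | h0
      · rw [norm_eq_zero.1 h0.symm]; simp
      · rw [Real.rpow_neg h0.le]
        norm_cast
        field_simp
    rw [e]; ring
  have hI : ∫⁻ q, B q ∂((boxVol 2).prod (boxVol 2)) ≤
      ENNReal.ofReal (4 * Real.pi) * sqrtInt * ∫⁻ p, gradSq z p ∂(boxVol 3) := by
    rw [lintegral_prod _ hBm.aemeasurable]
    exact lintegral_segmentEnergy_le hz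
  refine (lintegral_mono key).trans ?_
  rw [lintegral_const_mul _ (by fun_prop), lintegral_add_left hBm, lintegral_prod_swap]
  refine (mul_le_mul_right (add_le_add hI hI) _).trans (le_of_eq ?_)
  ring

/-! ### Vertical integration: Poincaré inequality and bound of the trace -/

lemma hasDerivAt_comp_lift3 {z : E 3 → ℂ} (hz : ContDiff ℝ ∞ z) (x : E 2) (s : ℝ) :
    HasDerivAt (fun s : ℝ => z (lift3 (x, s))) (pd 2 z (lift3 (x, s))) s := by
  have hl : ∀ s : ℝ, lift3 (x, s) = lift3 (x, 0) + s • EuclideanSpace.single 2 1 := by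
    intro s
    ext i; fin_cases i <;> simp [lift3]
  have h1 : HasDerivAt (fun τ : ℝ => lift3 (x, τ)) (EuclideanSpace.single 2 1) s := by
    rw [funext hl]
    simpa using ((hasDerivAt_id s).smul_const (EuclideanSpace.single 2 1 : E 3)).const_add
      (lift3 (x, 0))
  exact (hz.differentiable (by simp) _).hasFDerivAt.comp_hasDerivAt s h1

/-- Integrate the vertical derivative from height $t$ to the top, where $z$ vanishes. Integration
over $t$ yields the Poincaré inequality, and $t=0$ yields the $L^2$ bound of the trace. -/
lemma IsTopZero.enorm_sq_le {z : E 3 → ℂ} (hz : IsTopZero z) {x : E 2} (hx : x ∈ (K : Set (E 2)))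
    {t : ℝ} (ht : t ∈ Ico (0 : ℝ) 1) :
    ‖z (lift3 (x, t))‖ₑ ^ 2 ≤ ∫⁻ s, ‖pd 2 z (lift3 (x, s))‖ₑ ^ 2 ∂unitVol := by
  have hd := hasDerivAt_comp_lift3 hz.1 x
  have hc : Continuous fun s : ℝ => pd 2 z (lift3 (x, s)) :=
    (continuous_pd hz.1 2).comp (continuous_lift3.comp (by fun_prop))
  have h1 := intervalIntegral.integral_eq_sub_of_hasDerivAt (fun s _ => hd s)
    (hc.intervalIntegrable t 1)
  obtain ⟨hx0, hx1⟩ := mem_K.1 hx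
  have h2 : z (lift3 (x, 1)) = 0 := hz.2 _ hx0 _ hx1
  rw [h2, zero_sub, intervalIntegral.integral_of_le ht.2.le, integral_Ioc_eq_integral_Ioo] at h1
  have hm : Measurable fun s : ℝ => ‖pd 2 z (lift3 (x, s))‖ₑ := hc.measurable.enorm
  refine le_trans ?_ (lintegral_sq_le hm.aemeasurable)
  gcongr
  rw [← enorm_neg, ← h1]
  refine (enorm_integral_le_lintegral_enorm _).trans ?_
  exact lintegral_mono_set (Ioo_subset_Ioo_left ht.1)

lemma enorm_pd_sq_le_gradSq (z : E 3 → ℂ) (i : Fin 3) (p : E 3) :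
    ‖pd i z p‖ₑ ^ 2 ≤ gradSq z p :=
  Finset.single_le_sum (f := fun i => ‖pd i z p‖ₑ ^ 2) (fun _ _ => zero_le) (Finset.mem_univ i)

lemma IsTopZero.lintegral_column_le {z : E 3 → ℂ} (hz : IsTopZero z) :
    ∫⁻ x, (∫⁻ s, ‖pd 2 z (lift3 (x, s))‖ₑ ^ 2 ∂unitVol) ∂(boxVol 2) ≤
      ∫⁻ p, gradSq z p ∂(boxVol 3) := by
  have hm : Measurable fun q => ‖pd 2 z (lift3 q)‖ₑ ^ 2 :=
    ((continuous_pd hz.1 2).measurable.comp measurable_lift3).enorm.pow_const 2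
  rw [← lintegral_prod _ hm.aemeasurable, ← lintegral_box3 fun p => ‖pd 2 z p‖ₑ ^ 2]
  exact lintegral_mono fun p => enorm_pd_sq_le_gradSq z 2 p

/-- Poincaré inequality. -/
lemma IsTopZero.lintegral_sq_le {z : E 3 → ℂ} (hz : IsTopZero z) :
    ∫⁻ p, ‖z p‖ₑ ^ 2 ∂(boxVol 3) ≤ ∫⁻ p, gradSq z p ∂(boxVol 3) := by
  have hm : Measurable fun q => ‖z (lift3 q)‖ₑ ^ 2 :=
    (hz.1.continuous.measurable.comp measurable_lift3).enorm.pow_const 2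
  refine le_trans ?_ hz.lintegral_column_le
  rw [lintegral_box3, lintegral_prod _ hm.aemeasurable]
  refine setLIntegral_mono' K.isOpen.measurableSet fun x hx => ?_
  calc ∫⁻ t, ‖z (lift3 (x, t))‖ₑ ^ 2 ∂unitVol
      ≤ ∫⁻ _t, (∫⁻ s, ‖pd 2 z (lift3 (x, s))‖ₑ ^ 2 ∂unitVol) ∂unitVol :=
        setLIntegral_mono' measurableSet_Ioo fun t ht => hz.enorm_sq_le hx ⟨ht.1.le, ht.2⟩
    _ = _ := by rw [lintegral_const, measure_univ, mul_one]

lemma IsTopZero.lintegral_bottom_sq_le {z : E 3 → ℂ} (hz : IsTopZero z) :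
    ∫⁻ x, ‖bottom z x‖ₑ ^ 2 ∂(boxVol 2) ≤ ∫⁻ p, gradSq z p ∂(boxVol 3) := by
  refine le_trans ?_ hz.lintegral_column_le
  exact setLIntegral_mono' K.isOpen.measurableSet fun x hx =>
    hz.enorm_sq_le hx (t := 0) ⟨le_rfl, one_pos⟩

lemma lintegral_gradSq_lt_top {z : E 3 → ℂ} (hz : ContDiff ℝ ∞ z) :
    ∫⁻ p, gradSq z p ∂(boxVol 3) < ⊤ := by
  unfold gradSq
  rw [lintegral_finsetSum _ fun i _ => (continuous_pd hz i).measurable.enorm.pow_const 2]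
  exact ENNReal.sum_lt_top.2 fun i _ =>
    (memLp_two_iff.1 (memLp_boxVol_of_continuous (continuous_pd hz i) 2)).2

lemma bottom_mem_HHalf {z : E 3 → ℂ} (hz : ContDiff ℝ ∞ z) : bottom z ∈ HHalf := by
  refine ⟨memLp_boxVol_of_continuous (continuous_bottom hz) 2, memLp_two_iff.2
    ⟨(measurable_slobodetskij _ (continuous_bottom hz).measurable).aestronglyMeasurable, ?_⟩⟩
  refine (lintegral_slobodetskij_bottom_le hz).trans_lt ?_
  have h1 := sqrtInt_lt_top
  have h2 := lintegral_gradSq_lt_top hz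
  exact ENNReal.mul_lt_top (ENNReal.mul_lt_top (by norm_num) h1)
    (ENNReal.mul_lt_top (ENNReal.mul_lt_top ENNReal.ofReal_lt_top h1) h2)

/-- The bound is by the Dirichlet energy alone, so a functional in $\tilde H^{-1/2}(K)$ composed
with the trace is bounded in the energy norm, as the Riesz argument requires. -/
lemma exists_hHalfNorm_bottom_le : ∃ C : ℝ, 0 ≤ C ∧ ∀ z, IsTopZero z →
    hHalfNorm (bottom z) ≤ C * √(∫⁻ p, gradSq z p ∂(boxVol 3)).toReal := by
  set c : ENNReal := 4 * sqrtInt * (ENNReal.ofReal (4 * Real.pi) * sqrtInt) with hc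
  have hct : c < ⊤ := by
    have h1 := sqrtInt_lt_top
    exact ENNReal.mul_lt_top (ENNReal.mul_lt_top (by norm_num) h1)
      (ENNReal.mul_lt_top ENNReal.ofReal_lt_top h1)
  refine ⟨√(1 + c.toReal), Real.sqrt_nonneg _, fun z hz => ?_⟩
  rw [← Real.sqrt_mul (by positivity)]
  have hg := lintegral_gradSq_lt_top hz.1
  apply Real.sqrt_le_sqrt
  rw [add_mul, one_mul]
  refine add_le_add ?_ ?_
  · rw [← ENNReal.toReal_pow, eLpNorm_two_sq]
    exact ENNReal.toReal_mono hg.ne hz.lintegral_bottom_sq_le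
  · rw [← ENNReal.toReal_pow, eLpNorm_two_sq, ← ENNReal.toReal_mul]
    refine ENNReal.toReal_mono (ENNReal.mul_lt_top hct hg).ne ?_
    refine (lintegral_slobodetskij_bottom_le hz.1).trans (le_of_eq ?_)
    rw [hc]; ring

/-! ### Square integrable vector fields -/

/-- The Hilbert space of square integrable fields with `m` components on the box. -/
abbrev LVec (n m : ℕ) : Type := PiLp 2 (fun _ : Fin m => Lp ℂ 2 (boxVol n))

/-- The class of a square integrable field. -/
def toLVec {n m : ℕ} (G : Fin m → E n → ℂ) (hG : ∀ i, MemLp (G i) 2 (boxVol n)) : LVec n m :=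
  WithLp.toLp 2 fun i => (hG i).toLp

lemma inner_toLp {n : ℕ} {f g : E n → ℂ} (hf : MemLp f 2 (boxVol n)) (hg : MemLp g 2 (boxVol n)) :
    inner ℂ hf.toLp hg.toLp = ∫ x, g x * conj (f x) ∂(boxVol n) := by
  rw [L2.inner_def]
  refine integral_congr_ae ?_
  filter_upwards [hf.coeFn_toLp, hg.coeFn_toLp] with x h1 h2
  rw [h1, h2]; rfl

lemma MemLp.conj' {n : ℕ} {f : E n → ℂ} (hf : MemLp f 2 (boxVol n)) :
    MemLp (fun x => conj (f x)) 2 (boxVol n) := hf.star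

lemma inner_toLVec {n m : ℕ} {G G' : Fin m → E n → ℂ} (hG : ∀ i, MemLp (G i) 2 (boxVol n))
    (hG' : ∀ i, MemLp (G' i) 2 (boxVol n)) :
    inner ℂ (toLVec G hG) (toLVec G' hG') = ∫ x, ∑ i, G' i x * conj (G i x) ∂(boxVol n) := by
  rw [PiLp.inner_apply, integral_finsetSum]
  · exact Finset.sum_congr rfl fun i _ => inner_toLp (hG i) (hG' i)
  · exact fun i _ => (hG' i).integrable_mul (MemLp.conj' (hG i))

lemma norm_toLp_sq {n : ℕ} {f : E n → ℂ} (hf : MemLp f 2 (boxVol n)) :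
    ‖hf.toLp‖ ^ 2 = (∫⁻ x, ‖f x‖ₑ ^ 2 ∂(boxVol n)).toReal := by
  rw [Lp.norm_toLp, ← ENNReal.toReal_pow, eLpNorm_two_sq]

lemma norm_toLVec_sq {n m : ℕ} {G : Fin m → E n → ℂ} (hG : ∀ i, MemLp (G i) 2 (boxVol n)) :
    ‖toLVec G hG‖ ^ 2 = (∫⁻ x, ∑ i, ‖G i x‖ₑ ^ 2 ∂(boxVol n)).toReal := by
  rw [PiLp.norm_sq_eq_of_L2, lintegral_finsetSum' _ fun i _ => (hG i).1.enorm.pow_const 2,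
    ENNReal.toReal_sum fun i _ => (memLp_two_iff.1 (hG i)).2.ne]
  exact Finset.sum_congr rfl fun i _ => norm_toLp_sq (hG i)

lemma tendsto_toLVec_iff {n m : ℕ} {ι : Type*} {l : Filter ι} {G : ι → Fin m → E n → ℂ}
    (hG : ∀ k i, MemLp (G k i) 2 (boxVol n)) {G' : Fin m → E n → ℂ}
    (hG' : ∀ i, MemLp (G' i) 2 (boxVol n)) :
    Tendsto (fun k => toLVec (G k) (hG k)) l (𝓝 (toLVec G' hG')) ↔
      ∀ i, Tendsto (fun k => eLpNorm (fun x => G k i x - G' i x) 2 (boxVol n)) l (𝓝 0) := by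
  have h1 : Tendsto (fun k => toLVec (G k) (hG k)) l (𝓝 (toLVec G' hG')) ↔
      Tendsto (fun k i => (hG k i).toLp) l (𝓝 fun i => (hG' i).toLp) := by
    constructor
    · exact fun h => ((PiLp.continuous_ofLp 2 _).tendsto _).comp h
    · exact fun h => ((PiLp.continuous_toLp 2 _).tendsto _).comp h
  rw [h1, tendsto_pi_nhds]
  refine forall_congr' fun i => ?_
  exact Lp.tendsto_Lp_iff_tendsto_eLpNorm'' (fun k => G k i) (fun k => hG k i) (G' i) (hG' i)

/-! ### Riesz representation on the closure of a range -/

/-- The estimate makes $\ell$ a bounded functional on the range of $T$. Extend it by Hahn-Banach,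
represent it by Riesz, and project the representing vector to the closure of the range, which does
not change its products with the range. -/
lemma exists_riesz_range {V H : Type*} [AddCommGroup V] [Module ℂ V] [NormedAddCommGroup H]
    [InnerProductSpace ℂ H] [CompleteSpace H] (T : V →ₗ[ℂ] H) (ℓ : V →ₗ[ℂ] ℂ) {C : ℝ}
    (hC : ∀ v, ‖ℓ v‖ ≤ C * ‖T v‖) :
    ∃ g ∈ (LinearMap.range T).topologicalClosure, ∀ v, inner ℂ g (T v) = ℓ v := by
  obtain ⟨s, hs⟩ := LinearMap.exists_rightInverse_of_surjective T.rangeRestrict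
    T.range_rangeRestrict
  have hTs : ∀ r : LinearMap.range T, T (s r) = r := fun r =>
    congrArg Subtype.val (LinearMap.congr_fun hs r)
  let f : StrongDual ℂ (LinearMap.range T) := (ℓ ∘ₗ s).mkContinuous C fun r => by
    have := hC (s r)
    rw [hTs] at this
    simpa using this
  have hf : ∀ v, f ⟨T v, LinearMap.mem_range_self T v⟩ = ℓ v := by
    intro v
    -- The chosen preimage and $v$ have the same image under $T$, so the estimate forces $\ell$ to
    -- agree on them.
    have h1 := hC (s ⟨T v, LinearMap.mem_range_self T v⟩ - v)
    rw [map_sub T, hTs, sub_self, norm_zero, mul_zero, map_sub] at h1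
    exact sub_eq_zero.1 (norm_le_zero_iff.1 h1)
  obtain ⟨F, hF, -⟩ := exists_extension_norm_eq _ f
  set S := (LinearMap.range T).topologicalClosure with hS
  have : CompleteSpace S := (Submodule.isClosed_topologicalClosure _).completeSpace_coe
  obtain ⟨y, hy, z, hz, hyz⟩ := Submodule.exists_add_mem_mem_orthogonal (K := S)
    ((InnerProductSpace.toDual ℂ H).symm F)
  refine ⟨y, hy, fun v => ?_⟩
  have hTv : T v ∈ S := Submodule.le_topologicalClosure _ (LinearMap.mem_range_self T v)
  have e : y = (InnerProductSpace.toDual ℂ H).symm F - z := by rw [hyz]; abel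
  rw [e, inner_sub_left, InnerProductSpace.toDual_symm_apply,
    (Submodule.mem_orthogonal' S z).1 hz _ hTv, sub_zero]
  exact (hF ⟨T v, LinearMap.mem_range_self T v⟩).trans (hf v)

/-- The difference lies both in the closure of the range and in its orthogonal complement. This
uniqueness makes the chosen gradients depend linearly on the datum. -/
lemma eq_of_forall_inner_range {V H : Type*} [AddCommGroup V] [Module ℂ V] [NormedAddCommGroup H]
    [InnerProductSpace ℂ H] (T : V →ₗ[ℂ] H) {g g' : H}
    (hg : g ∈ (LinearMap.range T).topologicalClosure)
    (hg' : g' ∈ (LinearMap.range T).topologicalClosure)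
    (h : ∀ v, inner ℂ (T v) g = inner ℂ (T v) g') : g = g' := by
  have h1 : g - g' ∈ (LinearMap.range T).topologicalClosure := Submodule.sub_mem _ hg hg'
  have h2 : g - g' ∈ (LinearMap.range T)ᗮ := by
    rw [Submodule.mem_orthogonal]
    rintro _ ⟨v, rfl⟩
    rw [inner_sub_right, h, sub_self]
  rw [← Submodule.orthogonal_closure] at h2
  have := inner_self_eq_zero.1 (((Submodule.mem_orthogonal _ _).1 h2) _ h1)
  exact sub_eq_zero.1 this

/-! ### The mixed problem -/

lemma pd_add {n : ℕ} {f g : E n → ℂ} (hf : ContDiff ℝ ∞ f) (hg : ContDiff ℝ ∞ g) (i : Fin n) :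
    pd i (f + g) = pd i f + pd i g := by
  funext x
  simp only [pd, Pi.add_apply]
  rw [fderiv_add (hf.differentiable (by simp) x) (hg.differentiable (by simp) x)]
  rfl

lemma pd_smul {n : ℕ} {f : E n → ℂ} (hf : ContDiff ℝ ∞ f) (c : ℂ) (i : Fin n) :
    pd i (c • f) = c • pd i f := by
  funext x
  simp only [pd, Pi.smul_apply]
  rw [fderiv_const_smul (hf.differentiable (by simp) x)]
  rfl

lemma pd_conj {n : ℕ} {f : E n → ℂ} (hf : ContDiff ℝ ∞ f) (i : Fin n) (x : E n) :
    pd i (fun x => conj (f x)) x = conj (pd i f x) := by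
  have h := (Complex.conjCLE.toContinuousLinearMap.hasFDerivAt (x := f x)).comp x
    (hf.differentiable (by simp) x).hasFDerivAt
  have h' : HasFDerivAt (fun x => conj (f x)) _ x := h
  rw [pd, h'.fderiv]
  rfl

/-- The smooth functions vanishing on the top face. -/
def topZero : Submodule ℂ (E 3 → ℂ) where
  carrier := {z | IsTopZero z}
  zero_mem' := ⟨contDiff_const, fun _ _ _ _ => rfl⟩
  add_mem' := fun {z w} hz hw => ⟨hz.1.add hw.1, fun a ha b hb => by
    rw [Pi.add_apply, hz.2 a ha b hb, hw.2 a ha b hb, add_zero]⟩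
  smul_mem' := fun c z hz => ⟨hz.1.const_smul c, fun a ha b hb => by
    rw [Pi.smul_apply, hz.2 a ha b hb, smul_zero]⟩

lemma memLp_pd {n : ℕ} {z : E n → ℂ} (hz : ContDiff ℝ ∞ z) (i : Fin n) :
    MemLp (pd i z) 2 (boxVol n) := memLp_boxVol_of_continuous (continuous_pd hz i) 2

/-- The gradient as an operator from smooth functions to square integrable fields. -/
def gradMap : topZero →ₗ[ℂ] LVec 3 3 where
  toFun z := toLVec (fun i => pd i z) (memLp_pd z.2.1)
  map_add' z w := by
    ext1 i
    simp only [toLVec, PiLp.add_apply, Submodule.coe_add]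
    rw [← MemLp.toLp_add]
    congr 1
    exact pd_add z.2.1 w.2.1 i
  map_smul' c z := by
    ext1 i
    simp only [toLVec, PiLp.smul_apply, Submodule.coe_smul, RingHom.id_apply]
    rw [← MemLp.toLp_const_smul]
    congr 1
    exact pd_smul z.2.1 c i

lemma gradMap_apply (z : topZero) : gradMap z = toLVec (fun i => pd i z) (memLp_pd z.2.1) := rfl

lemma norm_gradMap (z : topZero) : ‖gradMap z‖ = √(∫⁻ p, gradSq z p ∂(boxVol 3)).toReal := by
  rw [gradMap_apply, ← Real.sqrt_sq (norm_nonneg _), norm_toLVec_sq]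
  rfl

/-- Complex conjugation of the functions vanishing on the top face. -/
def conjTop (z : topZero) : topZero :=
  ⟨fun x => conj ((z : E 3 → ℂ) x), Complex.conjCLE.toContinuousLinearMap.contDiff.comp z.2.1,
    fun a ha b hb => by
      change conj ((z : E 3 → ℂ) _) = 0
      rw [z.2.2 a ha b hb, map_zero]⟩

lemma conjTop_conjTop (z : topZero) : conjTop (conjTop z) = z := by
  ext x; simp [conjTop]

lemma pd_conjTop (z : topZero) (i : Fin 3) (x : E 3) : pd i (conjTop z) x = conj (pd i z x) :=
  pd_conj z.2.1 i x

lemma norm_gradMap_conjTop (z : topZero) : ‖gradMap (conjTop z)‖ = ‖gradMap z‖ := by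
  rw [norm_gradMap, norm_gradMap]
  congr 3
  funext p
  simp only [gradSq, pd_conjTop, ← ofReal_norm, RCLike.norm_conj]

/-- The trace on the bottom face as an element of `H^{1/2}(K)`. -/
def bottomMap : topZero →ₗ[ℂ] HHalf where
  toFun z := ⟨bottom z, bottom_mem_HHalf z.2.1⟩
  map_add' _ _ := rfl
  map_smul' _ _ := rfl

/-- The functional `z ↦ conj (D (conj z))` on the functions vanishing on the top face. -/
def conjTrace (D : Module.Dual ℂ HHalf) : topZero →ₗ[ℂ] ℂ where
  toFun z := conj (D (bottomMap (conjTop z)))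
  map_add' z w := by
    have : conjTop (z + w) = conjTop z + conjTop w := by ext x; simp [conjTop]
    rw [this, map_add, map_add, map_add]
  map_smul' c z := by
    have : conjTop (c • z) = conj c • conjTop z := by ext x; simp [conjTop]
    rw [this, map_smul, map_smul, smul_eq_mul, map_mul]
    simp

/-- The space `H̃^{-1/2}(K)`. -/
def negHalfSpace : Submodule ℂ (Module.Dual ℂ HHalf) where
  carrier := {D | MemHTildeNegHalf D}
  zero_mem' := ⟨0, fun v => by simp⟩
  add_mem' := by
    rintro D D' ⟨C, hC⟩ ⟨C', hC'⟩
    refine ⟨C + C', fun v => ?_⟩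
    rw [LinearMap.add_apply, add_mul]
    exact (norm_add_le _ _).trans (add_le_add (hC v) (hC' v))
  smul_mem' := by
    rintro c D ⟨C, hC⟩
    refine ⟨‖c‖ * C, fun v => ?_⟩
    rw [LinearMap.smul_apply, norm_smul, mul_assoc]
    exact mul_le_mul_of_nonneg_left (hC v) (norm_nonneg c)

/-! ### Solvability of the mixed problem and the solution operator -/

/-- The dual pairing is bilinear but the inner product is conjugate linear in its first argument.
Riesz is therefore applied to the conjugated functional `conjTrace`. -/
lemma exists_gradient {D : Module.Dual ℂ HHalf} (hD : MemHTildeNegHalf D) :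
    ∃ g ∈ (LinearMap.range gradMap).topologicalClosure,
      ∀ z, inner ℂ (gradMap z) g = D (bottomMap (conjTop z)) := by
  obtain ⟨C, hC⟩ := hD
  obtain ⟨c, hc0, hc⟩ := exists_hHalfNorm_bottom_le
  have hb : ∀ z, ‖conjTrace D z‖ ≤ (|C| * c) * ‖gradMap z‖ := by
    intro z
    have h1 : ‖conjTrace D z‖ = ‖D (bottomMap (conjTop z))‖ := RCLike.norm_conj _
    have h2 := hc _ (conjTop z).2
    rw [← norm_gradMap, norm_gradMap_conjTop] at h2
    rw [h1, mul_assoc]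
    refine (hC _).trans ?_
    have h3 : 0 ≤ hHalfNorm (bottom (conjTop z)) := Real.sqrt_nonneg _
    calc C * hHalfNorm (bottom (conjTop z)) ≤ |C| * hHalfNorm (bottom (conjTop z)) :=
          mul_le_mul_of_nonneg_right (le_abs_self C) h3
      _ ≤ _ := mul_le_mul_of_nonneg_left h2 (abs_nonneg C)
  obtain ⟨g, hg, hgz⟩ := exists_riesz_range gradMap (conjTrace D) hb
  refine ⟨g, hg, fun z => ?_⟩
  rw [← inner_conj_symm, hgz]
  exact Complex.conj_conj _

lemma topZero_norm_le (z : topZero) :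
    ‖(memLp_boxVol_of_continuous z.2.1.continuous 2).toLp‖ ≤ ‖gradMap z‖ := by
  rw [norm_gradMap]
  refine Real.le_sqrt_of_sq_le ?_
  rw [norm_toLp_sq]
  exact ENNReal.toReal_mono (lintegral_gradSq_lt_top z.2.1).ne (IsTopZero.lintegral_sq_le z.2)

lemma pairing_bottom (D : Module.Dual ℂ HHalf) (z : topZero) :
    pairing D (fun x => (z : E 3 → ℂ) !₂[x 0, x 1, 0]) = D (bottomMap z) :=
  pairing_of_mem D (bottom_mem_HHalf z.2.1)

/-- The Riesz vector is a limit of gradients of smooth functions. By the Poincaré inequality these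
functions are themselves Cauchy in $L^2$, and their limit is $w$. -/
lemma exists_isMixedSolution {D : Module.Dual ℂ HHalf} (hD : MemHTildeNegHalf D) :
    ∃ w G, IsMixedSolution D w G := by
  obtain ⟨g, hg, hgz⟩ := exists_gradient hD
  set G : Fin 3 → E 3 → ℂ := fun i => g i with hGdef
  have hG : ∀ i, MemLp (G i) 2 (boxVol 3) := fun i => Lp.memLp (g i)
  have hgG : g = toLVec G hG := by
    ext1 i
    rw [toLVec]
    exact (Lp.toLp_coeFn (g i) (hG i)).symm
  obtain ⟨y, hy, hlim⟩ := mem_closure_iff_seq_limit.1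
    (show g ∈ closure (LinearMap.range gradMap : Set (LVec 3 3)) from hg)
  choose z hz using hy
  have hzl : Tendsto (fun k => gradMap (z k)) atTop (𝓝 g) := by simpa only [hz] using hlim
  set ζ : ℕ → Lp ℂ 2 (boxVol 3) :=
    fun k => (memLp_boxVol_of_continuous (z k).2.1.continuous 2).toLp with hζ
  have hζc : CauchySeq ζ := by
    have hc := hzl.cauchySeq
    rw [Metric.cauchySeq_iff] at hc ⊢
    intro ε hε
    obtain ⟨N, hN⟩ := hc ε hε
    refine ⟨N, fun k hk l hl => lt_of_le_of_lt ?_ (hN k hk l hl)⟩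
    rw [dist_eq_norm, dist_eq_norm, ← map_sub]
    refine le_trans (le_of_eq ?_) (topZero_norm_le (z k - z l))
    rw [hζ, ← MemLp.toLp_sub]
    rfl
  obtain ⟨v₀, hv₀⟩ := cauchySeq_tendsto_of_complete hζc
  refine ⟨v₀, G, Lp.memLp v₀, hG, ⟨fun k => z k, fun k => (z k).2, ?_, ?_⟩, fun v hv => ?_⟩
  · rw [← Lp.toLp_coeFn v₀ (Lp.memLp v₀)] at hv₀
    exact (Lp.tendsto_Lp_iff_tendsto_eLpNorm'' (fun k => (z k : E 3 → ℂ)) _ _ _).1 hv₀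
  · rw [hgG] at hzl
    exact (tendsto_toLVec_iff (fun k => memLp_pd (z k).2.1) hG).1 hzl
  · have := hgz (conjTop ⟨v, hv⟩)
    rw [conjTop_conjTop, hgG, gradMap_apply, inner_toLVec] at this
    rw [pairing_bottom D ⟨v, hv⟩, ← this]
    congr 1; funext x
    refine Finset.sum_congr rfl fun i _ => ?_
    rw [pd_conjTop, Complex.conj_conj]

lemma mixedGrad_spec {D : Module.Dual ℂ HHalf} (hD : MemHTildeNegHalf D) :
    ∃ w, IsMixedSolution D w (mixedGrad D) := by
  have h := exists_isMixedSolution hD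
  refine ⟨h.choose, ?_⟩
  rw [mixedGrad, dif_pos h]
  exact h.choose_spec.choose_spec

lemma memLp_mixedGrad {D : Module.Dual ℂ HHalf} (hD : MemHTildeNegHalf D) (i : Fin 3) :
    MemLp (mixedGrad D i) 2 (boxVol 3) := (mixedGrad_spec hD).choose_spec.2.1 i

/-- The class of the gradient of the solution of the mixed problem. -/
def gradClass (D : negHalfSpace) : LVec 3 3 := toLVec (mixedGrad D) (memLp_mixedGrad D.2)

lemma gradClass_mem (D : negHalfSpace) :
    gradClass D ∈ (LinearMap.range gradMap).topologicalClosure := by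
  obtain ⟨w, -, hG, ⟨z, hz, -, hlim⟩, -⟩ := mixedGrad_spec D.2
  change gradClass D ∈ closure (LinearMap.range gradMap : Set (LVec 3 3))
  refine mem_closure_iff_seq_limit.2 ⟨fun k => gradMap ⟨z k, hz k⟩,
    fun k => LinearMap.mem_range_self _ _, ?_⟩
  exact (tendsto_toLVec_iff (fun k => memLp_pd (hz k).1) (memLp_mixedGrad D.2)).2 hlim

lemma inner_gradMap_gradClass (D : negHalfSpace) (z : topZero) :
    inner ℂ (gradMap z) (gradClass D) = (D : Module.Dual ℂ HHalf) (bottomMap (conjTop z)) := by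
  obtain ⟨w, -, hG, -, hw⟩ := mixedGrad_spec D.2
  rw [← pairing_bottom, ← hw _ (conjTop z).2, gradMap_apply, gradClass, inner_toLVec]
  simp only [pd_conjTop]

/-- The solution operator of the mixed problem. -/
def gradClassMap : negHalfSpace →ₗ[ℂ] LVec 3 3 where
  toFun := gradClass
  map_add' D D' := by
    refine eq_of_forall_inner_range gradMap (gradClass_mem _)
      (Submodule.add_mem _ (gradClass_mem _) (gradClass_mem _)) fun z => ?_
    rw [inner_add_right, inner_gradMap_gradClass, inner_gradMap_gradClass, inner_gradMap_gradClass]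
    rfl
  map_smul' c D := by
    refine eq_of_forall_inner_range gradMap (gradClass_mem _)
      (Submodule.smul_mem _ _ (gradClass_mem _)) fun z => ?_
    rw [RingHom.id_apply, inner_smul_right, inner_gradMap_gradClass, inner_gradMap_gradClass]
    rfl

/-- The arguments are exchanged because `negHalfInner` is linear in the first one and `inner` in the
second. -/
lemma negHalfInner_eq (D D' : negHalfSpace) :
    negHalfInner D D' = inner ℂ (gradClassMap D') (gradClassMap D) :=
  (inner_toLVec _ _).symm

/-! ### Square integrable functions as functionals -/

lemma ofL2_apply {f : E 2 → ℂ} (hf : MemLp f 2 (boxVol 2)) (v : HHalf) :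
    ofL2 f v = ∫ x, f x * (v : E 2 → ℂ) x ∂(boxVol 2) := by
  rw [ofL2, dif_pos hf]; rfl

lemma memHTildeNegHalf_ofL2 {f : E 2 → ℂ} (hf : MemLp f 2 (boxVol 2)) :
    MemHTildeNegHalf (ofL2 f) := by
  refine ⟨‖(MemLp.conj' hf).toLp‖, fun v => ?_⟩
  have h1 : ofL2 f v = inner ℂ (MemLp.conj' hf).toLp v.2.1.toLp := by
    rw [ofL2_apply hf, inner_toLp]
    congr 1; funext x
    rw [Complex.conj_conj, mul_comm]
  rw [h1]
  refine (norm_inner_le_norm _ _).trans (mul_le_mul_of_nonneg_left ?_ (norm_nonneg _))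
  rw [Lp.norm_toLp, hHalfNorm]
  refine Real.le_sqrt_of_sq_le ?_
  linarith [sq_nonneg (eLpNorm (slobodetskij (1 / 2) (v : E 2 → ℂ)) 2
    ((boxVol 2).prod (boxVol 2))).toReal]

/-- Polynomials as elements of `H̃^{-1/2}(K)`. -/
def polyFunctional : Poly →ₗ[ℂ] negHalfSpace where
  toFun P := ⟨ofL2 P.fn, memHTildeNegHalf_ofL2 (P.memLp_fn 2)⟩
  map_add' P Q := by
    ext v
    change ofL2 (Poly.fn (P + Q)) v = ofL2 P.fn v + ofL2 Q.fn v
    rw [ofL2_apply (Poly.memLp_fn _ 2), ofL2_apply (Poly.memLp_fn _ 2),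
      ofL2_apply (Poly.memLp_fn _ 2), Poly.fn_add, ← integral_add]
    · simp only [Pi.add_apply, add_mul]
    · exact (P.memLp_fn 2).integrable_mul v.2.1
    · exact (Q.memLp_fn 2).integrable_mul v.2.1
  map_smul' c P := by
    ext v
    change ofL2 (Poly.fn (c • P)) v = c * ofL2 P.fn v
    rw [ofL2_apply (Poly.memLp_fn _ 2), ofL2_apply (Poly.memLp_fn _ 2), Poly.fn_smul,
      ← integral_const_mul]
    simp only [Pi.smul_apply, smul_eq_mul, mul_assoc]

lemma coe_polyFunctional (P : Poly) : (polyFunctional P : Module.Dual ℂ HHalf) = ofL2 P.fn := rfl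

/-- The function `1 - x₃`, times a smooth function of the first two variables. -/
def topCut (P : Poly) : topZero :=
  ⟨fun x => P.fn !₂[x 0, x 1] * (1 - (x 2 : ℂ)), by
    refine ⟨?_, fun a _ b _ => by simp⟩
    refine ContDiff.mul (P.contDiff_fn.comp ?_) (contDiff_const.sub ?_)
    · rw [contDiff_euclidean]
      intro i; fin_cases i
      · exact (EuclideanSpace.proj (0 : Fin 3) : E 3 →L[ℝ] ℝ).contDiff
      · exact (EuclideanSpace.proj (1 : Fin 3) : E 3 →L[ℝ] ℝ).contDiff
    · exact (Complex.ofRealCLM.comp (EuclideanSpace.proj (2 : Fin 3) : E 3 →L[ℝ] ℝ)).contDiff⟩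

lemma bottom_topCut (P : Poly) (x : E 2) : bottom (topCut P) x = P.fn x := by
  have : (!₂[x 0, x 1] : E 2) = x := by ext i; fin_cases i <;> rfl
  simp [bottom, topCut, this]

/-- Definiteness on polynomials, needed for uniqueness of the projection. Testing the weak form with
the conjugate of $P(x_1,x_2)(1-x_3)$, whose bottom trace is $\overline P$, gives $\|P\|_{L^2}^2=0$.
-/
lemma polyFunctional_eq_zero_of_gradClassMap {P : Poly} (h : gradClassMap (polyFunctional P) = 0) :
    P = 0 := by
  have h1 := inner_gradMap_gradClass (polyFunctional P) (topCut P)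
  have h2 : gradClass (polyFunctional P) = 0 := h
  rw [h2, inner_zero_right, coe_polyFunctional, ofL2_apply (P.memLp_fn 2)] at h1
  have h3 : ∫ x, P.fn x * conj (P.fn x) ∂(boxVol 2) = 0 := by
    rw [h1]
    congr 1; funext x
    have : (bottomMap (conjTop (topCut P)) : E 2 → ℂ) x = conj (bottom (topCut P) x) := rfl
    rw [this, bottom_topCut]
  rw [← inner_toLp (P.memLp_fn 2) (P.memLp_fn 2), inner_self_eq_zero] at h3
  refine P.eq_zero_of_ae ?_
  exact (MemLp.toLp_eq_toLp_iff (P.memLp_fn 2) MemLp.zero).1 h3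

/-! ### Testing with constants -/

lemma pd_topCut_one (i : Fin 3) (x : E 3) :
    pd i (topCut 1) x = ![0, 0, -1] i := by
  have h : HasFDerivAt (topCut 1 : E 3 → ℂ)
      (-(Complex.ofRealCLM.comp (EuclideanSpace.proj (2 : Fin 3) : E 3 →L[ℝ] ℝ))) x := by
    have h1 := (hasFDerivAt_coord (2 : Fin 3) x).const_sub (1 : ℂ)
    have e : (topCut 1 : E 3 → ℂ) = fun x => 1 - (x 2 : ℂ) := by
      funext x; simp [topCut, Poly.fn]
    rw [e]; exact h1
  rw [pd, h.fderiv]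
  fin_cases i <;> simp

lemma IsTopZero.integral_pd_column {z : E 3 → ℂ} (hz : IsTopZero z) {x : E 2}
    (hx : x ∈ (K : Set (E 2))) :
    ∫ s, pd 2 z (lift3 (x, s)) ∂unitVol = -bottom z x := by
  have hc : Continuous fun s : ℝ => pd 2 z (lift3 (x, s)) :=
    (continuous_pd hz.1 2).comp (continuous_lift3.comp (by fun_prop))
  have h1 := intervalIntegral.integral_eq_sub_of_hasDerivAt
    (fun s _ => hasDerivAt_comp_lift3 hz.1 x s) (hc.intervalIntegrable 0 1)
  obtain ⟨hx0, hx1⟩ := mem_K.1 hx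
  have h2 : z (lift3 (x, 1)) = 0 := hz.2 _ hx0 _ hx1
  rw [h2, zero_sub, intervalIntegral.integral_of_le zero_le_one, integral_Ioc_eq_integral_Ioo] at h1
  exact h1

lemma IsTopZero.integral_pd {z : E 3 → ℂ} (hz : IsTopZero z) :
    ∫ p, pd 2 z p ∂(boxVol 3) = -∫ x, bottom z x ∂(boxVol 2) := by
  have hi : Integrable (pd 2 z) (boxVol 3) := (memLp_pd hz.1 2).integrable (by norm_num)
  have hi2 := measurePreserving_box3.integrable_comp_of_integrable hi
  rw [← measurePreserving_box3.integral_comp measurableEmbedding_lift3]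
  have h3 := integral_prod (fun q => pd 2 z (lift3 q)) hi2
  rw [h3, ← integral_neg]
  refine integral_congr_ae ?_
  filter_upwards [ae_boxVol_mem 2] with x hx using hz.integral_pd_column hx

/-- The solution with datum $1$ is $1-x_3$: its gradient is $(0,0,-1)$, and minus the integral of
$\partial_3z$ over a column is the bottom value of $z$. -/
lemma gradClass_one : gradClass (polyFunctional 1) = gradMap (topCut 1) := by
  refine eq_of_forall_inner_range gradMap (gradClass_mem _)
    (Submodule.le_topologicalClosure _ (LinearMap.mem_range_self _ _)) fun z => ?_
  rw [inner_gradMap_gradClass, coe_polyFunctional, ofL2_apply (Poly.memLp_fn 1 2), gradMap_apply,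
    gradMap_apply, inner_toLVec]
  simp only [pd_topCut_one, Fin.sum_univ_three, Matrix.cons_val, zero_mul, zero_add, neg_one_mul]
  rw [integral_neg]
  have h := IsTopZero.integral_pd (conjTop z).2
  simp only [pd_conjTop] at h
  rw [h, neg_neg]
  congr 1; funext x
  have : Poly.fn 1 x = 1 := by simp [Poly.fn]
  rw [this, one_mul]
  rfl

lemma inner_gradClass_one (D : negHalfSpace) :
    inner ℂ (gradClassMap (polyFunctional 1)) (gradClassMap D) =
      pairing (D : Module.Dual ℂ HHalf) (fun _ => 1) := by
  change inner ℂ (gradClass (polyFunctional 1)) (gradClass D) = _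
  rw [gradClass_one, inner_gradMap_gradClass, pairing_of_mem _ one_mem_HHalf]
  congr 1
  ext x
  have : (bottomMap (conjTop (topCut 1)) : E 2 → ℂ) x = conj (bottom (topCut 1) x) := rfl
  rw [this, bottom_topCut]
  simp [Poly.fn]

/-! ### The divergence theorem for polynomial fields -/

lemma Poly.hasDerivAt_comp_line (P : Poly) (x v : E 2) (t : ℝ) :
    HasDerivAt (fun t : ℝ => P.fn (x + t • v))
      (∑ j, Poly.fn (MvPolynomial.pderiv j P) (x + t • v) * (v j : ℂ)) t := by
  have h1 : HasDerivAt (fun τ : ℝ => x + τ • v) v t := by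
    simpa using ((hasDerivAt_id t).smul_const v).const_add x
  have := (P.differentiable_fn _).hasFDerivAt.comp_hasDerivAt t h1
  rwa [Poly.fderiv_fn_apply] at this

lemma Poly.integral_pderiv_zero (P : Poly) (b : ℝ) :
    ∫ t, Poly.fn (MvPolynomial.pderiv 0 P) !₂[t, b] ∂unitVol = P.fn !₂[1, b] - P.fn !₂[0, b] := by
  have e : ∀ t : ℝ, (!₂[0, b] : E 2) + t • EuclideanSpace.single 0 1 = !₂[t, b] := by
    intro t; ext i; fin_cases i <;> simp
  have hd : ∀ t : ℝ, HasDerivAt (fun t : ℝ => P.fn !₂[t, b])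
      (Poly.fn (MvPolynomial.pderiv 0 P) !₂[t, b]) t := by
    intro t
    have := P.hasDerivAt_comp_line !₂[0, b] (EuclideanSpace.single 0 1) t
    simp only [e, Fin.sum_univ_two] at this
    simpa using this
  have hl : Continuous fun t : ℝ => (!₂[0, b] : E 2) + t • EuclideanSpace.single 0 1 := by fun_prop
  have hc : Continuous fun t : ℝ => Poly.fn (MvPolynomial.pderiv 0 P) !₂[t, b] :=
    ((Poly.continuous_fn _).comp hl).congr fun t => by rw [Function.comp_apply, e]
  have := intervalIntegral.integral_eq_sub_of_hasDerivAt (fun t _ => hd t)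
    (hc.intervalIntegrable 0 1)
  rwa [intervalIntegral.integral_of_le zero_le_one, integral_Ioc_eq_integral_Ioo] at this

lemma Poly.integral_pderiv_one (P : Poly) (a : ℝ) :
    ∫ t, Poly.fn (MvPolynomial.pderiv 1 P) !₂[a, t] ∂unitVol = P.fn !₂[a, 1] - P.fn !₂[a, 0] := by
  have e : ∀ t : ℝ, (!₂[a, 0] : E 2) + t • EuclideanSpace.single 1 1 = !₂[a, t] := by
    intro t; ext i; fin_cases i <;> simp
  have hd : ∀ t : ℝ, HasDerivAt (fun t : ℝ => P.fn !₂[a, t])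
      (Poly.fn (MvPolynomial.pderiv 1 P) !₂[a, t]) t := by
    intro t
    have := P.hasDerivAt_comp_line !₂[a, 0] (EuclideanSpace.single 1 1) t
    simp only [e, Fin.sum_univ_two] at this
    simpa using this
  have hl : Continuous fun t : ℝ => (!₂[a, 0] : E 2) + t • EuclideanSpace.single 1 1 := by fun_prop
  have hc : Continuous fun t : ℝ => Poly.fn (MvPolynomial.pderiv 1 P) !₂[a, t] :=
    ((Poly.continuous_fn _).comp hl).congr fun t => by rw [Function.comp_apply, e]
  have := intervalIntegral.integral_eq_sub_of_hasDerivAt (fun t _ => hd t)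
    (hc.intervalIntegrable 0 1)
  rwa [intervalIntegral.integral_of_le zero_le_one, integral_Ioc_eq_integral_Ioo] at this

lemma Poly.integrable_square (P : Poly) :
    Integrable (fun q : ℝ × ℝ => P.fn !₂[q.1, q.2]) (unitVol.prod unitVol) :=
  measurePreserving_box2.integrable_comp_of_integrable
    ((P.memLp_fn 2).integrable (by norm_num))

lemma integral_polyDiv_of_isRTBubble {p : ℕ} {V : Fin 2 → Poly} (hV : IsRTBubble p V) :
    ∫ x, Poly.fn (polyDiv V) x ∂(boxVol 2) = 0 := by
  have hb := hV.2
  rw [polyDiv, Poly.fn_add]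
  rw [show (∫ x, (Poly.fn (MvPolynomial.pderiv 0 (V 0)) + Poly.fn (MvPolynomial.pderiv 1 (V 1))) x
      ∂(boxVol 2)) = (∫ x, Poly.fn (MvPolynomial.pderiv 0 (V 0)) x ∂(boxVol 2)) +
      ∫ x, Poly.fn (MvPolynomial.pderiv 1 (V 1)) x ∂(boxVol 2) from
    integral_add ((Poly.memLp_fn _ 2).integrable (by norm_num))
      ((Poly.memLp_fn _ 2).integrable (by norm_num))]
  have h0 : ∀ b ∈ Ioo (0 : ℝ) 1, (V 0).fn !₂[0, b] = 0 := by
    intro b hb'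
    -- The left and top edges are traversed backwards, hence the reflected parameter.
    have := hb 3 (1 - b) ⟨by linarith [hb'.2], by linarith [hb'.1]⟩
    simpa [edge, normal, Fin.sum_univ_two] using this
  have h1 : ∀ b ∈ Ioo (0 : ℝ) 1, (V 0).fn !₂[1, b] = 0 := by
    intro b hb'
    have := hb 1 b ⟨hb'.1.le, hb'.2.le⟩
    simpa [edge, normal, Fin.sum_univ_two] using this
  have h2 : ∀ a ∈ Ioo (0 : ℝ) 1, (V 1).fn !₂[a, 0] = 0 := by
    intro a ha
    have := hb 0 a ⟨ha.1.le, ha.2.le⟩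
    simpa [edge, normal, Fin.sum_univ_two] using this
  have h3 : ∀ a ∈ Ioo (0 : ℝ) 1, (V 1).fn !₂[a, 1] = 0 := by
    intro a ha
    have := hb 2 (1 - a) ⟨by linarith [ha.2], by linarith [ha.1]⟩
    simpa [edge, normal, Fin.sum_univ_two] using this
  rw [integral_box2, integral_box2, integral_prod_symm _ (Poly.integrable_square _),
    integral_prod _ (Poly.integrable_square _)]
  simp only [Poly.integral_pderiv_zero, Poly.integral_pderiv_one]
  rw [setIntegral_eq_zero_of_forall_eq_zero fun b hb' => by rw [h0 b hb', h1 b hb', sub_zero],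
    setIntegral_eq_zero_of_forall_eq_zero fun a ha => by rw [h2 a ha, h3 a ha, sub_zero], add_zero]

/-! ### Algebra of divergence and curl -/

lemma polyDiv_add (V W : Fin 2 → Poly) : polyDiv (V + W) = polyDiv V + polyDiv W := by
  simp only [polyDiv, Pi.add_apply, map_add]; ring

lemma polyDiv_smul (c : ℂ) (V : Fin 2 → Poly) : polyDiv (c • V) = c • polyDiv V := by
  simp only [polyDiv, Pi.smul_apply, Derivation.map_smul, smul_add]

/-- The divergence as a linear map. -/
def polyDivMap : (Fin 2 → Poly) →ₗ[ℂ] Poly where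
  toFun := polyDiv
  map_add' := polyDiv_add
  map_smul' := polyDiv_smul

/-- The vector curl as a linear map. -/
def polyCurlMap : Poly →ₗ[ℂ] (Fin 2 → Poly) where
  toFun := polyCurl
  map_add' P Q := by
    funext i; fin_cases i <;> simp [polyCurl, add_comm]
  map_smul' c P := by
    funext i; fin_cases i <;> simp [polyCurl]

lemma pderiv_comm (P : Poly) : MvPolynomial.pderiv 0 (MvPolynomial.pderiv 1 P) =
    MvPolynomial.pderiv 1 (MvPolynomial.pderiv 0 P) := by
  induction P using MvPolynomial.induction_on with
  | C a => simp
  | add P Q hP hQ => simp only [map_add, hP, hQ]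
  | mul_X P i hP =>
    fin_cases i <;> simp [MvPolynomial.pderiv_X, hP] <;> ring

lemma polyDiv_polyCurl (P : Poly) : polyDiv (polyCurl P) = 0 := by
  simp [polyDiv, polyCurl, pderiv_comm]

/-- Every summand is a curl, whichever polynomial extension was chosen, default values included. -/
lemma polyDiv_edgePart (p : ℕ) (u : Fin 2 → E 2 → ℂ) : polyDiv (edgePart p u) = 0 := by
  change polyDivMap (edgePart p u) = 0
  rw [edgePart, map_sum]
  exact Finset.sum_eq_zero fun i _ => polyDiv_polyCurl _

lemma polyDiv_lowest (u : Fin 2 → E 2 → ℂ) :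
    polyDiv (lowest u) = MvPolynomial.C (∑ i, edgeFlux u i) := by
  have h : ∀ i, polyDiv (rtBasis i) = 1 := by
    intro i; fin_cases i <;> simp [polyDiv, rtBasis]
  change polyDivMap (lowest u) = _
  rw [lowest, map_sum, map_sum]
  refine Finset.sum_congr rfl fun i _ => ?_
  rw [map_smul]
  change _ • polyDiv (rtBasis i) = _
  rw [h, MvPolynomial.smul_eq_C_mul, mul_one]

/-! ### Polynomial spaces as finite dimensional subspaces -/

/-- The space `𝒫_{p,q}(K)`. -/
def polyBox (p q : ℕ) : Submodule ℂ Poly where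
  carrier := {P | IsPoly p q P}
  zero_mem' := by simp [IsPoly]
  add_mem' := fun {P Q} hP hQ =>
    ⟨(MvPolynomial.degreeOf_add_le _ P Q).trans (max_le hP.1 hQ.1),
      (MvPolynomial.degreeOf_add_le _ P Q).trans (max_le hP.2 hQ.2)⟩
  smul_mem' := fun c P hP => by
    refine ⟨?_, ?_⟩ <;> refine MvPolynomial.degreeOf_le_iff.2 fun m hm => ?_
    · exact MvPolynomial.degreeOf_le_iff.1 hP.1 m (MvPolynomial.support_smul hm)
    · exact MvPolynomial.degreeOf_le_iff.1 hP.2 m (MvPolynomial.support_smul hm)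

lemma mem_polyBox {p q : ℕ} {P : Poly} : P ∈ polyBox p q ↔ IsPoly p q P := Iff.rfl

/-- The monomial `xᵃ yᵇ`. -/
def mono (m : ℕ × ℕ) : Poly := MvPolynomial.X 0 ^ m.1 * MvPolynomial.X 1 ^ m.2

lemma mono_mem_polyBox {p q : ℕ} {m : ℕ × ℕ} (h1 : m.1 ≤ p) (h2 : m.2 ≤ q) :
    mono m ∈ polyBox p q := by
  constructor
  · refine (MvPolynomial.degreeOf_mul_le _ _ _).trans ?_
    rw [MvPolynomial.degreeOf_X_self_pow, MvPolynomial.degreeOf_X_pow_of_ne _ (by decide)]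
    simpa
  · refine (MvPolynomial.degreeOf_mul_le _ _ _).trans ?_
    rw [MvPolynomial.degreeOf_X_self_pow, MvPolynomial.degreeOf_X_pow_of_ne _ (by decide)]
    simpa

lemma polyBox_eq_span (p q : ℕ) :
    polyBox p q = Submodule.span ℂ (mono '' (Iic p ×ˢ Iic q)) := by
  refine le_antisymm (fun P hP => ?_) (Submodule.span_le.2 ?_)
  · rw [← MvPolynomial.support_sum_monomial_coeff P]
    refine Submodule.sum_mem _ fun m hm => ?_
    have : MvPolynomial.monomial m (P.coeff m) = P.coeff m • mono (m 0, m 1) := by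
      rw [MvPolynomial.monomial_eq, Finsupp.prod_fintype _ _ fun i => pow_zero _,
        Fin.prod_univ_two, MvPolynomial.smul_eq_C_mul, mono]
    rw [this]
    exact Submodule.smul_mem _ _ (Submodule.subset_span ⟨(m 0, m 1),
      ⟨MvPolynomial.degreeOf_le_iff.1 hP.1 m hm, MvPolynomial.degreeOf_le_iff.1 hP.2 m hm⟩, rfl⟩)
  · rintro _ ⟨m, ⟨h1, h2⟩, rfl⟩
    exact mono_mem_polyBox h1 h2

instance finiteDimensional_polyBox (p q : ℕ) : FiniteDimensional ℂ (polyBox p q) := by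
  rw [polyBox_eq_span]
  exact FiniteDimensional.span_of_finite ℂ (((finite_Iic p).prod (finite_Iic q)).image _)

lemma pderiv_zero_mono (m : ℕ × ℕ) :
    MvPolynomial.pderiv 0 (mono m) = (m.1 : ℂ) • mono (m.1 - 1, m.2) := by
  simp [mono, MvPolynomial.pderiv_X, MvPolynomial.smul_eq_C_mul]
  ring

lemma pderiv_one_mono (m : ℕ × ℕ) :
    MvPolynomial.pderiv 1 (mono m) = (m.2 : ℂ) • mono (m.1, m.2 - 1) := by
  simp [mono, MvPolynomial.pderiv_X, MvPolynomial.smul_eq_C_mul]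
  ring

lemma pderiv_zero_mem_polyBox {p q : ℕ} {P : Poly} (hP : P ∈ polyBox p q) :
    MvPolynomial.pderiv 0 P ∈ polyBox (p - 1) q := by
  have h : polyBox p q ≤ (polyBox (p - 1) q).comap (MvPolynomial.pderiv 0).toLinearMap := by
    rw [polyBox_eq_span, Submodule.span_le]
    rintro _ ⟨m, ⟨h1, h2⟩, rfl⟩
    have : MvPolynomial.pderiv 0 (mono m) ∈ polyBox (p - 1) q := by
      rw [pderiv_zero_mono]
      exact Submodule.smul_mem _ _ (mono_mem_polyBox (Nat.sub_le_sub_right h1 1) h2)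
    exact this
  exact h hP

lemma pderiv_one_mem_polyBox {p q : ℕ} {P : Poly} (hP : P ∈ polyBox p q) :
    MvPolynomial.pderiv 1 P ∈ polyBox p (q - 1) := by
  have h : polyBox p q ≤ (polyBox p (q - 1)).comap (MvPolynomial.pderiv 1).toLinearMap := by
    rw [polyBox_eq_span, Submodule.span_le]
    rintro _ ⟨m, ⟨h1, h2⟩, rfl⟩
    have : MvPolynomial.pderiv 1 (mono m) ∈ polyBox p (q - 1) := by
      rw [pderiv_one_mono]
      exact Submodule.smul_mem _ _ (mono_mem_polyBox h1 (Nat.sub_le_sub_right h2 1))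
    exact this
  exact h hP

lemma polyDiv_mem_polyBox {p : ℕ} {V : Fin 2 → Poly} (hV : IsRT p V) :
    polyDiv V ∈ polyBox (p - 1) (p - 1) :=
  add_mem (pderiv_zero_mem_polyBox (mem_polyBox.2 hV.1))
    (pderiv_one_mem_polyBox (mem_polyBox.2 hV.2))

/-! ### Bubbles -/

/-- The space `𝒫⁰_p(K)`. -/
def bubble (p : ℕ) : Submodule ℂ Poly where
  carrier := {P | IsBubble p P}
  zero_mem' := ⟨(polyBox p p).zero_mem, fun i t _ => by simp [Poly.fn]⟩
  add_mem' := fun hP hQ => ⟨(polyBox p p).add_mem hP.1 hQ.1, fun i t ht => by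
    rw [Poly.fn_add, Pi.add_apply, hP.2 i t ht, hQ.2 i t ht, add_zero]⟩
  smul_mem' := fun c P hP => ⟨(polyBox p p).smul_mem c hP.1, fun i t ht => by
    rw [Poly.fn_smul, Pi.smul_apply, hP.2 i t ht, smul_zero]⟩

/-- The space of Raviart-Thomas fields with vanishing normal trace. -/
def rtBubble (p : ℕ) : Submodule ℂ (Fin 2 → Poly) where
  carrier := {V | IsRTBubble p V}
  zero_mem' := ⟨⟨(polyBox _ _).zero_mem, (polyBox _ _).zero_mem⟩,
    fun i t _ => by simp [Poly.fn]⟩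
  add_mem' := fun hP hQ => ⟨⟨(polyBox _ _).add_mem hP.1.1 hQ.1.1,
      (polyBox _ _).add_mem hP.1.2 hQ.1.2⟩, fun i t ht => by
    simp only [Pi.add_apply, Poly.fn_add, add_mul, Finset.sum_add_distrib]
    rw [hP.2 i t ht, hQ.2 i t ht, add_zero]⟩
  smul_mem' := fun c P hP => ⟨⟨(polyBox _ _).smul_mem c hP.1.1, (polyBox _ _).smul_mem c hP.1.2⟩,
    fun i t ht => by
    simp only [Pi.smul_apply, Poly.fn_smul, smul_eq_mul, mul_assoc, ← Finset.mul_sum]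
    rw [hP.2 i t ht, mul_zero]⟩

/-- The normal component of a curl is the tangential derivative, which vanishes because $P$ is zero
along each edge. -/
lemma polyCurl_mem_rtBubble {p : ℕ} {P : Poly} (hP : IsBubble p P) :
    polyCurl P ∈ rtBubble p := by
  refine ⟨⟨pderiv_one_mem_polyBox hP.1, (polyBox _ _).neg_mem (pderiv_zero_mem_polyBox hP.1)⟩,
    fun i t ht => ?_⟩
  let v : Fin 4 → E 2 := ![!₂[1, 0], !₂[0, 1], !₂[-1, 0], !₂[0, -1]]
  have he : ∀ t, edge i 0 + t • v i = edge i t := by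
    intro t
    fin_cases i <;> ext j <;> fin_cases j <;> simp [edge, v, sub_eq_add_neg]
  have hd := P.hasDerivAt_comp_line (edge i 0) (v i) t
  simp only [he] at hd
  -- The vanishing is given only for parameters in $[0,1]$, so derivatives within that interval are
  -- compared; this covers the end points.
  have h0 : HasDerivWithinAt (fun t => P.fn (edge i t)) 0 (Icc 0 1) t :=
    (hasDerivWithinAt_const t (Icc 0 1) (0 : ℂ)).congr (hP.2 i) (hP.2 i t ht)
  have := (uniqueDiffOn_Icc zero_lt_one t ht).eq_deriv _ hd.hasDerivWithinAt h0
  rw [← this]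
  fin_cases i <;> simp [v, normal, polyCurl, Fin.sum_univ_two, Poly.fn]

/-- A monomial minus its mean is the divergence of an explicit bubble. The field
$(x^{a+1}-x)y^b/(a+1)$ in the first component has divergence $x^ay^b-y^b/(a+1)$. The second
component, $(y^{b+1}-y)/((a+1)(b+1))$, replaces the remainder $y^b/(a+1)$ by its mean. -/
lemma mem_span_one_sup_map_polyDiv {p : ℕ} (hp : 1 ≤ p) {Q : Poly} (hQ : IsPoly (p - 1) (p - 1) Q) :
    Q ∈ Submodule.span ℂ {(1 : Poly)} ⊔ (rtBubble p).map polyDivMap := by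
  have h : polyBox (p - 1) (p - 1) ≤
      Submodule.span ℂ {(1 : Poly)} ⊔ (rtBubble p).map polyDivMap := by
    rw [polyBox_eq_span, Submodule.span_le]
    rintro _ ⟨⟨a, b⟩, ⟨ha, hb⟩, rfl⟩
    replace ha : a ≤ p - 1 := ha
    replace hb : b ≤ p - 1 := hb
    let V : Fin 2 → Poly := ![(a + 1 : ℂ)⁻¹ • (mono (a + 1, b) - mono (1, b)),
      ((a + 1 : ℂ)⁻¹ * (b + 1 : ℂ)⁻¹) • (mono (0, b + 1) - mono (0, 1))]
    have hV : V ∈ rtBubble p := by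
      have h0 : V 0 ∈ polyBox p (p - 1) :=
        Submodule.smul_mem _ _ (sub_mem (mono_mem_polyBox (by dsimp; omega) hb)
          (mono_mem_polyBox hp hb))
      have h1 : V 1 ∈ polyBox (p - 1) p :=
        Submodule.smul_mem _ _ (sub_mem (mono_mem_polyBox (Nat.zero_le _) (by dsimp; omega))
          (mono_mem_polyBox (Nat.zero_le _) hp))
      refine ⟨⟨h0, h1⟩, ?_⟩
      intro i t _
      fin_cases i <;> simp [V, normal, edge, Fin.sum_univ_two, Poly.fn, mono]
    have ha0 : (a + 1 : ℂ) ≠ 0 := Nat.cast_add_one_ne_zero a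
    have hb0 : (b + 1 : ℂ) ≠ 0 := Nat.cast_add_one_ne_zero b
    have hd : polyDivMap V = mono (a, b) - ((a + 1 : ℂ)⁻¹ * (b + 1 : ℂ)⁻¹) • 1 := by
      change MvPolynomial.pderiv 0 (V 0) + MvPolynomial.pderiv 1 (V 1) = _
      simp only [V, Matrix.cons_val_zero, Matrix.cons_val_one, Derivation.map_smul, map_sub,
        pderiv_zero_mono, pderiv_one_mono, smul_sub, smul_smul, Nat.cast_add, Nat.cast_one,
        Nat.add_sub_cancel, Nat.sub_self]
      rw [inv_mul_cancel₀ ha0, mul_assoc, inv_mul_cancel₀ hb0]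
      have : mono (0, 0) = 1 := by simp [mono]
      rw [this, one_smul, mul_one, mul_one]
      abel
    have := sub_eq_iff_eq_add.1 hd.symm
    rw [this]
    exact add_mem (Submodule.mem_sup_right (Submodule.mem_map_of_mem hV))
      (Submodule.mem_sup_left (Submodule.smul_mem _ _ (Submodule.mem_span_singleton_self _)))
  exact h hQ

/-! ### Orthogonal projections -/

lemma exists_orthogonal_approx {X H : Type*} [AddCommGroup X] [Module ℂ X] [NormedAddCommGroup H]
    [InnerProductSpace ℂ H] (T : X →ₗ[ℂ] H) (W : Submodule ℂ X) [FiniteDimensional ℂ (W.map T)]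
    (f : H) : ∃ w ∈ W, ∀ v ∈ W, inner ℂ (T v) (f - T w) = 0 := by
  obtain ⟨w, hw, hTw⟩ := ((W.map T).starProjection_apply_mem f : _ ∈ W.map T)
  refine ⟨w, hw, fun v hv => ?_⟩
  have hTw' : T w = (W.map T).starProjection f := hTw
  rw [hTw']
  exact (Submodule.mem_orthogonal _ _).1 (Submodule.sub_starProjection_mem_orthogonal f) _
    (Submodule.mem_map_of_mem hv)

/-! ### The interpolation operator -/

lemma negHalfInner_sub_ofL2 (D : negHalfSpace) (Q V : Poly) :
    negHalfInner ((D : Module.Dual ℂ HHalf) - ofL2 Q.fn) (ofL2 V.fn) =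
      inner ℂ (gradClassMap (polyFunctional V)) (gradClassMap D - gradClassMap (polyFunctional Q)) := by
  rw [← map_sub, ← negHalfInner_eq]
  rfl

/-- The class in `L²(K)²` of the curl of a polynomial. -/
def curlClass : Poly →ₗ[ℂ] LVec 2 2 where
  toFun P := toLVec (fun j => (polyCurl P j).fn) fun j => (polyCurl P j).memLp_fn 2
  map_add' P Q := by
    have : polyCurl (P + Q) = polyCurl P + polyCurl Q := polyCurlMap.map_add P Q
    simp only [this, Pi.add_apply, Poly.fn_add]
    rfl
  map_smul' c P := by
    have : polyCurl (c • P) = c • polyCurl P := polyCurlMap.map_smul c P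
    simp only [this, Pi.smul_apply, Poly.fn_smul]
    rfl

/-- The two sets of equations decouple. A bubble $U_1$ is found by projection for the divergence
equations. Adding the curl of a scalar bubble, found by projection in $L^2(K)^2$, then satisfies the
curl equations and leaves the divergence unchanged. -/
lemma exists_isInteriorPart (p : ℕ) {u : Fin 2 → E 2 → ℂ} (hu : ∀ j, MemLp (u j) 2 (boxVol 2))
    (hD : MemHTildeNegHalf (divNegHalf u)) : ∃ U, IsInteriorPart p u U := by
  let D : negHalfSpace := ⟨divNegHalf u, hD⟩
  let R := lowest u + edgePart p u
  have hle : (rtBubble p).map polyDivMap ≤ polyBox (p - 1) (p - 1) := by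
    rintro _ ⟨V, hV, rfl⟩
    exact polyDiv_mem_polyBox hV.1
  have hfd : FiniteDimensional ℂ ((rtBubble p).map polyDivMap) :=
    Submodule.finiteDimensional_of_le hle
  have hfd2 : FiniteDimensional ℂ (bubble p) :=
    Submodule.finiteDimensional_of_le (S₂ := polyBox p p) fun P hP => hP.1
  have hfd1 : FiniteDimensional ℂ
      ((rtBubble p).map (gradClassMap ∘ₗ polyFunctional ∘ₗ polyDivMap)) := by
    rw [← LinearMap.comp_assoc, Submodule.map_comp]
    infer_instance
  obtain ⟨U₁, hU₁, hort⟩ := exists_orthogonal_approx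
    (gradClassMap ∘ₗ polyFunctional ∘ₗ polyDivMap) (rtBubble p)
    (gradClassMap D - gradClassMap (polyFunctional (polyDiv R)))
  have hv : ∀ j, MemLp (fun x => u j x - ((R + U₁) j).fn x) 2 (boxVol 2) := fun j =>
    (hu j).sub (((R + U₁) j).memLp_fn 2)
  obtain ⟨P, hP, hortP⟩ := exists_orthogonal_approx curlClass (bubble p) (toLVec _ hv)
  refine ⟨U₁ + polyCurl P, (rtBubble p).add_mem hU₁ (polyCurl_mem_rtBubble hP),
    fun V hV => ?_, fun Q hQ => ?_⟩
  · have : polyDiv (R + (U₁ + polyCurl P)) = polyDiv R + polyDiv U₁ := by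
      rw [polyDiv_add R, polyDiv_add U₁, polyDiv_polyCurl, add_zero]
    change negHalfInner ((D : Module.Dual ℂ HHalf) - ofL2 (polyDiv (R + (U₁ + polyCurl P))).fn) _ = 0
    rw [this, negHalfInner_sub_ofL2, map_add, map_add, ← sub_sub]
    exact hort V hV
  · have h := hortP Q hQ
    have e : toLVec _ hv - curlClass P =
        toLVec (fun j x => u j x - ((R + (U₁ + polyCurl P)) j).fn x) fun j =>
          (hu j).sub (((R + (U₁ + polyCurl P)) j).memLp_fn 2) := by
      have e' : (fun j x => u j x - ((R + (U₁ + polyCurl P)) j).fn x) =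
          fun j => (fun x => u j x - ((R + U₁) j).fn x) - (polyCurl P j).fn := by
        funext j x
        simp only [Poly.fn_add, Pi.add_apply, Pi.sub_apply]
        ring
      simp only [e']
      rfl
    rw [e] at h
    exact (inner_toLVec _ _).symm.trans h

/-- Conservation of mass: both divergences pair with $1$ to the total edge flux, the area of $K$
being $1$. Only membership of $U$ among the bubbles enters, not its equations. -/
lemma inner_one_sub_eq_zero {p : ℕ} {r : ℝ} (hr : 0 < r) {u : Fin 2 → E 2 → ℂ}
    (hu : ∀ j, MemSobolev r (u j)) (D : negHalfSpace) (hD : (D : Module.Dual ℂ HHalf) = divNegHalf u)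
    {U : Fin 2 → Poly} (hU : IsRTBubble p U) :
    inner ℂ (gradClassMap (polyFunctional 1)) (gradClassMap D -
      gradClassMap (polyFunctional (polyDiv (lowest u + edgePart p u + U)))) = 0 := by
  have hflux := sum_edgeFlux hr hu (hD ▸ D.2)
  have hdiv : polyDiv (lowest u + edgePart p u + U) =
      MvPolynomial.C (∑ i, edgeFlux u i) + polyDiv U := by
    rw [polyDiv_add, polyDiv_add, polyDiv_edgePart, add_zero, polyDiv_lowest]
  rw [inner_sub_right, inner_gradClass_one, inner_gradClass_one, hD, ← hflux, hdiv,
    coe_polyFunctional, pairing_of_mem _ one_mem_HHalf, ofL2_apply (Poly.memLp_fn _ 2), Poly.fn_add]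
  have h1 : ∫ x, Poly.fn (MvPolynomial.C (∑ i, edgeFlux u i)) x ∂(boxVol 2) =
      ∑ i, edgeFlux u i := by
    have := isProbabilityMeasure_boxVol_two
    simp [Poly.fn]
  have h2 := integral_add (μ := boxVol 2)
    ((Poly.memLp_fn (MvPolynomial.C (∑ i, edgeFlux u i)) 2).integrable (by norm_num))
    ((Poly.memLp_fn (polyDiv U) 2).integrable (by norm_num))
  rw [h1, integral_polyDiv_of_isRTBubble hU, add_zero] at h2
  simp only [Pi.add_apply, mul_one]
  rw [h2, sub_self]

lemma isNegHalfProj_polyDiv_interp {p : ℕ} (hp : 1 ≤ p) {r : ℝ} (hr : 0 < r)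
    {u : Fin 2 → E 2 → ℂ} (hu : ∀ j, MemSobolev r (u j)) (hD : MemHTildeNegHalf (divNegHalf u)) :
    IsNegHalfProj (p - 1) (divNegHalf u) (polyDiv (interp p u)) := by
  obtain ⟨hU, hort, -⟩ : IsInteriorPart p u (interiorPart p u) := by
    have h := exists_isInteriorPart p (fun j => (hu j).memLp) hD
    rw [interiorPart, dif_pos h]
    exact h.choose_spec
  let D : negHalfSpace := ⟨divNegHalf u, hD⟩
  have hinterp : interp p u = lowest u + edgePart p u + interiorPart p u := rfl
  refine ⟨?_, fun V hV => ?_⟩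
  · rw [hinterp, polyDiv_add, polyDiv_add, polyDiv_edgePart, add_zero, polyDiv_lowest]
    refine (polyBox _ _).add_mem ⟨?_, ?_⟩ (polyDiv_mem_polyBox hU.1)
    · rw [MvPolynomial.degreeOf_C]; exact Nat.zero_le _
    · rw [MvPolynomial.degreeOf_C]; exact Nat.zero_le _
  · change negHalfInner ((D : Module.Dual ℂ HHalf) - _) _ = 0
    rw [negHalfInner_sub_ofL2, hinterp]
    obtain ⟨_, hc, _, ⟨W, hW, rfl⟩, rfl⟩ :=
      Submodule.mem_sup.1 (mem_span_one_sup_map_polyDiv hp hV)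
    obtain ⟨c, rfl⟩ := Submodule.mem_span_singleton.1 hc
    rw [map_add, map_add, inner_add_left, map_smul, map_smul, inner_smul_left,
      inner_one_sub_eq_zero hr hu D rfl hU, mul_zero, zero_add, ← negHalfInner_sub_ofL2]
    exact hort W hW

/-- The difference of two projections is itself an admissible test polynomial, hence orthogonal to
itself. -/
lemma IsNegHalfProj.unique {q : ℕ} {D : Module.Dual ℂ HHalf} (hD : MemHTildeNegHalf D) {Q Q' : Poly}
    (hQ : IsNegHalfProj q D Q) (hQ' : IsNegHalfProj q D Q') : Q = Q' := by
  refine sub_eq_zero.1 (polyFunctional_eq_zero_of_gradClassMap ?_)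
  have hV := (polyBox q q).sub_mem hQ.1 hQ'.1
  have h1 := (negHalfInner_sub_ofL2 ⟨D, hD⟩ Q _).symm.trans (hQ.2 _ hV)
  have h2 := (negHalfInner_sub_ofL2 ⟨D, hD⟩ Q' _).symm.trans (hQ'.2 _ hV)
  rw [← inner_self_eq_zero (𝕜 := ℂ)]
  nth_rw 2 [map_sub]
  rw [map_sub gradClassMap (polyFunctional Q), ← sub_sub_sub_cancel_left _ _ (gradClassMap ⟨D, hD⟩),
    inner_sub_right, h1, h2, sub_zero]

lemma IsNegHalfProj.eq_projNegHalf {q : ℕ} {D : Module.Dual ℂ HHalf} (hD : MemHTildeNegHalf D)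
    {Q : Poly} (hQ : IsNegHalfProj q D Q) : Q = projNegHalf q D := by
  have h : ∃ Q, IsNegHalfProj q D Q := ⟨Q, hQ⟩
  rw [projNegHalf, dif_pos h]
  exact hQ.unique hD h.choose_spec

end RTInterp

end

theorem mainTheorem3 (p : ℕ) (hp : 1 ≤ p) (r : ℝ) (hr : 0 < r)
    (u : Fin 2 → RTInterp.E 2 → ℂ)
    (hu : ∀ j, RTInterp.MemSobolev r (u j))
    (hdiv : RTInterp.MemHTildeDiv u) :
    RTInterp.polyDiv (RTInterp.interp p u) =
      RTInterp.projNegHalf (p - 1) (RTInterp.divNegHalf u) := by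
  have hD := RTInterp.memHTildeNegHalf_divNegHalf hdiv
  exact (RTInterp.isNegHalfProj_polyDiv_interp hp hr hu hD).eq_projNegHalf hD
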